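/- Let $1\le d\le 3$, let $\Omega=[0,1]^d$ be the torus (opposite points identified), let $T>0$ and $\bar\gamma>\max(1,d/2)$, and write $H^s=H^s(\Omega)$ for the $L^2$-based Sobolev spaces, with $\|g\|_{H^s}^2=\sum_{n\in\mathbb Z^d}(1+4\pi^2|n|^2)^s|\hat g(n)|^2$, $\hat g$ being the Fourier coefficients, and $H^{-1}=(H^1)^*$. Let $f\in C_c^\infty(\mathbb R)$ and $\theta_0\in C^\infty(\Omega)$ be fixed real-valued functions. Given $F$ on $[0,T]\times\Omega$ and $\theta\in L^2(\Omega)$, a *weak solution* of $\partial_t u-\Delta u=F$, $u(0)=\theta$, is a map $u\in L^2([0,T],H^1)\cap C([0,T],L^2)$ with $u'\in L^2([0,T],H^{-1})$, $u(0)=\theta$ and $\langle u',v\rangle+\langle\nabla u,\nabla v\rangle_{L^2}=\langle F,v\rangle_{L^2}$ for all $v\in H^1$ and a.e. $t\in(0,T)$; it is a *strong solution* if moreover $u\in L^2([0,T],H^2)\cap C([0,T],H^1)$ and $u'\in L^2([0,T],L^2)$. Write $u_\theta$ for the weak solution of the reaction-diffusion equation $$\partial_t u-\Delta u=f(u),\qquad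 u(0)=\theta .$$ **Theorem.** (i) For $\theta=\theta_0$, the solution $u_{\theta_0}$ exists, is unique on $[0,T]$, is a strong solution, and satisfies $\sup_{0\le t\le T}\|u_{\theta_0}(t)\|_{H^{\bar\gamma}}<\infty$. The potential $V(t,\cdot)=f'(u_{\theta_0}(t,\cdot))$ lies in $\bigcap_{b>0}C^1([0,T],C^b(\Omega))$, where $C^1([0,T],X)$ is the space of weakly differentiable maps $H:[0,T]\to X$ with $\sup_t\|H(t)\|_X+\operatorname{ess\,sup}_t\|H'(t)\|_X<\infty$. (ii) For every $B$ there is a constant $C=C(B,\bar\gamma,T)>0$ (which may also depend on the fixed $d,f,\theta_0$) such that for every $h\in H^{\bar\gamma}$ with $\|\theta_0+h\|_{H^{\bar\gamma}}\le B$: the solution $u_{\theta_0+h}$ exists, is unique on $[0,T]$, is a strong solution and satisfies $\sup_{0\le t\le T}\|u_{\theta_0+h}(t)\|_{H^{\bar\gamma}}<\infty$; the linear Schrödinger-type equation $$\partial_t U-\Delta U-V\,U=0,\qquad U(0)=h,$$ has a unique weak solution $U_h$ on $[0,T]$; and $$\sup_{0\le t\le T}\|u_{\theta_0+h}(t)-u_{\theta_0}(t)-U_h(t)\|_{L^2(\Omega)}\le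 C\,\|h\|_{L^2(\Omega)}^2 .$$ -/

import Mathlib

open MeasureTheory Set
open scoped ContDiff InnerProductSpace

noncomputable section

/-- The flat torus `Ω = [0,1]^d` with opposite points identified. -/
abbrev Torus (d : ℕ) : Type := Fin d → UnitAddCircle

/-- Lebesgue measure on the torus, of total mass one. -/
abbrev torusMeasure (d : ℕ) : Measure (Torus d) :=
  Measure.pi fun _ : Fin d => AddCircle.haarAddCircle

/-- The real Hilbert space `L²(Ω)`. -/
abbrev L2 (d : ℕ) : Type := Lp ℝ 2 (torusMeasure d)

/-- The `1`-periodic function on `ℝ^d` that corresponds to a function on the torus. -/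
def periodicLift {d : ℕ} (φ : Torus d → ℝ) : (Fin d → ℝ) → ℝ :=
  fun y => φ fun i => ((y i : ℝ) : UnitAddCircle)

/-- `φ ∈ C^∞(Ω)`. -/
def IsSmooth {d : ℕ} (φ : Torus d → ℝ) : Prop := ContDiff ℝ ∞ (periodicLift φ)

/-- The partial derivative `∂φ/∂x_i` of a function on the torus. -/
def torusDeriv {d : ℕ} (i : Fin d) (φ : Torus d → ℝ) : Torus d → ℝ :=
  fun x => deriv (fun s : ℝ => φ (x + Pi.single i (s : UnitAddCircle))) 0

/-- The iterated partial derivative `∂_{i₁} ⋯ ∂_{i_k} φ` for a list of indices. -/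
def iterTorusDeriv {d : ℕ} (α : List (Fin d)) (φ : Torus d → ℝ) : Torus d → ℝ :=
  α.foldr torusDeriv φ

/-- `g'` is the weak partial derivative of `g` in the direction of the `i`-th coordinate. -/
def IsWeakPartial {d : ℕ} (i : Fin d) (g g' : L2 d) : Prop :=
  ∀ φ : Torus d → ℝ, IsSmooth φ →
    ∫ x, g x * torusDeriv i φ x ∂(torusMeasure d) = -∫ x, g' x * φ x ∂(torusMeasure d)

/-! Smooth functions on the torus and their derivatives are continuous; this is needed for the
linearity of the weak derivative. -/

theorem isOpenQuotientMap_torus (d : ℕ) :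
    IsOpenQuotientMap (fun (y : Fin d → ℝ) (i : Fin d) => ((y i : ℝ) : UnitAddCircle)) :=
  IsOpenQuotientMap.piMap fun _ => QuotientAddGroup.isOpenQuotientMap_mk

theorem IsSmooth.continuous {d : ℕ} {φ : Torus d → ℝ} (h : IsSmooth φ) : Continuous φ :=
  ((isOpenQuotientMap_torus d).isQuotientMap.continuous_iff).2 (ContDiff.continuous h)

theorem periodicLift_torusDeriv {d : ℕ} {φ : Torus d → ℝ} (h : IsSmooth φ) (i : Fin d) :
    periodicLift (torusDeriv i φ)
      = fun y => fderiv ℝ (periodicLift φ) y (Pi.single i 1) := by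
  funext y
  have hd : HasFDerivAt (periodicLift φ) (fderiv ℝ (periodicLift φ) y)
      (y + (0 : ℝ) • Pi.single i (1 : ℝ)) := by
    rw [zero_smul, add_zero]
    exact ((ContDiff.differentiable h (by simp)) y).hasFDerivAt
  have hl : HasDerivAt (fun s : ℝ => y + s • (Pi.single i (1 : ℝ) : Fin d → ℝ))
      (Pi.single i (1 : ℝ)) 0 := by
    simpa using ((hasDerivAt_id (0 : ℝ)).smul_const (Pi.single i (1 : ℝ) : Fin d → ℝ)).const_add y
  have hc := hd.comp_hasDerivAt (0 : ℝ) hl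
  have he : (fun s : ℝ => φ ((fun j => ((y j : ℝ) : UnitAddCircle))
        + Pi.single i (s : UnitAddCircle)))
      = periodicLift φ ∘ fun s : ℝ => y + s • (Pi.single i (1 : ℝ) : Fin d → ℝ) := by
    funext s
    simp only [periodicLift, Function.comp]
    congr 1
    funext j
    by_cases hj : j = i
    · subst hj
      simp
    · simp [hj]
  change deriv (fun s : ℝ => φ ((fun j => ((y j : ℝ) : UnitAddCircle))
        + Pi.single i (s : UnitAddCircle))) 0 = _
  rw [he]
  exact hc.deriv

theorem IsSmooth.torusDeriv {d : ℕ} {φ : Torus d → ℝ} (h : IsSmooth φ) (i : Fin d) :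
    IsSmooth (torusDeriv i φ) := by
  unfold IsSmooth
  rw [periodicLift_torusDeriv h i]
  exact (ContDiff.fderiv_right (m := ∞) h (by simp)).clm_apply contDiff_const

theorem integrable_L2_mul_smooth {d : ℕ} (g : L2 d) {φ : Torus d → ℝ} (h : IsSmooth φ) :
    Integrable (fun x => g x * φ x) (torusMeasure d) := by
  have hφ : MemLp φ 2 (torusMeasure d) := by
    have hb : ∃ C, ∀ x, ‖φ x‖ ≤ C := by
      obtain ⟨C, hC⟩ := isCompact_univ.exists_bound_of_continuousOn h.continuous.continuousOn
      exact ⟨C, fun x => hC x (mem_univ x)⟩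
    obtain ⟨C, hC⟩ := hb
    exact MemLp.of_bound h.continuous.aestronglyMeasurable C (Filter.Eventually.of_forall hC)
  exact (Lp.memLp g).integrable_mul hφ

/-- The pairs of a function in `L²(Ω)` and its weak gradient in `L²(Ω)^d`. -/
def h1Submodule (d : ℕ) : Submodule ℝ (L2 d × (Fin d → L2 d)) where
  carrier := {p | ∀ i, IsWeakPartial i p.1 (p.2 i)}
  zero_mem' := by
    intro i φ _
    have h0 : ∀ᵐ x ∂(torusMeasure d), (0 : L2 d) x = 0 := Lp.coeFn_zero _ _ _
    have h1 : ∀ ψ : Torus d → ℝ, ∫ x, (0 : L2 d) x * ψ x ∂(torusMeasure d) = 0 := by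
      intro ψ
      apply integral_eq_zero_of_ae
      filter_upwards [h0] with x hx
      rw [hx, zero_mul, Pi.zero_apply]
    exact (h1 _).trans (by rw [← neg_zero]; exact congrArg _ (h1 φ).symm)
  add_mem' := by
    intro p q hp hq i φ hφ
    have e1 : ∫ x, (p + q).1 x * torusDeriv i φ x ∂(torusMeasure d)
        = ∫ x, (p.1 x * torusDeriv i φ x + q.1 x * torusDeriv i φ x) ∂(torusMeasure d) := by
      apply integral_congr_ae
      filter_upwards [Lp.coeFn_add p.1 q.1] with x hx
      simp only [Prod.fst_add, hx, Pi.add_apply, add_mul]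
    have e2 : ∫ x, (p + q).2 i x * φ x ∂(torusMeasure d)
        = ∫ x, (p.2 i x * φ x + q.2 i x * φ x) ∂(torusMeasure d) := by
      apply integral_congr_ae
      filter_upwards [Lp.coeFn_add (p.2 i) (q.2 i)] with x hx
      simp only [Prod.snd_add, Pi.add_apply, hx, add_mul]
    rw [e1, e2, integral_add (integrable_L2_mul_smooth _ (hφ.torusDeriv i))
      (integrable_L2_mul_smooth _ (hφ.torusDeriv i)),
      integral_add (integrable_L2_mul_smooth _ hφ) (integrable_L2_mul_smooth _ hφ),
      hp i φ hφ, hq i φ hφ]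
    ring
  smul_mem' := by
    intro c p hp i φ hφ
    have e1 : ∫ x, (c • p).1 x * torusDeriv i φ x ∂(torusMeasure d)
        = ∫ x, c * (p.1 x * torusDeriv i φ x) ∂(torusMeasure d) := by
      apply integral_congr_ae
      filter_upwards [Lp.coeFn_smul c p.1] with x hx
      simp only [Prod.smul_fst, hx, Pi.smul_apply, smul_eq_mul, mul_assoc]
    have e2 : ∫ x, (c • p).2 i x * φ x ∂(torusMeasure d)
        = ∫ x, c * (p.2 i x * φ x) ∂(torusMeasure d) := by
      apply integral_congr_ae
      filter_upwards [Lp.coeFn_smul c (p.2 i)] with x hx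
      simp only [Prod.smul_snd, Pi.smul_apply, hx, smul_eq_mul, mul_assoc]
    rw [e1, e2, integral_const_mul, integral_const_mul, hp i φ hφ]
    ring

/-- The Sobolev space `H¹(Ω)` of functions in `L²(Ω)` with weak gradient in `L²(Ω)^d`. The norm
inherited from the product of `L²` spaces is equivalent to the usual `H¹` norm. -/
def H1 (d : ℕ) : Type := h1Submodule d

instance (d : ℕ) : NormedAddCommGroup (H1 d) := inferInstanceAs (NormedAddCommGroup (h1Submodule d))

instance (d : ℕ) : NormedSpace ℝ (H1 d) := inferInstanceAs (NormedSpace ℝ (h1Submodule d))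

/-- The inclusion of `H¹(Ω)` into `L²(Ω)`. -/
def H1.toL2 {d : ℕ} : H1 d →L[ℝ] L2 d :=
  (ContinuousLinearMap.fst ℝ (L2 d) (Fin d → L2 d)).comp (h1Submodule d).subtypeL

/-- The weak partial derivative `∂_i : H¹(Ω) → L²(Ω)`. -/
def H1.partialDeriv {d : ℕ} (i : Fin d) : H1 d →L[ℝ] L2 d :=
  ((ContinuousLinearMap.proj i).comp (ContinuousLinearMap.snd ℝ (L2 d) (Fin d → L2 d))).comp
    (h1Submodule d).subtypeL

/-- The dual space `H^{-1}(Ω) = (H¹(Ω))^*`. -/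
abbrev HNegOne (d : ℕ) : Type := StrongDual ℝ (H1 d)

/-- The inclusion of `L²(Ω)` into `H^{-1}(Ω)`, `g ↦ ⟨g, ·⟩_{L²}`. -/
def toHNegOne {d : ℕ} (g : L2 d) : HNegOne d := (innerSL ℝ g).comp H1.toL2

/-- The Laplace eigenvalue `λ_n = 4π²|n|²` of `e_n(x) = e^{2πi n·x}`, `-Δ e_n = λ_n e_n`. -/
def laplaceEigenvalue {d : ℕ} (n : Fin d → ℤ) : ℝ :=
  (2 * Real.pi) ^ 2 * ∑ i, (n i : ℝ) ^ 2

/-- The Sobolev norm `‖g‖_{H^s} = (∑_n (1 + λ_n)^s |⟨g, e_n⟩|²)^{1/2}` for real order `s`, with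
value `∞` if `g ∉ H^s(Ω)`. -/
def sobolevNorm {d : ℕ} (s : ℝ) (g : L2 d) : ENNReal :=
  (∑' n : Fin d → ℤ, ENNReal.ofReal ((1 + laplaceEigenvalue n) ^ s *
    ‖UnitAddTorus.mFourierCoeff (fun x => ((g x : ℝ) : ℂ)) n‖ ^ 2)) ^ (1 / 2 : ℝ)

/-- `u` is a weak solution on `[0,T] × Ω` of `∂u/∂t - Δu = F`, `u(0) = θ`: `u` belongs to
`L²([0,T], H¹) ∩ C([0,T], L²)` with weak time derivative `u' ∈ L²([0,T], H^{-1})` and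
`⟨u', v⟩ + ⟨∇u, ∇v⟩ = ⟨F, v⟩` for all `v ∈ H¹` and a.e. `t`. -/
structure IsWeakSolution {d : ℕ} (T : ℝ) (F : ℝ → Torus d → ℝ) (θ : L2 d) (u : ℝ → L2 d) :
    Prop where
  continuousOn : ContinuousOn u (Icc 0 T)
  initial : u 0 = θ
  weak : ∃ (uH : ℝ → H1 d) (u' : ℝ → HNegOne d),
    MemLp uH 2 (volume.restrict (Icc 0 T)) ∧
    (∀ᵐ t ∂(volume.restrict (Icc 0 T)), H1.toL2 (uH t) = u t) ∧
    MemLp u' 2 (volume.restrict (Icc 0 T)) ∧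
    (∀ t ∈ Icc 0 T, toHNegOne (u t) = toHNegOne (u 0) + ∫ s in 0..t, u' s) ∧
    ∀ᵐ t ∂(volume.restrict (Icc 0 T)), ∀ v : H1 d,
      u' t v + ∑ i, ⟪H1.partialDeriv i (uH t), H1.partialDeriv i v⟫_ℝ
        = ∫ x, F t x * H1.toL2 v x ∂(torusMeasure d)

/-- `u` is a strong solution of `∂u/∂t - Δu = F`, `u(0) = θ`: a weak solution that in addition
belongs to `L²([0,T], H²) ∩ C([0,T], H¹)` and has `u' ∈ L²([0,T], L²)`. -/
structure IsStrongSolution {d : ℕ} (T : ℝ) (F : ℝ → Torus d → ℝ) (θ : L2 d) (u : ℝ → L2 d) :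
    Prop extends IsWeakSolution T F θ u where
  continuousOn_H1 : ∃ uH : ℝ → H1 d, ContinuousOn uH (Icc 0 T) ∧ ∀ t ∈ Icc 0 T, H1.toL2 (uH t) = u t
  square_integrable_H2 : ∫⁻ t in Icc 0 T, sobolevNorm 2 (u t) ^ 2 < ⊤
  deriv_L2 : ∃ u' : ℝ → L2 d, MemLp u' 2 (volume.restrict (Icc 0 T)) ∧
    ∀ t ∈ Icc 0 T, u t = u 0 + ∫ s in 0..t, u' s

/-- The space `C¹([0,T], X)` of weakly differentiable maps with `sup ‖H(t)‖ + ess sup ‖H'(t)‖`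
finite. -/
def MemC1 {X : Type*} [NormedAddCommGroup X] [NormedSpace ℝ X] (T : ℝ) (H : ℝ → X) : Prop :=
  ∃ H' : ℝ → X, MemLp H' ⊤ (volume.restrict (Icc 0 T)) ∧
    ∀ t ∈ Icc 0 T, H t = H 0 + ∫ s in 0..t, H' s

/-- `V ∈ ⋂_{b > 0} C¹([0,T], C^b(Ω))`: up to null sets of `Ω`, `V(t)` is smooth for every `t`, and
every partial derivative of `V` in the space variables lies in `C¹([0,T], C(Ω))`. -/
def IsC1Infty {d : ℕ} (T : ℝ) (V : ℝ → Torus d → ℝ) : Prop :=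
  ∃ W : ℝ → Torus d → ℝ, (∀ t ∈ Icc 0 T, V t =ᵐ[torusMeasure d] W t) ∧
    (∀ t ∈ Icc 0 T, IsSmooth (W t)) ∧
    ∀ α : List (Fin d), ∃ G : ℝ → C(Torus d, ℝ),
      (∀ t ∈ Icc 0 T, ∀ x, G t x = iterTorusDeriv α (W t) x) ∧ MemC1 T G

/-- The unique weak solution of the reaction-diffusion equation `∂u/∂t - Δu = f(u)`, `u(0) = θ`, on
`[0,T] × Ω`, which is moreover strong. Solutions are identified if they agree on `[0,T]`. -/
def IsReactionDiffusionSolution {d : ℕ} (f : ℝ → ℝ) (T : ℝ) (θ : L2 d) (u : ℝ → L2 d) : Prop :=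
  IsStrongSolution T (fun t x => f (u t x)) θ u ∧
    ∀ w : ℝ → L2 d, IsWeakSolution T (fun t x => f (w t x)) θ w → EqOn w u (Icc 0 T)

/-- The unique weak solution of the linear Schrödinger equation `∂U/∂t - ΔU - V U = 0`, `U(0) = h`,
on `[0,T] × Ω`. Solutions are identified if they agree on `[0,T]`. -/
def IsSchrodingerSolution {d : ℕ} (V : ℝ → Torus d → ℝ) (T : ℝ) (h : L2 d) (U : ℝ → L2 d) : Prop :=
  IsWeakSolution T (fun t x => V t x * U t x) h U ∧
    ∀ w : ℝ → L2 d, IsWeakSolution T (fun t x => V t x * w t x) h w → EqOn w U (Icc 0 T)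

end

/-! The equation is diagonal in an eigenbasis of the Laplacian. As `L2 d` is a real space, the basis
consists of the Hartley functions cos + sin. Each coefficient of a solution of u' - Δu = G obeys a'
= -λ_n a + g and is given by Duhamel's formula (`duhamel`); all estimates are made mode by mode and
then summed.

Well-posedness. Since f is smooth with compact support, f and f' are bounded and Lipschitz, so g ↦ f
∘ g is Lipschitz on L². Mild solutions exist on all of [0,T] by contraction in an exponentially
weighted norm (`exists_isMild`). Testing with Hartley functions shows that weak solutions are mild
(`IsWeakSolution.isMild`), hence unique by Gronwall, and mild solutions with H¹ data are strong
(`IsMild.isStrongSolution`).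

Regularity. A source bounded in H^σ uniformly in time produces a solution bounded in H^(σ+7/4), up
to the regularity of the initial value (`IsMild.exists_hsBound`). Composition with f costs only 3/4
of a derivative (`exists_hsBound_superpose`): for d ≤ 3 an H^(k+3/4) bound controls all derivatives
of order below k in the sup norm, and the k-th one enters the k-th derivative of f ∘ u linearly.
Each round gains one derivative, until the regularity of the initial value is reached. For smooth θ₀
the coefficients of u and of f(u) therefore decay faster than any power, uniformly in time; by the
equation so do those of u', and f'(u) is smooth in space and C¹ in time.

Linearization. The error w = u₁ - u₀ - U satisfies w' - Δw = V w + R, w(0) = 0, where |R| ≤ K |u₁ -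
u₀|² pointwise. This controls R only in L¹, by a multiple of ‖h‖². But an L¹ bound bounds every
coefficient, Duhamel's formula gains the factor 1/(1+λ_n), and the sum of (1+λ_n)^(-2) converges for
d ≤ 3. The term V w is absorbed by Gronwall (`norm_sq_le_of_coeff_eq`). -/

noncomputable section

open UnitAddTorus

/-! ### The Hartley basis of the real space `L²(Ω)` -/

/-- The real eigenfunction `cos (2π n·x) + sin (2π n·x)` of the Laplacian. -/
def hartley {d : ℕ} (n : Fin d → ℤ) : C(Torus d, ℝ) :=
  ⟨fun x => (mFourier n x).re + (mFourier n x).im, by fun_prop⟩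

theorem hartley_apply {d : ℕ} (n : Fin d → ℤ) (x : Torus d) :
    hartley n x = (mFourier n x).re + (mFourier n x).im := rfl

theorem mFourier_neg_re {d : ℕ} (n : Fin d → ℤ) (x : Torus d) :
    (mFourier (-n) x).re = (mFourier n x).re := by
  rw [mFourier_neg, Complex.conj_re]

theorem mFourier_neg_im {d : ℕ} (n : Fin d → ℤ) (x : Torus d) :
    (mFourier (-n) x).im = -(mFourier n x).im := by
  rw [mFourier_neg, Complex.conj_im]

theorem hartley_neg_apply {d : ℕ} (n : Fin d → ℤ) (x : Torus d) :
    hartley (-n) x = (mFourier n x).re - (mFourier n x).im := by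
  rw [hartley_apply, mFourier_neg_re, mFourier_neg_im, sub_eq_add_neg]

/-- The addition theorem (cos a + sin a)(cos b + sin b) = sin(a+b) + cos(a-b). The sine has mean
zero at every frequency, so only n = m survives integration. -/
theorem hartley_mul_hartley {d : ℕ} (n m : Fin d → ℤ) (x : Torus d) :
    hartley n x * hartley m x = (mFourier (n + m) x).im + (mFourier (n + -m) x).re := by
  simp only [hartley_apply, mFourier_add, Complex.mul_re, Complex.mul_im, mFourier_neg_re,
    mFourier_neg_im]
  ring

theorem abs_hartley_le {d : ℕ} (n : Fin d → ℤ) (x : Torus d) : |hartley n x| ≤ 2 := by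
  have h : ‖mFourier n x‖ ≤ 1 := ((mFourier n).norm_coe_le_norm x).trans_eq mFourier_norm
  have h1 := (Complex.abs_re_le_norm (mFourier n x)).trans h
  have h2 := (Complex.abs_im_le_norm (mFourier n x)).trans h
  rw [hartley_apply]
  exact (abs_add_le _ _).trans (by linarith)

theorem integrable_mFourier {d : ℕ} (n : Fin d → ℤ) :
    Integrable (fun x => mFourier n x) (torusMeasure d) :=
  Integrable.of_bound (mFourier n).continuous.aestronglyMeasurable 1
    (Filter.Eventually.of_forall fun x => ((mFourier n).norm_coe_le_norm x).trans_eq mFourier_norm)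

theorem integral_mFourier {d : ℕ} (n : Fin d → ℤ) :
    ∫ x, mFourier n x ∂(torusMeasure d) = if n = 0 then 1 else 0 := by
  have h := orthonormal_iff_ite.1 (orthonormal_mFourier (d := Fin d)) 0 n
  simp only [ContinuousMap.inner_toLp, ← mFourier_neg, ← mFourier_add] at h
  simp only [neg_zero, add_zero, eq_comm (a := (0 : Fin d → ℤ))] at h
  exact h

theorem integral_hartley_mul_hartley {d : ℕ} (n m : Fin d → ℤ) :
    ∫ x, hartley n x * hartley m x ∂(torusMeasure d) = if n = m then 1 else 0 := by
  simp only [hartley_mul_hartley]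
  have e1 : ∫ x, (mFourier (n + m) x).im ∂(torusMeasure d) = 0 := by
    have := integral_im (𝕜 := ℂ) (integrable_mFourier (n + m))
    simp only [RCLike.im_eq_complex_im] at this
    rw [this, integral_mFourier]
    split_ifs <;> simp
  have e2 : ∫ x, (mFourier (n + -m) x).re ∂(torusMeasure d) = if n = m then 1 else 0 := by
    have := integral_re (𝕜 := ℂ) (integrable_mFourier (n + -m))
    simp only [RCLike.re_eq_complex_re] at this
    rw [this, integral_mFourier]
    simp only [add_neg_eq_zero]
    split_ifs <;> simp
  have i1 : Integrable (fun x => (mFourier (n + m) x).im) (torusMeasure d) :=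
    (integrable_mFourier _).im
  have i2 : Integrable (fun x => (mFourier (n + -m) x).re) (torusMeasure d) :=
    (integrable_mFourier _).re
  rw [integral_add i1 i2, e1, e2, zero_add]

/-- The element of `L²(Ω)` given by a continuous function. -/
abbrev contL2 {d : ℕ} : C(Torus d, ℝ) →L[ℝ] L2 d := ContinuousMap.toLp 2 (torusMeasure d) ℝ

theorem coeFn_contL2 {d : ℕ} (φ : C(Torus d, ℝ)) : contL2 φ =ᵐ[torusMeasure d] φ :=
  ContinuousMap.coeFn_toLp (torusMeasure d) φ

theorem orthonormal_hartley (d : ℕ) :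
    Orthonormal ℝ fun n : Fin d → ℤ => contL2 (hartley n) := by
  rw [orthonormal_iff_ite]
  intro n m
  rw [ContinuousMap.inner_toLp]
  simp only [conj_trivial]
  have := integral_hartley_mul_hartley m n
  simp only [eq_comm (a := m)] at this
  exact this

/-- The coefficient of `g` with respect to the Hartley function of frequency `n`. -/
def coeff {d : ℕ} (n : Fin d → ℤ) : L2 d →L[ℝ] ℝ := innerSL ℝ (contL2 (hartley n))

theorem coeff_apply {d : ℕ} (n : Fin d → ℤ) (g : L2 d) :
    coeff n g = ⟪contL2 (hartley n), g⟫_ℝ := rfl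

theorem inner_eq_integral {d : ℕ} (g h : L2 d) :
    ⟪g, h⟫_ℝ = ∫ x, g x * h x ∂(torusMeasure d) := by
  rw [MeasureTheory.L2.inner_def]
  simp [mul_comm]

theorem coeff_eq_integral {d : ℕ} (n : Fin d → ℤ) (g : L2 d) :
    coeff n g = ∫ x, hartley n x * g x ∂(torusMeasure d) := by
  rw [coeff_apply, inner_eq_integral]
  apply integral_congr_ae
  filter_upwards [coeFn_contL2 (hartley n)] with x hx
  rw [hx]

theorem integrable_mul_cont {d : ℕ} (φ : C(Torus d, ℝ)) {g : Torus d → ℝ}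
    (hg : Integrable g (torusMeasure d)) : Integrable (fun x => φ x * g x) (torusMeasure d) :=
  hg.bdd_mul φ.continuous.aestronglyMeasurable
    (Filter.Eventually.of_forall fun x => φ.norm_coe_le_norm x)

theorem integrable_L2 {d : ℕ} (g : L2 d) : Integrable g (torusMeasure d) :=
  (Lp.memLp g).integrable (by norm_num)

/-- The bridge to the complex coefficients that define the Sobolev norm: cosine and sine are the
even and odd parts of `hartley n` under n ↦ -n. -/
theorem mFourierCoeff_ofReal {d : ℕ} (g : L2 d) (n : Fin d → ℤ) :
    mFourierCoeff (fun x => ((g x : ℝ) : ℂ)) n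
      = ((coeff n g + coeff (-n) g) / 2 : ℝ) - ((coeff n g - coeff (-n) g) / 2 : ℝ) * Complex.I := by
  have hi : Integrable (fun x => mFourier (-n) x * ((g x : ℝ) : ℂ)) (torusMeasure d) :=
    (integrable_L2 g).ofReal.bdd_mul (mFourier (-n)).continuous.aestronglyMeasurable
      (Filter.Eventually.of_forall fun x => (mFourier (-n)).norm_coe_le_norm x)
  have h0 : mFourierCoeff (fun x => ((g x : ℝ) : ℂ)) n
      = ∫ x, mFourier (-n) x * ((g x : ℝ) : ℂ) ∂(torusMeasure d) := rfl
  have h1 := integral_re (𝕜 := ℂ) hi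
  have h2 := integral_im (𝕜 := ℂ) hi
  simp only [RCLike.re_eq_complex_re, RCLike.im_eq_complex_im, Complex.re_mul_ofReal,
    Complex.im_mul_ofReal, mFourier_neg_re, mFourier_neg_im] at h1 h2
  have i1 := integrable_mul_cont (hartley n) (integrable_L2 g)
  have i2 := integrable_mul_cont (hartley (-n)) (integrable_L2 g)
  rw [h0]
  apply Complex.ext
  · rw [← h1]
    simp only [Complex.sub_re, Complex.ofReal_re, Complex.mul_re, Complex.I_re, Complex.I_im,
      Complex.ofReal_im, mul_zero, zero_mul, sub_zero]
    rw [coeff_eq_integral, coeff_eq_integral, ← integral_add i1 i2, ← integral_div]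
    congr 1
    funext x
    rw [hartley_apply, hartley_neg_apply]
    ring
  · rw [← h2]
    simp only [Complex.sub_im, Complex.ofReal_re, Complex.mul_im, Complex.I_re, Complex.I_im,
      Complex.ofReal_im, mul_zero, mul_one, zero_sub, add_zero]
    rw [coeff_eq_integral, coeff_eq_integral, ← integral_sub i1 i2, ← integral_div, ← integral_neg]
    congr 1
    funext x
    rw [hartley_apply, hartley_neg_apply]
    ring

theorem norm_mFourierCoeff_ofReal_sq {d : ℕ} (g : L2 d) (n : Fin d → ℤ) :
    ‖mFourierCoeff (fun x => ((g x : ℝ) : ℂ)) n‖ ^ 2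
      = (coeff n g ^ 2 + coeff (-n) g ^ 2) / 2 := by
  rw [mFourierCoeff_ofReal, ← Complex.normSq_eq_norm_sq, Complex.normSq_apply]
  simp only [Complex.sub_re, Complex.sub_im, Complex.ofReal_re, Complex.mul_re, Complex.mul_im,
    Complex.I_re, Complex.I_im, Complex.ofReal_im]
  ring

/-- Completeness is inherited from the complex Fourier basis. -/
theorem eq_zero_of_coeff_eq_zero {d : ℕ} (g : L2 d) (h : ∀ n, coeff n g = 0) : g = 0 := by
  have hm : MemLp (fun x => ((g x : ℝ) : ℂ)) 2 (torusMeasure d) := (Lp.memLp g).ofReal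
  have hz : hm.toLp _ = 0 := by
    apply mFourierBasis.repr.injective
    ext n
    rw [mFourierBasis_repr, map_zero]
    have e : mFourierCoeff (hm.toLp (fun x => ((g x : ℝ) : ℂ))) n
        = mFourierCoeff (fun x => ((g x : ℝ) : ℂ)) n := by
      apply integral_congr_ae
      filter_upwards [hm.coeFn_toLp] with x hx
      rw [hx]
    have : mFourierCoeff (fun x => ((g x : ℝ) : ℂ)) n = 0 := by
      rw [mFourierCoeff_ofReal]
      simp [h]
    exact e.trans this
  apply Lp.ext
  have hz' : (hm.toLp _ : Torus d → ℂ) =ᵐ[torusMeasure d] 0 := by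
    rw [hz]
    exact Lp.coeFn_zero _ _ _
  filter_upwards [hm.coeFn_toLp, hz', Lp.coeFn_zero ℝ 2 (torusMeasure d)] with x h1 h2 h3
  rw [h1] at h2
  rw [h3]
  simpa using h2

/-- The real orthonormal basis of `L²(Ω)` that consists of the Hartley functions. -/
def hartleyBasis (d : ℕ) : HilbertBasis (Fin d → ℤ) ℝ (L2 d) :=
  HilbertBasis.mkOfOrthogonalEqBot (orthonormal_hartley d) (by
    rw [Submodule.eq_bot_iff]
    intro g hg
    apply eq_zero_of_coeff_eq_zero
    intro n
    exact (Submodule.mem_orthogonal _ _).1 hg _ (Submodule.subset_span ⟨n, rfl⟩))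

theorem hartleyBasis_apply {d : ℕ} (n : Fin d → ℤ) : hartleyBasis d n = contL2 (hartley n) := by
  rw [hartleyBasis, HilbertBasis.coe_mkOfOrthogonalEqBot]

theorem hartleyBasis_repr {d : ℕ} (g : L2 d) (n : Fin d → ℤ) :
    (hartleyBasis d).repr g n = coeff n g := by
  rw [HilbertBasis.repr_apply_apply, hartleyBasis_apply, coeff_apply]

theorem hasSum_coeff_mul_coeff {d : ℕ} (g h : L2 d) :
    HasSum (fun n => coeff n g * coeff n h) ⟪g, h⟫_ℝ := by
  have := (hartleyBasis d).hasSum_inner_mul_inner g h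
  simpa only [hartleyBasis_apply, coeff_apply, real_inner_comm] using this

theorem hasSum_coeff_sq {d : ℕ} (g : L2 d) : HasSum (fun n => coeff n g ^ 2) (‖g‖ ^ 2) := by
  have := hasSum_coeff_mul_coeff g g
  simpa only [real_inner_self_eq_norm_sq, ← sq] using this

theorem sum_coeff_sq_le {d : ℕ} (g : L2 d) (S : Finset (Fin d → ℤ)) :
    ∑ n ∈ S, coeff n g ^ 2 ≤ ‖g‖ ^ 2 :=
  sum_le_hasSum S (fun _ _ => sq_nonneg _) (hasSum_coeff_sq g)

theorem norm_sq_le_of_sum_le {d : ℕ} (g : L2 d) {c : ℝ}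
    (h : ∀ S : Finset (Fin d → ℤ), ∑ n ∈ S, coeff n g ^ 2 ≤ c) : ‖g‖ ^ 2 ≤ c :=
  hasSum_le_of_sum_le (hasSum_coeff_sq g) h

theorem hasSum_coeff_smul {d : ℕ} (g : L2 d) :
    HasSum (fun n => coeff n g • contL2 (hartley n)) g := by
  have := (hartleyBasis d).hasSum_repr g
  simpa only [hartleyBasis_apply, hartleyBasis_repr] using this

theorem L2_ext_coeff {d : ℕ} {g h : L2 d} (H : ∀ n, coeff n g = coeff n h) : g = h := by
  rw [← sub_eq_zero]
  apply eq_zero_of_coeff_eq_zero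
  intro n
  rw [map_sub, H n, sub_self]

theorem coeff_contL2_hartley {d : ℕ} (n m : Fin d → ℤ) :
    coeff n (contL2 (hartley m)) = if n = m then 1 else 0 :=
  orthonormal_iff_ite.1 (orthonormal_hartley d) n m

open Classical in
/-- The element of `L²(Ω)` with given coefficients, or `0` if these are not square summable. -/
def ofCoeff {d : ℕ} (a : (Fin d → ℤ) → ℝ) : L2 d :=
  if h : Memℓp a 2 then (hartleyBasis d).repr.symm ⟨a, h⟩ else 0

theorem coeff_ofCoeff {d : ℕ} {a : (Fin d → ℤ) → ℝ} (h : Summable fun n => a n ^ 2)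
    (n : Fin d → ℤ) : coeff n (ofCoeff a) = a n := by
  have h' : Memℓp a 2 := by
    apply memℓp_gen
    simpa using h
  rw [ofCoeff, dif_pos h', ← hartleyBasis_repr, LinearIsometryEquiv.apply_symm_apply]

/-- An `L²`-valued map with continuous, uniformly square summable coefficients is continuous. -/
theorem continuousOn_of_coeff {d : ℕ} {X : Type*} [TopologicalSpace X] {s : Set X} {u : X → L2 d}
    (hc : ∀ n, ContinuousOn (fun t => coeff n (u t)) s) {c : (Fin d → ℤ) → ℝ} (hs : Summable c)
    (hb : ∀ t ∈ s, ∀ n, coeff n (u t) ^ 2 ≤ c n) : ContinuousOn u s := by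
  intro t ht
  rw [ContinuousWithinAt, tendsto_iff_norm_sub_tendsto_zero]
  have h2 : Filter.Tendsto (fun r => ‖u r - u t‖ ^ 2) (nhdsWithin t s) (nhds 0) := by
    -- Parseval turns the claim into dominated convergence of a series; (a - b)² ≤ 2a² + 2b² gives
    -- the majorant 4 c n.
    have e : ∀ r, ‖u r - u t‖ ^ 2 = ∑' n, (coeff n (u r) - coeff n (u t)) ^ 2 := by
      intro r
      rw [← (hasSum_coeff_sq (u r - u t)).tsum_eq]
      simp only [map_sub]
    simp only [e]
    rw [show (0 : ℝ) = ∑' _ : Fin d → ℤ, (0 : ℝ) from tsum_zero.symm]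
    refine tendsto_tsum_of_dominated_convergence (bound := fun n => 4 * c n) (hs.mul_left 4)
      (fun n => ?_) ?_
    · have := ((hc n t ht).sub_const (coeff n (u t))).pow 2
      simpa [ContinuousWithinAt] using this
    · filter_upwards [self_mem_nhdsWithin] with r hr
      intro n
      rw [Real.norm_of_nonneg (sq_nonneg _)]
      nlinarith [hb r hr n, hb t ht n, sq_nonneg (coeff n (u r) + coeff n (u t))]
  have := h2.sqrt
  simpa [Real.sqrt_sq (norm_nonneg _)] using this

end

noncomputable section

open UnitAddTorus

/-! ### Calculus of smooth functions on the torus -/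

theorem contDiff_translate {d : ℕ} {φ : Torus d → ℝ} (h : IsSmooth φ) (i : Fin d) (x : Torus d) :
    ContDiff ℝ ∞ fun s : ℝ => φ (x + Pi.single i (s : UnitAddCircle)) := by
  obtain ⟨y, rfl⟩ := (isOpenQuotientMap_torus d).surjective x
  have e : (fun s : ℝ => φ ((fun j => ((y j : ℝ) : UnitAddCircle))
        + Pi.single i (s : UnitAddCircle)))
      = periodicLift φ ∘ fun s : ℝ => y + s • (Pi.single i (1 : ℝ) : Fin d → ℝ) := by
    funext s
    simp only [periodicLift, Function.comp]
    congr 1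
    funext j
    by_cases hj : j = i
    · subst hj
      simp
    · simp [hj]
  rw [e]
  exact ContDiff.comp h (contDiff_const.add (contDiff_id.smul contDiff_const))

theorem torusDeriv_translate {d : ℕ} (φ : Torus d → ℝ) (i : Fin d) (x : Torus d) (s : ℝ) :
    torusDeriv i φ (x + Pi.single i (s : UnitAddCircle))
      = deriv (fun r : ℝ => φ (x + Pi.single i (r : UnitAddCircle))) s := by
  have := deriv_comp_const_add (fun r : ℝ => φ (x + Pi.single i (r : UnitAddCircle))) s 0
  rw [add_zero] at this
  rw [← this, torusDeriv]
  congr 1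
  funext r
  rw [add_assoc, ← Pi.single_add, ← AddCircle.coe_add]

theorem hasDerivAt_translate {d : ℕ} {φ : Torus d → ℝ} (h : IsSmooth φ) (i : Fin d) (x : Torus d)
    (s : ℝ) : HasDerivAt (fun s : ℝ => φ (x + Pi.single i (s : UnitAddCircle)))
      (torusDeriv i φ (x + Pi.single i (s : UnitAddCircle))) s := by
  rw [torusDeriv_translate]
  exact ((contDiff_translate h i x).differentiable (by simp) s).hasDerivAt

theorem add_single_coe_zero {d : ℕ} (x : Torus d) (i : Fin d) :
    x + Pi.single i (((0 : ℝ) : UnitAddCircle)) = x := by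
  simp

theorem hasDerivAt_torusDeriv {d : ℕ} {φ : Torus d → ℝ} (h : IsSmooth φ) (i : Fin d)
    (x : Torus d) :
    HasDerivAt (fun s : ℝ => φ (x + Pi.single i (s : UnitAddCircle))) (torusDeriv i φ x) 0 := by
  have := hasDerivAt_translate h i x 0
  rwa [add_single_coe_zero] at this

/-- Reduces repeated differentiation in one coordinate to calculus on ℝ, where bounds for
derivatives of compositions are applied. -/
theorem iteratedDeriv_translate {d : ℕ} (φ : Torus d → ℝ) (i : Fin d) (x : Torus d) (k : ℕ) :
    iteratedDeriv k (fun s : ℝ => φ (x + Pi.single i (s : UnitAddCircle)))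
      = fun s : ℝ => (torusDeriv i)^[k] φ (x + Pi.single i (s : UnitAddCircle)) := by
  induction k with
  | zero => simp
  | succ k ih =>
    rw [iteratedDeriv_succ, ih]
    funext s
    rw [Function.iterate_succ_apply', torusDeriv_translate]

theorem IsSmooth.iterate_torusDeriv {d : ℕ} {φ : Torus d → ℝ} (h : IsSmooth φ) (i : Fin d)
    (k : ℕ) : IsSmooth ((_root_.torusDeriv i)^[k] φ) := by
  induction k with
  | zero => exact h
  | succ k ih =>
    rw [Function.iterate_succ_apply']
    exact ih.torusDeriv i

theorem IsSmooth.mul {d : ℕ} {φ ψ : Torus d → ℝ} (h : IsSmooth φ) (h' : IsSmooth ψ) :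
    IsSmooth fun x => φ x * ψ x :=
  ContDiff.mul h h'

theorem IsSmooth.add {d : ℕ} {φ ψ : Torus d → ℝ} (h : IsSmooth φ) (h' : IsSmooth ψ) :
    IsSmooth fun x => φ x + ψ x :=
  ContDiff.add h h'

theorem IsSmooth.comp {d : ℕ} {φ : Torus d → ℝ} {g : ℝ → ℝ} (hg : ContDiff ℝ ∞ g)
    (h : IsSmooth φ) : IsSmooth fun x => g (φ x) :=
  ContDiff.comp hg h

theorem torusDeriv_mul {d : ℕ} {φ ψ : Torus d → ℝ} (h : IsSmooth φ) (h' : IsSmooth ψ)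
    (i : Fin d) : torusDeriv i (fun x => φ x * ψ x)
      = fun x => torusDeriv i φ x * ψ x + φ x * torusDeriv i ψ x := by
  funext x
  have := (hasDerivAt_torusDeriv h i x).mul (hasDerivAt_torusDeriv h' i x)
  rw [add_single_coe_zero] at this
  exact this.deriv

theorem torusDeriv_comp {d : ℕ} {φ : Torus d → ℝ} {g : ℝ → ℝ} (hg : ContDiff ℝ ∞ g)
    (h : IsSmooth φ) (i : Fin d) :
    torusDeriv i (fun x => g (φ x)) = fun x => deriv g (φ x) * torusDeriv i φ x := by
  funext x
  have h1 := (hg.differentiable (by simp) (φ (x + Pi.single i ((0 : ℝ) : UnitAddCircle)))).hasDerivAt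
  have := h1.comp 0 (hasDerivAt_torusDeriv h i x)
  rw [add_single_coe_zero] at this
  exact this.deriv

theorem exists_bound_continuous {d : ℕ} {φ : Torus d → ℝ} (h : Continuous φ) :
    ∃ C, ∀ x, |φ x| ≤ C := by
  obtain ⟨C, hC⟩ := isCompact_univ.exists_bound_of_continuousOn h.continuousOn
  exact ⟨C, fun x => hC x (mem_univ x)⟩

theorem integrable_of_continuous {d : ℕ} {φ : Torus d → ℝ} (h : Continuous φ) :
    Integrable φ (torusMeasure d) := by
  obtain ⟨C, hC⟩ := exists_bound_continuous h
  exact Integrable.of_bound h.aestronglyMeasurable C (Filter.Eventually.of_forall hC)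

/-- The integral of a translate does not depend on the translation; differentiate this under the
integral sign. -/
theorem integral_torusDeriv {d : ℕ} {φ : Torus d → ℝ} (h : IsSmooth φ) (i : Fin d) :
    ∫ x, torusDeriv i φ x ∂(torusMeasure d) = 0 := by
  obtain ⟨C, hC⟩ := exists_bound_continuous (h.torusDeriv i).continuous
  have ht : ∀ s : ℝ, Continuous fun x : Torus d => φ (x + Pi.single i (s : UnitAddCircle)) :=
    fun s => h.continuous.comp (by fun_prop)
  have hc : Continuous fun x : Torus d => torusDeriv i φ (x + Pi.single i ((0 : ℝ) : UnitAddCircle)) :=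
    (h.torusDeriv i).continuous.comp (by fun_prop)
  have hd : HasDerivAt
      (fun s : ℝ => ∫ x, φ (x + Pi.single i (s : UnitAddCircle)) ∂(torusMeasure d))
      (∫ x, torusDeriv i φ (x + Pi.single i ((0 : ℝ) : UnitAddCircle)) ∂(torusMeasure d)) 0 :=
    (hasDerivAt_integral_of_dominated_loc_of_deriv_le (bound := fun _ => C) Filter.univ_mem
      (Filter.Eventually.of_forall fun s => (ht s).aestronglyMeasurable)
      (integrable_of_continuous (ht 0)) hc.aestronglyMeasurable
      (Filter.Eventually.of_forall fun x s _ =>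
        hC (x + Pi.single i ((s : ℝ) : UnitAddCircle)))
      (integrable_const C)
      (Filter.Eventually.of_forall fun x s _ => hasDerivAt_translate h i x s)).2
  have ht' : ∀ s : ℝ, ∫ x, φ (x + Pi.single i (s : UnitAddCircle)) ∂(torusMeasure d)
      = ∫ x, φ x ∂(torusMeasure d) := fun s => integral_add_right_eq_self φ _
  simp only [ht', add_single_coe_zero] at hd
  exact hd.unique (hasDerivAt_const _ _)

/-! ### Derivatives of Hartley functions -/

theorem mFourier_coe {d : ℕ} (n : Fin d → ℤ) (y : Fin d → ℝ) :
    mFourier n (fun j => ((y j : ℝ) : UnitAddCircle))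
      = Complex.exp (((∑ j, (2 * Real.pi * n j) * y j : ℝ) : ℂ) * Complex.I) := by
  change ∏ j, fourier (n j) ((y j : ℝ) : UnitAddCircle) = _
  simp only [fourier_coe_apply]
  rw [← Complex.exp_sum]
  congr 1
  push_cast
  rw [Finset.sum_mul]
  apply Finset.sum_congr rfl
  intro j _
  simp
  ring

/-- The phase `y ↦ 2π n·y`. -/
def phase {d : ℕ} (n : Fin d → ℤ) : (Fin d → ℝ) →L[ℝ] ℝ :=
  ∑ j, (2 * Real.pi * n j) • ContinuousLinearMap.proj j

theorem phase_apply {d : ℕ} (n : Fin d → ℤ) (y : Fin d → ℝ) :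
    phase n y = ∑ j, (2 * Real.pi * n j) * y j := by
  simp [phase]

theorem periodicLift_hartley {d : ℕ} (n : Fin d → ℤ) :
    periodicLift (hartley n) = (fun r => Real.cos r + Real.sin r) ∘ phase n := by
  funext y
  simp only [periodicLift, hartley_apply, Function.comp, phase_apply]
  rw [mFourier_coe, Complex.exp_ofReal_mul_I_re, Complex.exp_ofReal_mul_I_im]

theorem contDiff_cos_add_sin : ContDiff ℝ ∞ fun r => Real.cos r + Real.sin r :=
  Real.contDiff_cos.add Real.contDiff_sin

theorem isSmooth_hartley {d : ℕ} (n : Fin d → ℤ) : IsSmooth (hartley n) := by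
  rw [IsSmooth, periodicLift_hartley]
  exact contDiff_cos_add_sin.comp (phase n).contDiff

/-- The derivative of cos + sin is cos - sin, the Hartley function of the opposite frequency. This
is the origin of every index -n below. -/
theorem torusDeriv_hartley {d : ℕ} (i : Fin d) (n : Fin d → ℤ) (x : Torus d) :
    torusDeriv i (hartley n) x = 2 * Real.pi * n i * hartley (-n) x := by
  obtain ⟨y, rfl⟩ := (isOpenQuotientMap_torus d).surjective x
  have h := congrFun (periodicLift_torusDeriv (isSmooth_hartley n) i) y
  have h' := congrFun (periodicLift_hartley (-n)) y
  simp only [periodicLift] at h h'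
  rw [h, h']
  have hd : HasFDerivAt (periodicLift (hartley n))
      ((-Real.sin (phase n y) + Real.cos (phase n y)) • phase n) y := by
    rw [periodicLift_hartley]
    exact HasDerivAt.comp_hasFDerivAt y
      ((Real.hasDerivAt_cos (phase n y)).add (Real.hasDerivAt_sin (phase n y)))
      (phase n).hasFDerivAt
  have e1 : (fun y : Fin d → ℝ => hartley n fun j => ((y j : ℝ) : UnitAddCircle))
    = periodicLift (hartley n) := rfl
  have e2 : phase n (Pi.single i 1) = 2 * Real.pi * n i := by
    rw [phase_apply]
    simp [Pi.single_apply]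
  have e3 : phase (-n) y = -phase n y := by
    simp [phase_apply]
  change fderiv ℝ (periodicLift (hartley n)) y _ = _
  rw [hd.fderiv]
  simp only [smul_apply, e2, Function.comp, e3, Real.cos_neg, Real.sin_neg,
    smul_eq_mul]
  ring

/-- The element of `L²(Ω)` given by a smooth function. -/
def IsSmooth.toL2 {d : ℕ} {φ : Torus d → ℝ} (h : IsSmooth φ) : L2 d := contL2 ⟨φ, h.continuous⟩

theorem IsSmooth.coeFn_toL2 {d : ℕ} {φ : Torus d → ℝ} (h : IsSmooth φ) :
    h.toL2 =ᵐ[torusMeasure d] φ := coeFn_contL2 _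

theorem IsSmooth.coeff_toL2 {d : ℕ} {φ : Torus d → ℝ} (h : IsSmooth φ) (n : Fin d → ℤ) :
    coeff n h.toL2 = ∫ x, hartley n x * φ x ∂(torusMeasure d) := by
  rw [coeff_eq_integral]
  apply integral_congr_ae
  filter_upwards [h.coeFn_toL2] with x hx
  rw [hx]

theorem integral_mul_torusDeriv {d : ℕ} {φ ψ : Torus d → ℝ} (h : IsSmooth φ) (h' : IsSmooth ψ)
    (i : Fin d) : ∫ x, φ x * torusDeriv i ψ x ∂(torusMeasure d)
      = -∫ x, torusDeriv i φ x * ψ x ∂(torusMeasure d) := by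
  have := integral_torusDeriv (h.mul h') i
  simp only [torusDeriv_mul h h'] at this
  have i1 : Integrable (fun x => torusDeriv i φ x * ψ x) (torusMeasure d) :=
    integrable_of_continuous ((h.torusDeriv i).continuous.mul h'.continuous)
  have i2 : Integrable (fun x => φ x * torusDeriv i ψ x) (torusMeasure d) :=
    integrable_of_continuous (h.continuous.mul (h'.torusDeriv i).continuous)
  rw [integral_add i1 i2] at this
  linarith

theorem coeff_torusDeriv {d : ℕ} {φ : Torus d → ℝ} (h : IsSmooth φ) (i : Fin d)
    (n : Fin d → ℤ) :
    coeff n (h.torusDeriv i).toL2 = -(2 * Real.pi * n i * coeff (-n) h.toL2) := by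
  rw [IsSmooth.coeff_toL2, IsSmooth.coeff_toL2, integral_mul_torusDeriv (isSmooth_hartley n) h,
    ← integral_const_mul]
  simp only [torusDeriv_hartley, mul_assoc]

/-- One direction tests with Hartley functions only. The other is Parseval against a smooth test
function, where the substitution n ↦ -n undoes the frequency flip. -/
theorem isWeakPartial_iff_coeff {d : ℕ} {i : Fin d} {g g' : L2 d} :
    IsWeakPartial i g g' ↔ ∀ n, coeff n g' = -(2 * Real.pi * n i * coeff (-n) g) := by
  constructor
  · intro h n
    have := h (hartley n) (isSmooth_hartley n)
    rw [coeff_eq_integral, coeff_eq_integral, ← integral_const_mul]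
    simp only [torusDeriv_hartley] at this
    rw [eq_neg_iff_add_eq_zero, add_comm, ← eq_neg_iff_add_eq_zero]
    convert this using 1
    · congr 1
      funext x
      ring
    · congr 2
      funext x
      ring
  · intro h φ hφ
    have e1 : ∫ x, g x * torusDeriv i φ x ∂(torusMeasure d) = ⟪g, (hφ.torusDeriv i).toL2⟫_ℝ := by
      rw [inner_eq_integral]
      apply integral_congr_ae
      filter_upwards [(hφ.torusDeriv i).coeFn_toL2] with x hx
      rw [hx]
    have e2 : ∫ x, g' x * φ x ∂(torusMeasure d) = ⟪g', hφ.toL2⟫_ℝ := by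
      rw [inner_eq_integral]
      apply integral_congr_ae
      filter_upwards [hφ.coeFn_toL2] with x hx
      rw [hx]
    rw [e1, e2]
    refine (hasSum_coeff_mul_coeff _ _).unique ?_
    have := ((Equiv.neg (Fin d → ℤ)).hasSum_iff.2 (hasSum_coeff_mul_coeff g' hφ.toL2)).neg
    refine this.congr_fun fun n => ?_
    rw [coeff_torusDeriv hφ]
    simp only [Function.comp, Equiv.neg_apply, h, neg_neg, Pi.neg_apply]
    push_cast
    ring

/-! ### The space `H¹(Ω)` and Sobolev norms through coefficients -/

theorem laplaceEigenvalue_eq {d : ℕ} (n : Fin d → ℤ) :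
    laplaceEigenvalue n = ∑ i, (2 * Real.pi * n i) ^ 2 := by
  simp only [laplaceEigenvalue, Finset.mul_sum, mul_pow]

theorem laplaceEigenvalue_nonneg {d : ℕ} (n : Fin d → ℤ) : 0 ≤ laplaceEigenvalue n := by
  rw [laplaceEigenvalue_eq]
  positivity

theorem laplaceEigenvalue_neg {d : ℕ} (n : Fin d → ℤ) :
    laplaceEigenvalue (-n) = laplaceEigenvalue n := by
  simp [laplaceEigenvalue]

theorem sq_le_laplaceEigenvalue {d : ℕ} (n : Fin d → ℤ) (i : Fin d) :
    (2 * Real.pi * n i) ^ 2 ≤ laplaceEigenvalue n := by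
  rw [laplaceEigenvalue_eq]
  exact Finset.single_le_sum (f := fun i => (2 * Real.pi * (n i : ℝ)) ^ 2)
    (fun _ _ => sq_nonneg _) (Finset.mem_univ i)

theorem weight_nonneg {d : ℕ} (s : ℝ) (n : Fin d → ℤ) : 0 ≤ (1 + laplaceEigenvalue n) ^ s :=
  Real.rpow_nonneg (by linarith [laplaceEigenvalue_nonneg n]) s

theorem one_le_weight {d : ℕ} (n : Fin d → ℤ) : 1 ≤ 1 + laplaceEigenvalue n := by
  linarith [laplaceEigenvalue_nonneg n]

/-- A squared complex coefficient is the average of the squared Hartley coefficients at n and -n.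
The weight is even, so both halves have the same sum. -/
theorem sobolevNorm_eq {d : ℕ} (s : ℝ) (g : L2 d) :
    sobolevNorm s g = (∑' n : Fin d → ℤ, ENNReal.ofReal ((1 + laplaceEigenvalue n) ^ s *
      coeff n g ^ 2)) ^ (1 / 2 : ℝ) := by
  rw [sobolevNorm]
  congr 1
  have e : ∀ n : Fin d → ℤ, ENNReal.ofReal ((1 + laplaceEigenvalue n) ^ s *
      ‖mFourierCoeff (fun x => ((g x : ℝ) : ℂ)) n‖ ^ 2)
      = 2⁻¹ * ENNReal.ofReal ((1 + laplaceEigenvalue n) ^ s * coeff n g ^ 2)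
        + 2⁻¹ * ENNReal.ofReal ((1 + laplaceEigenvalue (-n)) ^ s * coeff (-n) g ^ 2) := by
    intro n
    have h2 : (2⁻¹ : ENNReal) = ENNReal.ofReal (2⁻¹) := by
      rw [ENNReal.ofReal_inv_of_pos (by norm_num)]
      simp
    rw [norm_mFourierCoeff_ofReal_sq, h2, ← ENNReal.ofReal_mul (by norm_num),
      ← ENNReal.ofReal_mul (by norm_num), laplaceEigenvalue_neg,
      ← ENNReal.ofReal_add (mul_nonneg (by norm_num) (mul_nonneg (weight_nonneg s n) (sq_nonneg _)))
        (mul_nonneg (by norm_num) (mul_nonneg (weight_nonneg s n) (sq_nonneg _)))]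
    congr 1
    ring
  simp only [e]
  rw [ENNReal.tsum_add, ENNReal.tsum_mul_left, ENNReal.tsum_mul_left]
  have hn := (Equiv.neg (Fin d → ℤ)).tsum_eq
    fun n => ENNReal.ofReal ((1 + laplaceEigenvalue n) ^ s * coeff n g ^ 2)
  simp only [Equiv.neg_apply] at hn
  rw [hn, ← add_mul, ENNReal.inv_two_add_inv_two, one_mul]

/-- The square of the `H^s` norm of `g` is at most `M`. -/
def HsBound {d : ℕ} (s M : ℝ) (g : L2 d) : Prop :=
  ∀ S : Finset (Fin d → ℤ), ∑ n ∈ S, (1 + laplaceEigenvalue n) ^ s * coeff n g ^ 2 ≤ M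

theorem HsBound.nonneg {d : ℕ} {s M : ℝ} {g : L2 d} (h : HsBound s M g) : 0 ≤ M := by
  simpa using h ∅

theorem HsBound.mono {d : ℕ} {s s' M M' : ℝ} {g : L2 d} (h : HsBound s M g) (hs : s' ≤ s)
    (hM : M ≤ M') : HsBound s' M' g := fun S =>
  ((Finset.sum_le_sum fun n _ => mul_le_mul_of_nonneg_right
    (Real.rpow_le_rpow_of_exponent_le (one_le_weight n) hs) (sq_nonneg _)).trans (h S)).trans hM

theorem HsBound.summable {d : ℕ} {s M : ℝ} {g : L2 d} (h : HsBound s M g) :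
    Summable fun n => (1 + laplaceEigenvalue n) ^ s * coeff n g ^ 2 :=
  summable_of_sum_le (fun n => mul_nonneg (weight_nonneg s n) (sq_nonneg _)) h

theorem hsBound_zero {d : ℕ} (g : L2 d) : HsBound 0 (‖g‖ ^ 2) g := fun S => by
  simpa using sum_coeff_sq_le g S

theorem HsBound.sobolevNorm_le {d : ℕ} {s M : ℝ} {g : L2 d} (h : HsBound s M g) :
    sobolevNorm s g ≤ ENNReal.ofReal (√M) := by
  rw [sobolevNorm_eq, one_div, ENNReal.rpow_inv_le_iff (by norm_num),
    ENNReal.ofReal_rpow_of_nonneg (Real.sqrt_nonneg _) (by norm_num), Real.rpow_two,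
    Real.sq_sqrt h.nonneg, ENNReal.tsum_eq_iSup_sum]
  refine iSup_le fun S => ?_
  rw [← ENNReal.ofReal_sum_of_nonneg fun n _ => mul_nonneg (weight_nonneg s n) (sq_nonneg _)]
  exact ENNReal.ofReal_le_ofReal (h S)

theorem hsBound_of_sobolevNorm_le {d : ℕ} {s M : ℝ} {g : L2 d} (hM : 0 ≤ M)
    (h : sobolevNorm s g ≤ ENNReal.ofReal M) : HsBound s (M ^ 2) g := by
  intro S
  rw [sobolevNorm_eq, one_div, ENNReal.rpow_inv_le_iff (by norm_num),
    ENNReal.ofReal_rpow_of_nonneg hM (by norm_num), Real.rpow_two] at h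
  have := (ENNReal.sum_le_tsum S).trans h
  rw [← ENNReal.ofReal_sum_of_nonneg
    fun n _ => mul_nonneg (weight_nonneg s n) (sq_nonneg _)] at this
  exact (ENNReal.ofReal_le_ofReal_iff (sq_nonneg M)).1 this

theorem exists_hsBound_of_sobolevNorm_lt_top {d : ℕ} {s : ℝ} {g : L2 d}
    (h : sobolevNorm s g < ⊤) : ∃ M, HsBound s M g :=
  ⟨_, hsBound_of_sobolevNorm_le ENNReal.toReal_nonneg (ENNReal.ofReal_toReal h.ne).ge⟩

end

noncomputable section

/-! ### The scalar equation `a' = -μ a + g` -/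

/-- The solution of `a' = -μ a + g`, `a(0) = c`. -/
def duhamel (μ c : ℝ) (g : ℝ → ℝ) (t : ℝ) : ℝ :=
  Real.exp (-μ * t) * (c + ∫ s in 0..t, Real.exp (μ * s) * g s)

theorem duhamel_initial (μ c : ℝ) (g : ℝ → ℝ) : duhamel μ c g 0 = c := by
  simp [duhamel]

theorem hasDerivAt_duhamel (μ c : ℝ) {g : ℝ → ℝ} (hg : Continuous g) (t : ℝ) :
    HasDerivAt (duhamel μ c g) (-μ * duhamel μ c g t + g t) t := by
  have hc : Continuous fun s => Real.exp (μ * s) * g s := by fun_prop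
  have h1 : HasDerivAt (fun t => Real.exp (-μ * t)) (Real.exp (-μ * t) * -μ) t := by
    simpa using ((hasDerivAt_id t).const_mul (-μ)).exp
  have h2 : HasDerivAt (fun t => c + ∫ s in 0..t, Real.exp (μ * s) * g s)
      (Real.exp (μ * t) * g t) t :=
    (hc.integral_hasStrictDerivAt 0 t).hasDerivAt.const_add c
  have h3 := h1.mul h2
  refine h3.congr_deriv ?_
  have he : Real.exp (-μ * t) * Real.exp (μ * t) = 1 := by
    rw [← Real.exp_add]
    simp
  rw [← mul_assoc, he, duhamel]
  ring

theorem continuous_duhamel (μ c : ℝ) {g : ℝ → ℝ} (hg : Continuous g) :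
    Continuous (duhamel μ c g) :=
  continuous_iff_continuousAt.2 fun t => (hasDerivAt_duhamel μ c hg t).continuousAt

theorem duhamel_eq (μ c : ℝ) (g : ℝ → ℝ) (t : ℝ) :
    duhamel μ c g t = Real.exp (-μ * t) * c + ∫ s in 0..t, Real.exp (-μ * (t - s)) * g s := by
  rw [duhamel, mul_add, ← intervalIntegral.integral_const_mul]
  congr 2
  funext s
  rw [← mul_assoc, ← Real.exp_add]
  ring_nf

theorem duhamel_add (μ c c' : ℝ) {g g' : ℝ → ℝ} (hg : Continuous g) (hg' : Continuous g') (t : ℝ) :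
    duhamel μ (c + c') (fun s => g s + g' s) t = duhamel μ c g t + duhamel μ c' g' t := by
  have hc : ∀ {g : ℝ → ℝ}, Continuous g →
      IntervalIntegrable (fun s => Real.exp (μ * s) * g s) volume 0 t := fun hg =>
    Continuous.intervalIntegrable (by fun_prop) _ _
  simp only [duhamel, mul_add (Real.exp (μ * _))]
  rw [intervalIntegral.integral_add (hc hg) (hc hg')]
  ring

theorem duhamel_sub (μ c c' : ℝ) {g g' : ℝ → ℝ} (hg : Continuous g) (hg' : Continuous g') (t : ℝ) :
    duhamel μ (c - c') (fun s => g s - g' s) t = duhamel μ c g t - duhamel μ c' g' t := by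
  have := duhamel_add μ (c - c') c' (g := fun s => g s - g' s) (by fun_prop) hg' t
  simp only [sub_add_cancel] at this
  linarith

theorem duhamel_eq_add_zero (μ c : ℝ) (g : ℝ → ℝ) (t : ℝ) :
    duhamel μ c g t = Real.exp (-μ * t) * c + duhamel μ 0 g t := by
  rw [duhamel, duhamel]
  ring

/-- A change of variables: adding `k` to the rate amounts to multiplication by `e^{-kt}`. -/
theorem exp_mul_duhamel (μ k c : ℝ) (g : ℝ → ℝ) (t : ℝ) :
    Real.exp (k * t) * duhamel (μ + k) c (fun s => Real.exp (-k * s) * g s) t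
      = duhamel μ c g t := by
  rw [duhamel, duhamel, ← mul_assoc, ← Real.exp_add]
  congr 2
  · ring_nf
  · congr 1
    funext s
    rw [← mul_assoc, ← Real.exp_add]
    ring_nf

/-- With the integrating factor e^(μt), the difference to Duhamel's formula has zero derivative on
[0,T] and vanishes at 0. -/
theorem eq_duhamel_of_integral_eq {μ c T : ℝ} {a g : ℝ → ℝ} (hg : Continuous g)
    (ha : Continuous a) (h : ∀ t ∈ Icc 0 T, a t = c + ∫ s in 0..t, (g s - μ * a s)) :
    ∀ t ∈ Icc 0 T, a t = duhamel μ c g t := by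
  have hc : Continuous fun s => g s - μ * a s := by fun_prop
  -- The integral equation is known on [0,T] only; its right-hand side is differentiable on all of ℝ
  -- and replaces `a`.
  set A : ℝ → ℝ := fun t => c + ∫ s in 0..t, (g s - μ * a s)
  have hA : ∀ t, HasDerivAt A (g t - μ * a t) t := fun t =>
    (hc.integral_hasStrictDerivAt 0 t).hasDerivAt.const_add c
  set Z : ℝ → ℝ := fun t => Real.exp (μ * t) * (A t - duhamel μ c g t)
  have hZ : ∀ t, HasDerivAt Z (Real.exp (μ * t) * μ * (A t - duhamel μ c g t)
      + Real.exp (μ * t) * ((g t - μ * a t) - (-μ * duhamel μ c g t + g t))) t := by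
    intro t
    have h1 : HasDerivAt (fun t => Real.exp (μ * t)) (Real.exp (μ * t) * μ) t := by
      simpa using ((hasDerivAt_id t).const_mul μ).exp
    exact h1.mul ((hA t).sub (hasDerivAt_duhamel μ c hg t))
  intro t ht
  have hz : ∀ s ∈ Icc 0 T, HasDerivAt Z 0 s := by
    intro s hs
    refine (hZ s).congr_deriv ?_
    rw [h s hs]
    change Real.exp (μ * s) * μ * (A s - duhamel μ c g s)
      + Real.exp (μ * s) * ((g s - μ * A s) - (-μ * duhamel μ c g s + g s)) = 0
    ring
  have hzero : Z t = Z 0 := by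
    refine constant_of_has_deriv_right_zero (a := 0) (b := T)
      (fun s hs => (hz s hs).continuousAt.continuousWithinAt)
      (fun s hs => (hz s ⟨hs.1, hs.2.le⟩).hasDerivWithinAt) t ht
  have h0 : Z 0 = 0 := by simp [Z, A, duhamel_initial]
  rw [h0] at hzero
  have := (mul_eq_zero.1 hzero).resolve_left (Real.exp_pos _).ne'
  rw [h t ht]
  exact sub_eq_zero.1 this

/-- The Cauchy-Schwarz inequality for a continuous weight. -/
theorem sq_integral_mul_le {φ g : ℝ → ℝ} (hφ : Continuous φ) (hφ0 : ∀ s, 0 ≤ φ s)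
    (hg : Continuous g) {t : ℝ} (ht : 0 ≤ t) :
    (∫ s in 0..t, φ s * g s) ^ 2 ≤ (∫ s in 0..t, φ s) * ∫ s in 0..t, φ s * g s ^ 2 := by
  -- The nonnegative quadratic form ∫ φ (y g - x)², expanded.
  have key : ∀ x y : ℝ, 0 ≤ y ^ 2 * (∫ s in 0..t, φ s * g s ^ 2) - 2 * x * y * (∫ s in 0..t, φ s * g s)
      + x ^ 2 * ∫ s in 0..t, φ s := by
    intro x y
    have h1 : 0 ≤ ∫ s in 0..t, φ s * (y * g s - x) ^ 2 :=
      intervalIntegral.integral_nonneg ht fun s _ => mul_nonneg (hφ0 s) (sq_nonneg _)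
    have h2 : (fun s => φ s * (y * g s - x) ^ 2)
        = fun s => y ^ 2 * (φ s * g s ^ 2) - 2 * x * y * (φ s * g s) + x ^ 2 * φ s := by
      funext s
      ring
    rw [h2, intervalIntegral.integral_add, intervalIntegral.integral_sub,
      intervalIntegral.integral_const_mul, intervalIntegral.integral_const_mul,
      intervalIntegral.integral_const_mul] at h1
    · exact h1
    all_goals exact Continuous.intervalIntegrable (by fun_prop) _ _
  set P := ∫ s in 0..t, φ s
  set Q := ∫ s in 0..t, φ s * g s
  set R := ∫ s in 0..t, φ s * g s ^ 2
  have hP : 0 ≤ P := by simpa using key 1 0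
  rcases hP.eq_or_lt with h0 | hpos
  -- If P = 0, these values make the form equal to -Q⁴ (R + 2), which forces Q = 0.
  · have h1 := key (Q * (R + 1)) (Q ^ 2)
    have h2 : 0 ≤ R := by simpa using key 0 1
    rw [← h0] at h1 ⊢
    by_contra hne
    have hq : 0 < Q ^ 2 := by linarith
    nlinarith [mul_pos hq hq]
  · have h1 := key Q P
    nlinarith

/-- The kernel has mass at most 1/μ and at most T; using both gives a gain of 1/(1+μ) that remains
valid for the zero mode. -/
theorem one_add_mul_integral_exp_le {μ t T : ℝ} (hμ : 0 ≤ μ) (ht : 0 ≤ t) (htT : t ≤ T) :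
    (1 + μ) * ∫ s in 0..t, Real.exp (-μ * (t - s)) ≤ 1 + T := by
  have h1 : ∫ s in 0..t, μ * Real.exp (-μ * (t - s)) = 1 - Real.exp (-μ * t) := by
    have hd : ∀ s ∈ uIcc 0 t, HasDerivAt (fun s => Real.exp (-μ * (t - s)))
        (μ * Real.exp (-μ * (t - s))) s := by
      intro s _
      have := (((hasDerivAt_id s).const_sub t).const_mul (-μ)).exp
      refine this.congr_deriv ?_
      simp
      ring
    rw [intervalIntegral.integral_eq_sub_of_hasDerivAt hd
      (Continuous.intervalIntegrable (by fun_prop) _ _)]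
    simp
  have h2 : ∫ s in 0..t, Real.exp (-μ * (t - s)) ≤ ∫ _ in 0..t, (1 : ℝ) := by
    apply intervalIntegral.integral_mono_on ht (Continuous.intervalIntegrable (by fun_prop) _ _)
      (Continuous.intervalIntegrable (by fun_prop) _ _)
    intro s hs
    rw [Real.exp_le_one_iff]
    nlinarith [hs.2]
  rw [intervalIntegral.integral_const_mul] at h1
  rw [intervalIntegral.integral_const, smul_eq_mul, mul_one, sub_zero] at h2
  nlinarith [Real.exp_pos (-μ * t)]

/-- Cauchy-Schwarz with the heat kernel as weight; one of the two factors is its mass. -/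
theorem duhamel_zero_sq_le {μ t T : ℝ} {g : ℝ → ℝ} (hμ : 0 ≤ μ) (hg : Continuous g) (ht : 0 ≤ t)
    (htT : t ≤ T) : (1 + μ) * duhamel μ 0 g t ^ 2
      ≤ (1 + T) * ∫ s in 0..t, Real.exp (-μ * (t - s)) * g s ^ 2 := by
  rw [duhamel_eq, mul_zero, zero_add]
  have h1 := sq_integral_mul_le (φ := fun s => Real.exp (-μ * (t - s))) (by fun_prop)
    (fun s => (Real.exp_pos _).le) hg ht
  have h2 := one_add_mul_integral_exp_le hμ ht htT
  have h3 : 0 ≤ ∫ s in 0..t, Real.exp (-μ * (t - s)) * g s ^ 2 :=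
    intervalIntegral.integral_nonneg ht fun s _ => by positivity
  calc _ ≤ (1 + μ) * ((∫ s in 0..t, Real.exp (-μ * (t - s)))
        * ∫ s in 0..t, Real.exp (-μ * (t - s)) * g s ^ 2) :=
        mul_le_mul_of_nonneg_left h1 (by linarith)
    _ ≤ _ := by
      rw [← mul_assoc]
      exact mul_le_mul_of_nonneg_right h2 h3

theorem duhamel_zero_sq_le' {μ t T : ℝ} {g : ℝ → ℝ} (hμ : 0 ≤ μ) (hg : Continuous g) (ht : 0 ≤ t)
    (htT : t ≤ T) : (1 + μ) * duhamel μ 0 g t ^ 2 ≤ (1 + T) * ∫ s in 0..t, g s ^ 2 := by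
  refine (duhamel_zero_sq_le hμ hg ht htT).trans (mul_le_mul_of_nonneg_left ?_ (by linarith))
  apply intervalIntegral.integral_mono_on ht (Continuous.intervalIntegrable (by fun_prop) _ _)
      (Continuous.intervalIntegrable (by fun_prop) _ _)
  intro s hs
  refine mul_le_of_le_one_left (sq_nonneg _) ?_
  rw [Real.exp_le_one_iff]
  nlinarith [hs.2]

/-- For a source bounded in time the whole factor 1/(1+μ) is gained before squaring. This makes
merely bounded coefficients square summable in the linearization. -/
theorem abs_duhamel_zero_le {μ t T Z : ℝ} {g : ℝ → ℝ} (hμ : 0 ≤ μ) (hg : Continuous g)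
    (ht : 0 ≤ t) (htT : t ≤ T) (hZ : ∀ s ∈ Icc 0 t, |g s| ≤ Z) :
    |duhamel μ 0 g t| ≤ Z * (1 + T) / (1 + μ) := by
  have hZ0 : 0 ≤ Z := (abs_nonneg _).trans (hZ 0 ⟨le_rfl, ht⟩)
  rw [duhamel_eq, mul_zero, zero_add, le_div_iff₀ (by linarith)]
  have h1 : |∫ s in 0..t, Real.exp (-μ * (t - s)) * g s|
      ≤ ∫ s in 0..t, Z * Real.exp (-μ * (t - s)) := by
    refine (intervalIntegral.abs_integral_le_integral_abs ht).trans ?_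
    apply intervalIntegral.integral_mono_on ht (Continuous.intervalIntegrable (by fun_prop) _ _)
      (Continuous.intervalIntegrable (by fun_prop) _ _)
    intro s hs
    rw [abs_mul, abs_of_pos (Real.exp_pos _), mul_comm]
    exact mul_le_mul_of_nonneg_right (hZ s hs) (Real.exp_pos _).le
  rw [intervalIntegral.integral_const_mul] at h1
  have h2 := one_add_mul_integral_exp_le hμ ht htT
  nlinarith

/-- The smoothing estimate for the heat semigroup on a single mode. -/
theorem duhamel_zero_smoothing {μ t T : ℝ} {g : ℝ → ℝ} (hμ : 0 ≤ μ) (hg : Continuous g)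
    (ht : 0 ≤ t) (htT : t ≤ T) : (1 + μ) ^ (7 / 4 : ℝ) * duhamel μ 0 g t ^ 2
      ≤ (1 + T) * Real.exp T * ∫ s in 0..t, (t - s) ^ (-(3 / 4) : ℝ) * g s ^ 2 := by
  have hμ1 : 0 < 1 + μ := by linarith
  have h1 := duhamel_zero_sq_le hμ hg ht htT
  have hint : IntervalIntegrable (fun s : ℝ => (t - s) ^ (-(3 / 4) : ℝ)) volume 0 t := by
    have := (intervalIntegral.intervalIntegrable_rpow' (a := t) (b := 0)
      (r := -(3 / 4)) (by norm_num)).comp_sub_left t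
    simpa using this
  have hint2 : IntervalIntegrable (fun s : ℝ => (t - s) ^ (-(3 / 4) : ℝ) * g s ^ 2) volume 0 t :=
    hint.mul_continuousOn (by fun_prop)
  -- Since x^(3/4) e^(-x) ≤ 1 at x = (1+μ)(t-s), the power (1+μ)^(3/4) is traded for (t-s)^(-3/4),
  -- which is still integrable. Passing from μ to 1+μ in the exponent costs e^(t-s) ≤ e^T.
  have h2 : (1 + μ) ^ (3 / 4 : ℝ) * ∫ s in 0..t, Real.exp (-μ * (t - s)) * g s ^ 2
      ≤ Real.exp T * ∫ s in 0..t, (t - s) ^ (-(3 / 4) : ℝ) * g s ^ 2 := by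
    rw [← intervalIntegral.integral_const_mul, ← intervalIntegral.integral_const_mul]
    apply intervalIntegral.integral_mono_on_of_le_Ioo ht
      (Continuous.intervalIntegrable (by fun_prop) _ _) (hint2.const_mul _)
    intro s hs
    have hτ : 0 < t - s := by linarith [hs.2]
    rw [← mul_assoc, ← mul_assoc]
    refine mul_le_mul_of_nonneg_right ?_ (sq_nonneg _)
    have hx : 0 < (1 + μ) * (t - s) := by positivity
    have e1 : Real.exp (-μ * (t - s)) = Real.exp (t - s) * Real.exp (-((1 + μ) * (t - s))) := by
      rw [← Real.exp_add]
      ring_nf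
    have e2 : ((1 + μ) * (t - s)) ^ (3 / 4 : ℝ) * Real.exp (-((1 + μ) * (t - s))) ≤ 1 := by
      rw [Real.exp_neg, ← div_eq_mul_inv, div_le_one (Real.exp_pos _)]
      have h3 := Real.add_one_le_exp ((1 + μ) * (t - s))
      rcases le_total ((1 + μ) * (t - s)) 1 with h4 | h4
      · exact (Real.rpow_le_one hx.le h4 (by norm_num)).trans (by linarith)
      · refine (Real.rpow_le_rpow_of_exponent_le h4 (by norm_num : (3 / 4 : ℝ) ≤ 1)).trans ?_
        rw [Real.rpow_one]
        linarith
    rw [Real.mul_rpow hμ1.le hτ.le] at e2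
    have e3 : Real.exp (t - s) ≤ Real.exp T := Real.exp_le_exp.2 (by linarith [hs.1])
    have e4 : (t - s) ^ (3 / 4 : ℝ) * (t - s) ^ (-(3 / 4) : ℝ) = 1 := by
      rw [← Real.rpow_add hτ]
      norm_num
    have e5 : 0 < (t - s) ^ (-(3 / 4) : ℝ) := Real.rpow_pos_of_pos hτ _
    calc (1 + μ) ^ (3 / 4 : ℝ) * Real.exp (-μ * (t - s))
        = Real.exp (t - s) * ((1 + μ) ^ (3 / 4 : ℝ) * (t - s) ^ (3 / 4 : ℝ)
          * Real.exp (-((1 + μ) * (t - s)))) * (t - s) ^ (-(3 / 4) : ℝ) := by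
          rw [e1]
          linear_combination (-(1 + μ) ^ (3 / 4 : ℝ) * Real.exp (t - s)
            * Real.exp (-((1 + μ) * (t - s)))) * e4
      _ ≤ Real.exp (t - s) * 1 * (t - s) ^ (-(3 / 4) : ℝ) := by gcongr
      _ ≤ Real.exp T * (t - s) ^ (-(3 / 4) : ℝ) := by
        rw [mul_one]
        gcongr
  have e : (1 + μ) ^ (7 / 4 : ℝ) = (1 + μ) ^ (3 / 4 : ℝ) * (1 + μ) := by
    nth_rewrite 3 [← Real.rpow_one (1 + μ)]
    rw [← Real.rpow_add hμ1]
    norm_num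
  have h3 : 0 ≤ (1 + μ) ^ (3 / 4 : ℝ) := Real.rpow_nonneg hμ1.le _
  calc _ = (1 + μ) ^ (3 / 4 : ℝ) * ((1 + μ) * duhamel μ 0 g t ^ 2) := by rw [e, mul_assoc]
    _ ≤ (1 + μ) ^ (3 / 4 : ℝ) * ((1 + T) * ∫ s in 0..t, Real.exp (-μ * (t - s)) * g s ^ 2) :=
      mul_le_mul_of_nonneg_left h1 h3
    _ = (1 + T) * ((1 + μ) ^ (3 / 4 : ℝ) * ∫ s in 0..t, Real.exp (-μ * (t - s)) * g s ^ 2) := by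
      ring
    _ ≤ (1 + T) * (Real.exp T * ∫ s in 0..t, (t - s) ^ (-(3 / 4) : ℝ) * g s ^ 2) :=
      mul_le_mul_of_nonneg_left h2 (by linarith)
    _ = _ := by ring

theorem integral_rpow_neg_three_quarters {t T : ℝ} (ht : 0 ≤ t) (htT : t ≤ T) :
    ∫ s in 0..t, (t - s) ^ (-(3 / 4) : ℝ) ≤ 4 * (1 + T) := by
  have h := intervalIntegral.integral_comp_sub_left (a := 0) (b := t)
    (fun s : ℝ => s ^ (-(3 / 4) : ℝ)) t
  rw [h, sub_self, sub_zero, integral_rpow (Or.inl (by norm_num))]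
  norm_num
  have h1 : t ^ (1 / 4 : ℝ) ≤ 1 + T := by
    rcases le_total t 1 with h4 | h4
    · exact (Real.rpow_le_one ht h4 (by norm_num)).trans (by linarith)
    · refine (Real.rpow_le_rpow_of_exponent_le h4 (by norm_num : (1 / 4 : ℝ) ≤ 1)).trans ?_
      rw [Real.rpow_one]
      linarith
  linarith

/-- The energy estimate on a single mode. -/
theorem duhamel_energy {μ c t : ℝ} {g : ℝ → ℝ} (hμ : 0 ≤ μ) (hg : Continuous g) (ht : 0 ≤ t) :
    μ ^ 2 * ∫ s in 0..t, duhamel μ c g s ^ 2 ≤ μ * c ^ 2 + ∫ s in 0..t, g s ^ 2 := by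
  set a := duhamel μ c g
  have ha : Continuous a := continuous_duhamel μ c hg
  have h1 : ∫ s in 0..t, 2 * a s * (-μ * a s + g s) = a t ^ 2 - c ^ 2 := by
    have hd : ∀ s ∈ uIcc 0 t, HasDerivAt (fun s => a s ^ 2) (2 * a s * (-μ * a s + g s)) s := by
      intro s _
      have := (hasDerivAt_duhamel μ c hg s).pow 2
      refine this.congr_deriv ?_
      simp [a]
    rw [intervalIntegral.integral_eq_sub_of_hasDerivAt hd
      (Continuous.intervalIntegrable (by fun_prop) _ _)]
    simp [a, duhamel_initial]
  -- The subtracted term is μ (a²)', and the two integrands differ by (g - μ a)² ≥ 0.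
  have h2 : ∫ s in 0..t, μ ^ 2 * a s ^ 2
      ≤ ∫ s in 0..t, (g s ^ 2 - μ * (2 * a s * (-μ * a s + g s))) := by
    apply intervalIntegral.integral_mono_on ht (Continuous.intervalIntegrable (by fun_prop) _ _)
      (Continuous.intervalIntegrable (by fun_prop) _ _)
    intro s _
    nlinarith [sq_nonneg (g s - μ * a s)]
  rw [intervalIntegral.integral_const_mul, intervalIntegral.integral_sub
    (Continuous.intervalIntegrable (by fun_prop) _ _)
    (Continuous.intervalIntegrable (by fun_prop) _ _), intervalIntegral.integral_const_mul, h1] at h2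
  nlinarith [sq_nonneg (a t), mul_nonneg hμ (sq_nonneg (a t))]

/-- Gronwall's inequality in integral form. -/
theorem le_exp_of_le_integral {y : ℝ → ℝ} (hy : Continuous y) {A K T : ℝ} (hA : 0 ≤ A) (hK : 0 ≤ K)
    (h : ∀ t ∈ Icc 0 T, y t ≤ A + K * ∫ s in 0..t, y s) :
    ∀ t ∈ Icc 0 T, y t ≤ A * Real.exp (K * T) := by
  set Y : ℝ → ℝ := fun t => A + K * ∫ s in 0..t, y s
  set Z : ℝ → ℝ := fun t => Real.exp (-K * t) * Y t
  have hY : ∀ t, HasDerivAt Y (K * y t) t := fun t =>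
    ((hy.integral_hasStrictDerivAt 0 t).hasDerivAt.const_mul K).const_add A
  have hZ : ∀ t, HasDerivAt Z (Real.exp (-K * t) * -K * Y t + Real.exp (-K * t) * (K * y t)) t := by
    intro t
    have h1 : HasDerivAt (fun t => Real.exp (-K * t)) (Real.exp (-K * t) * -K) t := by
      simpa using ((hasDerivAt_id t).const_mul (-K)).exp
    exact h1.mul (hY t)
  intro t ht
  have hanti : AntitoneOn Z (Icc 0 T) := by
    apply antitoneOn_of_deriv_nonpos (convex_Icc 0 T)
    · exact fun s _ => (hZ s).continuousAt.continuousWithinAt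
    · exact fun s _ => (hZ s).differentiableAt.differentiableWithinAt
    · intro s hs
      rw [interior_Icc] at hs
      rw [(hZ s).deriv]
      have h1 := h s ⟨hs.1.le, hs.2.le⟩
      have h2 := Real.exp_pos (-K * s)
      have h3 : 0 ≤ Real.exp (-K * s) * K * (Y s - y s) :=
        mul_nonneg (mul_nonneg h2.le hK) (sub_nonneg.2 h1)
      linarith
  have h1 : Z t ≤ Z 0 := hanti ⟨le_rfl, ht.1.trans ht.2⟩ ht ht.1
  have h2 : Z 0 = A := by simp [Z, Y]
  rw [h2] at h1
  have h3 : Y t = Real.exp (K * t) * Z t := by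
    rw [← mul_assoc, ← Real.exp_add]
    simp
  refine (h t ht).trans (h3.le.trans ?_)
  rw [mul_comm]
  have h4 : Real.exp (K * t) ≤ Real.exp (K * T) :=
    Real.exp_le_exp.2 (mul_le_mul_of_nonneg_left ht.2 hK)
  exact mul_le_mul h1 h4 (Real.exp_pos _).le hA

end

noncomputable section

/-! ### Mild solutions of the inhomogeneous heat equation -/

/-- `u` is the mild solution on `[0,T]` of `u' - Δu = G`, `u(0) = θ`. -/
def IsMild {d : ℕ} (T : ℝ) (G : ℝ → L2 d) (θ : L2 d) (u : ℝ → L2 d) : Prop :=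
  ∀ t ∈ Icc 0 T, ∀ n, coeff n (u t)
    = duhamel (laplaceEigenvalue n) (coeff n θ) (fun s => coeff n (G s)) t

theorem continuous_coeff {d : ℕ} {X : Type*} [TopologicalSpace X] {G : X → L2 d}
    (hG : Continuous G) (n : Fin d → ℤ) : Continuous fun s => coeff n (G s) :=
  (coeff n).continuous.comp hG

theorem sum_integral_coeff_sq_le {d : ℕ} {G : ℝ → L2 d} (hG : Continuous G) {t : ℝ} (ht : 0 ≤ t)
    (S : Finset (Fin d → ℤ)) :
    ∑ n ∈ S, ∫ s in 0..t, coeff n (G s) ^ 2 ≤ ∫ s in 0..t, ‖G s‖ ^ 2 := by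
  have hc : ∀ n, IntervalIntegrable (fun s => coeff n (G s) ^ 2) volume 0 t := fun n =>
    ((continuous_coeff hG n).pow 2).intervalIntegrable _ _
  rw [← intervalIntegral.integral_finsetSum fun n _ => hc n]
  apply intervalIntegral.integral_mono_on ht _ ((hG.norm.pow 2).intervalIntegrable _ _)
  · exact fun s _ => sum_coeff_sq_le (G s) S
  · exact (continuous_finsetSum S fun n _ => (continuous_coeff hG n).pow 2).intervalIntegrable _ _

theorem summable_integral_coeff_sq {d : ℕ} {G : ℝ → L2 d} (hG : Continuous G) {t : ℝ}
    (ht : 0 ≤ t) : Summable fun n => ∫ s in 0..t, coeff n (G s) ^ 2 :=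
  summable_of_sum_le (fun _ => intervalIntegral.integral_nonneg ht fun _ _ => sq_nonneg _)
    (sum_integral_coeff_sq_le hG ht)

theorem duhamel_weighted_sq_le {μ c t T : ℝ} {g : ℝ → ℝ} (hμ : 0 ≤ μ) (hg : Continuous g)
    (ht : 0 ≤ t) (htT : t ≤ T) : (1 + μ) * duhamel μ c g t ^ 2
      ≤ 2 * ((1 + μ) * c ^ 2) + 2 * (1 + T) * ∫ s in 0..t, g s ^ 2 := by
  rw [duhamel_eq_add_zero]
  have h1 := duhamel_zero_sq_le' hμ hg ht htT
  have h2 : Real.exp (-μ * t) ≤ 1 := by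
    rw [Real.exp_le_one_iff]
    nlinarith
  have h3 : (Real.exp (-μ * t) * c) ^ 2 ≤ c ^ 2 := by
    rw [mul_pow]
    exact mul_le_of_le_one_left (sq_nonneg _) (pow_le_one₀ (Real.exp_pos _).le h2)
  nlinarith [sq_nonneg (Real.exp (-μ * t) * c - duhamel μ 0 g t),
    mul_nonneg (by linarith : 0 ≤ 1 + μ) (sq_nonneg (Real.exp (-μ * t) * c - duhamel μ 0 g t)),
    mul_le_mul_of_nonneg_left h3 (by linarith : 0 ≤ 1 + μ)]

theorem duhamel_sq_le {μ c t T : ℝ} {g : ℝ → ℝ} (hμ : 0 ≤ μ) (hg : Continuous g)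
    (ht : 0 ≤ t) (htT : t ≤ T) : duhamel μ c g t ^ 2
      ≤ 2 * c ^ 2 + 2 * (1 + T) * ∫ s in 0..t, g s ^ 2 := by
  have h1 := duhamel_weighted_sq_le (c := c) hμ hg ht htT
  have h2 : 0 ≤ (1 + T) * ∫ s in 0..t, g s ^ 2 :=
    mul_nonneg (by linarith) (intervalIntegral.integral_nonneg ht fun _ _ => sq_nonneg _)
  have h3 : (1 + μ) * duhamel μ c g t ^ 2
      ≤ (1 + μ) * (2 * c ^ 2 + 2 * (1 + T) * ∫ s in 0..t, g s ^ 2) := by nlinarith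
  exact le_of_mul_le_mul_left h3 (by linarith)

theorem integral_sq_mono {g : ℝ → ℝ} (hg : Continuous g) {t T : ℝ} (ht : 0 ≤ t) (htT : t ≤ T) :
    ∫ s in 0..t, g s ^ 2 ≤ ∫ s in 0..T, g s ^ 2 :=
  intervalIntegral.integral_mono_interval le_rfl ht htT
    (Filter.Eventually.of_forall fun _ => sq_nonneg _) ((hg.pow 2).intervalIntegrable _ _)

/-- The mild solution operator of `u' - Δu + k u = G`, `u(0) = θ`. -/
def heatSolve {d : ℕ} (k : ℝ) (θ : L2 d) (G : ℝ → L2 d) (t : ℝ) : L2 d :=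
  ofCoeff fun n => duhamel (laplaceEigenvalue n + k) (coeff n θ) (fun s => coeff n (G s)) t

section heatSolve

variable {d : ℕ} {k T : ℝ} {θ : L2 d} {G : ℝ → L2 d}

theorem duhamel_coeff_sq_le (hk : 0 ≤ k) (hG : Continuous G) {t : ℝ} (ht : t ∈ Icc 0 T)
    (n : Fin d → ℤ) :
    duhamel (laplaceEigenvalue n + k) (coeff n θ) (fun s => coeff n (G s)) t ^ 2
      ≤ 2 * coeff n θ ^ 2 + 2 * (1 + T) * ∫ s in 0..T, coeff n (G s) ^ 2 := by
  have h1 := duhamel_sq_le (c := coeff n θ) (add_nonneg (laplaceEigenvalue_nonneg n) hk)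
    (continuous_coeff hG n) ht.1 ht.2
  have h2 := integral_sq_mono (continuous_coeff hG n) ht.1 ht.2
  have h3 : 0 ≤ T := ht.1.trans ht.2
  nlinarith

theorem summable_duhamel_bound (hT : 0 ≤ T) (hG : Continuous G) : Summable fun n : Fin d → ℤ =>
    2 * coeff n θ ^ 2 + 2 * (1 + T) * ∫ s in 0..T, coeff n (G s) ^ 2 :=
  ((hasSum_coeff_sq θ).summable.mul_left 2).add ((summable_integral_coeff_sq hG hT).mul_left _)

theorem coeff_heatSolve (hk : 0 ≤ k) (hG : Continuous G) {t : ℝ} (ht : t ∈ Icc 0 T)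
    (n : Fin d → ℤ) : coeff n (heatSolve k θ G t)
      = duhamel (laplaceEigenvalue n + k) (coeff n θ) (fun s => coeff n (G s)) t :=
  coeff_ofCoeff (Summable.of_nonneg_of_le (fun _ => sq_nonneg _)
    (fun n => duhamel_coeff_sq_le hk hG ht n)
    (summable_duhamel_bound (ht.1.trans ht.2) hG)) n

theorem continuousOn_heatSolve (hT : 0 ≤ T) (hk : 0 ≤ k) (hG : Continuous G) :
    ContinuousOn (heatSolve k θ G) (Icc 0 T) := by
  refine continuousOn_of_coeff (fun n => ?_) (summable_duhamel_bound (θ := θ) hT hG)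
    (fun t ht n => ?_)
  · exact (continuous_duhamel _ _ (continuous_coeff hG n)).continuousOn.congr
      fun t ht => coeff_heatSolve hk hG ht n
  · rw [coeff_heatSolve hk hG ht]
    exact duhamel_coeff_sq_le hk hG ht n

/-- All rates λ_n + k are at least k, so damping gains the factor 1 + k uniformly in n. A large k
yields a contraction on the whole interval [0,T]. -/
theorem norm_sq_heatSolve_sub_le (hk : 0 ≤ k) (hG : Continuous G) {G' : ℝ → L2 d}
    (hG' : Continuous G') {t : ℝ} (ht : t ∈ Icc 0 T) :
    (1 + k) * ‖heatSolve k θ G t - heatSolve k θ G' t‖ ^ 2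
      ≤ (1 + T) * ∫ s in 0..t, ‖G s - G' s‖ ^ 2 := by
  rw [← le_div_iff₀' (by linarith)]
  apply norm_sq_le_of_sum_le
  intro S
  rw [le_div_iff₀' (by linarith), Finset.mul_sum]
  have hsub : Continuous fun s => G s - G' s := hG.sub hG'
  refine le_trans ?_ (mul_le_mul_of_nonneg_left (sum_integral_coeff_sq_le hsub ht.1 S)
    (by linarith [ht.1, ht.2]))
  rw [Finset.mul_sum]
  apply Finset.sum_le_sum
  intro n _
  have hl := laplaceEigenvalue_nonneg n
  have h1 := duhamel_zero_sq_le' (add_nonneg hl hk) (continuous_coeff hsub n) ht.1 ht.2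
  have h2 : coeff n (heatSolve k θ G t - heatSolve k θ G' t)
      = duhamel (laplaceEigenvalue n + k) 0 (fun s => coeff n (G s - G' s)) t := by
    rw [map_sub, coeff_heatSolve hk hG ht, coeff_heatSolve hk hG' ht,
      ← duhamel_sub _ _ _ (continuous_coeff hG n) (continuous_coeff hG' n), sub_self]
    simp only [map_sub]
  rw [h2]
  refine le_trans (mul_le_mul_of_nonneg_right ?_ (sq_nonneg _)) h1
  linarith

end heatSolve

/-- Existence of mild solutions of `u' - Δu = N(t, u)` for Lipschitz nonlinearities. -/
theorem exists_isMild {d : ℕ} {T L : ℝ} (hT : 0 ≤ T) {N : ℝ → L2 d → L2 d}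
    (hN : Continuous (Function.uncurry N)) (hL : ∀ t g h, ‖N t g - N t h‖ ≤ L * ‖g - h‖)
    (θ : L2 d) : ∃ u : ℝ → L2 d, Continuous u ∧ IsMild T (fun s => N s (u s)) θ u := by
  have hL0 : 0 ≤ L ^ 2 := sq_nonneg L
  -- Chosen so that (1+T) T L² = k/4 ≤ (1+k)/4, hence contraction factor 1/2.
  set k : ℝ := 4 * ((1 + T) * T * L ^ 2)
  have hk : 0 ≤ k := by positivity
  -- The nonlinearity for v = e^(-kt) u, which solves v' - Δv + k v = e^(-kt) N(t, e^(kt) v). The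
  -- Lipschitz constant is unchanged; `projIcc` extends v continuously beyond [0,T].
  let G : C(Icc 0 T, L2 d) → ℝ → L2 d := fun v s =>
    Real.exp (-k * s) • N s (Real.exp (k * s) • v (projIcc 0 T hT s))
  have hG : ∀ v, Continuous (G v) := by
    intro v
    have hv : Continuous fun s => v (projIcc 0 T hT s) := v.continuous.comp continuous_projIcc
    have : Continuous fun s : ℝ => N s (Real.exp (k * s) • v (projIcc 0 T hT s)) :=
      hN.comp (continuous_id.prodMk ((by fun_prop : Continuous fun s : ℝ => Real.exp (k * s)).smul hv))
    exact (by fun_prop : Continuous fun s : ℝ => Real.exp (-k * s)).smul this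
  have hGL : ∀ v w s, ‖G v s - G w s‖ ≤ |L| * ‖v - w‖ := by
    intro v w s
    have e : Real.exp (-k * s) * Real.exp (k * s) = 1 := by
      rw [← Real.exp_add]
      simp
    have h1 : ‖v (projIcc 0 T hT s) - w (projIcc 0 T hT s)‖ ≤ ‖v - w‖ :=
      (v - w).norm_coe_le_norm _
    simp only [G]
    rw [← smul_sub, norm_smul, Real.norm_of_nonneg (Real.exp_pos _).le]
    calc _ ≤ Real.exp (-k * s) * (L * (Real.exp (k * s)
          * ‖v (projIcc 0 T hT s) - w (projIcc 0 T hT s)‖)) := by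
          refine mul_le_mul_of_nonneg_left ((hL _ _ _).trans_eq ?_) (Real.exp_pos _).le
          rw [← smul_sub, norm_smul, Real.norm_of_nonneg (Real.exp_pos _).le]
      _ = L * ‖v (projIcc 0 T hT s) - w (projIcc 0 T hT s)‖ := by
          linear_combination (L * ‖v (projIcc 0 T hT s) - w (projIcc 0 T hT s)‖) * e
      _ ≤ |L| * ‖v - w‖ :=
          mul_le_mul (le_abs_self L) h1 (norm_nonneg _) (abs_nonneg L)
  let Φ : C(Icc 0 T, L2 d) → C(Icc 0 T, L2 d) := fun v =>
    ⟨fun t => heatSolve k θ (G v) t, (continuousOn_heatSolve hT hk (hG v)).domRestrict⟩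
  have hΦ : ContractingWith (1 / 2) Φ := by
    refine ⟨by rw [← NNReal.coe_lt_coe]; norm_num, LipschitzWith.of_dist_le_mul fun v w => ?_⟩
    have hD : 0 ≤ dist v w := dist_nonneg
    rw [ContinuousMap.dist_le (by positivity)]
    intro t
    have h1 := norm_sq_heatSolve_sub_le (θ := θ) hk (hG v) (hG w) t.2
    have h2 : ∫ s in 0..(t : ℝ), ‖G v s - G w s‖ ^ 2 ≤ T * (L ^ 2 * dist v w ^ 2) := by
      have h3 : ∫ s in 0..(t : ℝ), ‖G v s - G w s‖ ^ 2
          ≤ ∫ _ in 0..(t : ℝ), (L ^ 2 * dist v w ^ 2) := by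
        apply intervalIntegral.integral_mono_on t.2.1
          ((((hG v).sub (hG w)).norm.pow 2).intervalIntegrable _ _) (by simp)
        intro s _
        have := pow_le_pow_left₀ (norm_nonneg _) (hGL v w s) 2
        rwa [mul_pow, sq_abs, ← dist_eq_norm v w] at this
      rw [intervalIntegral.integral_const, smul_eq_mul, sub_zero] at h3
      exact h3.trans (mul_le_mul_of_nonneg_right t.2.2 (by positivity))
    have h4 : (1 + k) * ‖heatSolve k θ (G v) t - heatSolve k θ (G w) t‖ ^ 2
        ≤ (1 + k) * ((1 / 2) * dist v w) ^ 2 := by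
      refine h1.trans ((mul_le_mul_of_nonneg_left h2 (by linarith)).trans ?_)
      have : (1 + T) * (T * (L ^ 2 * dist v w ^ 2)) = k / 4 * dist v w ^ 2 := by
        simp only [k]
        ring
      rw [this]
      nlinarith [sq_nonneg (dist v w)]
    have h5 := le_of_mul_le_mul_left h4 (by linarith)
    have h6 := abs_le_of_sq_le_sq h5 (by positivity)
    rw [dist_eq_norm]
    exact (le_abs_self _).trans (h6.trans_eq (by simp))
  have : Nonempty C(Icc 0 T, L2 d) := ⟨0⟩
  have hfix : Φ (hΦ.fixedPoint Φ) = hΦ.fixedPoint Φ := hΦ.fixedPoint_isFixedPt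
  set v := hΦ.fixedPoint Φ
  refine ⟨fun t => Real.exp (k * t) • v (projIcc 0 T hT t),
    (by fun_prop : Continuous fun t : ℝ => Real.exp (k * t)).smul
      (v.continuous.comp continuous_projIcc), fun t ht n => ?_⟩
  have h1 : v (projIcc 0 T hT t) = heatSolve k θ (G v) t := by
    conv_lhs => rw [← hfix, projIcc_of_mem hT ht]
    rfl
  rw [map_smul, h1, coeff_heatSolve hk (hG v) ht, smul_eq_mul]
  -- Undoes the exponential weight: rate λ_n + k for v is rate λ_n for u.
  conv_rhs => rw [← exp_mul_duhamel (laplaceEigenvalue n) k]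
  simp only [G, map_smul, smul_eq_mul]

theorem continuous_comp_projIcc {X : Type*} [TopologicalSpace X] {T : ℝ} (hT : 0 ≤ T) {w : ℝ → X}
    (hw : ContinuousOn w (Icc 0 T)) : Continuous fun t => w (projIcc 0 T hT t) :=
  hw.comp_continuous (continuous_subtype_val.comp continuous_projIcc) fun t => (projIcc 0 T hT t).2

/-- Stability of mild solutions. -/
theorem IsMild.norm_sub_sq_le {d : ℕ} {T L : ℝ} {G G' : ℝ → L2 d} {θ θ' : L2 d} {u u' : ℝ → L2 d}
    (h : IsMild T G θ u) (h' : IsMild T G' θ' u') (hG : Continuous G) (hG' : Continuous G')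
    (hu : Continuous u) (hu' : Continuous u')
    (hL : ∀ s ∈ Icc 0 T, ‖G s - G' s‖ ≤ L * ‖u s - u' s‖) :
    ∀ t ∈ Icc 0 T, ‖u t - u' t‖ ^ 2
      ≤ 2 * ‖θ - θ'‖ ^ 2 * Real.exp (2 * (1 + T) * L ^ 2 * T) := by
  intro t ht
  have hT : 0 ≤ T := ht.1.trans ht.2
  refine le_exp_of_le_integral (y := fun t => ‖u t - u' t‖ ^ 2) (by fun_prop) (by positivity)
    (by positivity) (fun t ht => ?_) t ht
  apply norm_sq_le_of_sum_le
  intro S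
  have hsub : Continuous fun s => G s - G' s := hG.sub hG'
  have h1 : ∫ s in 0..t, ‖G s - G' s‖ ^ 2 ≤ L ^ 2 * ∫ s in 0..t, ‖u s - u' s‖ ^ 2 := by
    rw [← intervalIntegral.integral_const_mul]
    apply intervalIntegral.integral_mono_on ht.1 (Continuous.intervalIntegrable (by fun_prop) _ _)
      (Continuous.intervalIntegrable (by fun_prop) _ _)
    intro s hs
    rw [← mul_pow]
    exact pow_le_pow_left₀ (norm_nonneg _) (hL s ⟨hs.1, hs.2.trans ht.2⟩) 2
  have h2 : ∀ n ∈ S, coeff n (u t - u' t) ^ 2 ≤ 2 * coeff n (θ - θ') ^ 2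
      + 2 * (1 + T) * ∫ s in 0..t, coeff n (G s - G' s) ^ 2 := by
    intro n _
    rw [map_sub, h t ht, h' t ht, ← duhamel_sub _ _ _ (continuous_coeff hG n)
      (continuous_coeff hG' n), ← map_sub]
    simp only [← map_sub]
    exact duhamel_sq_le (laplaceEigenvalue_nonneg n) (continuous_coeff hsub n) ht.1 ht.2
  refine (Finset.sum_le_sum h2).trans ?_
  rw [Finset.sum_add_distrib, ← Finset.mul_sum, ← Finset.mul_sum]
  have h3 := sum_coeff_sq_le (θ - θ') S
  have h4 := (sum_integral_coeff_sq_le hsub ht.1 S).trans h1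
  have h5 := mul_le_mul_of_nonneg_left h4 (by linarith : 0 ≤ 2 * (1 + T))
  linarith

theorem IsMild.eqOn {d : ℕ} {T L : ℝ} {G G' : ℝ → L2 d} {θ : L2 d} {u u' : ℝ → L2 d}
    (h : IsMild T G θ u) (h' : IsMild T G' θ u') (hG : Continuous G) (hG' : Continuous G')
    (hu : Continuous u) (hu' : Continuous u')
    (hL : ∀ s ∈ Icc 0 T, ‖G s - G' s‖ ≤ L * ‖u s - u' s‖) : EqOn u u' (Icc 0 T) := by
  intro t ht
  have := h.norm_sub_sq_le h' hG hG' hu hu' hL t ht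
  simp only [sub_self, norm_zero] at this
  rw [← sub_eq_zero, ← norm_eq_zero]
  nlinarith [norm_nonneg (u t - u' t)]

end

noncomputable section

/-! ### Weak solutions are mild -/

theorem isWeakPartial_hartley {d : ℕ} (i : Fin d) (n : Fin d → ℤ) :
    IsWeakPartial i (contL2 (hartley n)) ((2 * Real.pi * n i) • contL2 (hartley (-n))) := by
  rw [isWeakPartial_iff_coeff]
  intro m
  rw [map_smul, coeff_contL2_hartley, coeff_contL2_hartley, smul_eq_mul]
  by_cases h : m = -n
  · subst h
    simp
  · have h' : -m ≠ n := fun h' => h (by rw [← h', neg_neg])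
    simp [h, h']

/-- The element of `H¹(Ω)` given by a function and its weak gradient. -/
def H1.mk {d : ℕ} (g : L2 d) (g' : Fin d → L2 d) (h : ∀ i, IsWeakPartial i g (g' i)) : H1 d :=
  (⟨(g, g'), h⟩ : h1Submodule d)

/-- Hartley functions as elements of `H¹(Ω)`. -/
def hartleyH1 {d : ℕ} (n : Fin d → ℤ) : H1 d :=
  H1.mk (contL2 (hartley n)) (fun i => (2 * Real.pi * n i) • contL2 (hartley (-n)))
    fun i => isWeakPartial_hartley i n

theorem toL2_hartleyH1 {d : ℕ} (n : Fin d → ℤ) :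
    H1.toL2 (hartleyH1 n) = contL2 (hartley n) := rfl

theorem partialDeriv_hartleyH1 {d : ℕ} (i : Fin d) (n : Fin d → ℤ) :
    H1.partialDeriv i (hartleyH1 n) = (2 * Real.pi * n i) • contL2 (hartley (-n)) := rfl

theorem coeff_partialDeriv {d : ℕ} (i : Fin d) (v : H1 d) (n : Fin d → ℤ) :
    coeff n (H1.partialDeriv i v) = -(2 * Real.pi * n i * coeff (-n) (H1.toL2 v)) :=
  isWeakPartial_iff_coeff.1 (v.2 i) n

theorem toHNegOne_apply {d : ℕ} (g : L2 d) (v : H1 d) : toHNegOne g v = ⟪g, H1.toL2 v⟫_ℝ := rfl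

theorem toHNegOne_hartleyH1 {d : ℕ} (g : L2 d) (n : Fin d → ℤ) :
    toHNegOne g (hartleyH1 n) = coeff n g := by
  rw [toHNegOne_apply, toL2_hartleyH1, real_inner_comm, coeff_apply]

theorem sum_inner_partialDeriv_hartleyH1 {d : ℕ} (v : H1 d) (n : Fin d → ℤ) :
    ∑ i, ⟪H1.partialDeriv i v, H1.partialDeriv i (hartleyH1 n)⟫_ℝ
      = laplaceEigenvalue n * coeff n (H1.toL2 v) := by
  rw [laplaceEigenvalue_eq, Finset.sum_mul]
  apply Finset.sum_congr rfl
  intro i _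
  rw [partialDeriv_hartleyH1, real_inner_smul_right, real_inner_comm, ← coeff_apply,
    coeff_partialDeriv]
  simp
  ring

theorem integral_mul_eq_inner {d : ℕ} {F : Torus d → ℝ} {G : L2 d} (h : F =ᵐ[torusMeasure d] G)
    (v : L2 d) : ∫ x, F x * v x ∂(torusMeasure d) = ⟪G, v⟫_ℝ := by
  rw [inner_eq_integral]
  apply integral_congr_ae
  filter_upwards [h] with x hx
  rw [hx]

/-- Testing with the n-th Hartley function leaves the scalar equation a' = -λ_n a + g in integral
form, which determines a. Here `w'` is a continuous extension of `w` from [0,T] and `G` represents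
the right-hand side in L². -/
theorem IsWeakSolution.isMild {d : ℕ} {T : ℝ} {F : ℝ → Torus d → ℝ} {θ : L2 d} {w w' : ℝ → L2 d}
    (h : IsWeakSolution T F θ w) (hw : EqOn w w' (Icc 0 T)) (hc : Continuous w') {G : ℝ → L2 d}
    (hG : Continuous G) (hF : ∀ s ∈ Icc 0 T, F s =ᵐ[torusMeasure d] G s) : IsMild T G θ w' := by
  obtain ⟨uH, u', -, huH, hu', hint, heq⟩ := h.weak
  intro t ht n
  have hT : 0 ≤ T := ht.1.trans ht.2
  refine eq_duhamel_of_integral_eq (continuous_coeff hG n) (continuous_coeff hc n)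
    (fun t ht => ?_) t ht
  have h1 := congrArg (fun φ : HNegOne d => φ (hartleyH1 n)) (hint t ht)
  simp only [add_apply, toHNegOne_hartleyH1] at h1
  rw [← hw ht, h1, h.initial]
  congr 1
  have hu'i : IntegrableOn u' (Icc 0 T) volume := hu'.integrable (by norm_num)
  have hi : IntervalIntegrable u' volume 0 t :=
    (intervalIntegrable_iff_integrableOn_Ioc_of_le ht.1).2
      (hu'i.mono_set (Ioc_subset_Icc_self.trans (Icc_subset_Icc_right ht.2)))
  have h2 := (ContinuousLinearMap.apply ℝ ℝ (hartleyH1 n)).intervalIntegral_comp_comm hi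
  simp only [ContinuousLinearMap.apply_apply] at h2
  rw [← h2]
  apply intervalIntegral.integral_congr_ae
  rw [uIoc_of_le ht.1]
  have h3 := (ae_restrict_iff' measurableSet_Icc).1 huH
  have h4 := (ae_restrict_iff' measurableSet_Icc).1 heq
  filter_upwards [h3, h4] with s hs3 hs4 hs
  have hs' : s ∈ Icc 0 T := ⟨hs.1.le, hs.2.trans ht.2⟩
  have h5 := hs4 hs' (hartleyH1 n)
  rw [sum_inner_partialDeriv_hartleyH1, hs3 hs', integral_mul_eq_inner (hF s hs'),
    toL2_hartleyH1, real_inner_comm, ← coeff_apply, hw hs'] at h5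
  linarith

/-! ### Mild solutions with initial value in `H¹(Ω)` are strong -/

theorem HsBound.summable_partial {d : ℕ} {M : ℝ} {g : L2 d} (h : HsBound 1 M g) (i : Fin d) :
    Summable fun n : Fin d → ℤ => (-(2 * Real.pi * n i * coeff (-n) g)) ^ 2 := by
  refine Summable.of_nonneg_of_le (fun _ => sq_nonneg _) (fun n => ?_)
    ((Equiv.neg (Fin d → ℤ)).summable_iff.2 h.summable)
  simp only [Function.comp, Equiv.neg_apply, Real.rpow_one, laplaceEigenvalue_neg]
  rw [neg_sq, mul_pow]
  exact mul_le_mul_of_nonneg_right (by linarith [sq_le_laplaceEigenvalue n i]) (sq_nonneg _)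

open Classical in
/-- The element of `H¹(Ω)` that corresponds to an element of `L²(Ω)`, or `0` if there is none. -/
def liftH1 {d : ℕ} (g : L2 d) : H1 d :=
  if h : ∃ M, HsBound 1 M g then
    H1.mk g (fun i => ofCoeff fun n => -(2 * Real.pi * n i * coeff (-n) g)) fun i =>
      isWeakPartial_iff_coeff.2 fun n => coeff_ofCoeff (h.choose_spec.summable_partial i) n
  else 0

theorem toL2_liftH1 {d : ℕ} {M : ℝ} {g : L2 d} (h : HsBound 1 M g) :
    H1.toL2 (liftH1 g) = g := by
  rw [liftH1, dif_pos ⟨M, h⟩]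
  rfl

theorem continuousOn_H1 {d : ℕ} {X : Type*} [TopologicalSpace X] {s : Set X} {v : X → H1 d}
    (h : ContinuousOn (fun t => H1.toL2 (v t)) s)
    (h' : ∀ i, ContinuousOn (fun t => H1.partialDeriv i (v t)) s) : ContinuousOn v s := by
  have : Topology.IsInducing (Subtype.val : h1Submodule d → _) := Topology.IsInducing.subtypeVal
  exact this.continuousOn_iff.2 (h.prodMk (continuousOn_pi.2 h'))

/-- `toHNegOne` as a continuous linear map. -/
def toHNegOneL (d : ℕ) : L2 d →L[ℝ] HNegOne d :=
  LinearMap.mkContinuous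
    { toFun := toHNegOne
      map_add' := fun g h => by
        ext v
        simp only [add_apply, toHNegOne_apply, inner_add_left]
      map_smul' := fun c g => by
        ext v
        simp only [smul_apply, toHNegOne_apply, real_inner_smul_left, smul_eq_mul,
          RingHom.id_apply] }
    ‖(H1.toL2 : H1 d →L[ℝ] L2 d)‖ (fun g => by
      refine ContinuousLinearMap.opNorm_le_bound _ (by positivity) fun v => ?_
      change ‖⟪g, H1.toL2 v⟫_ℝ‖ ≤ _
      refine (norm_inner_le_norm _ _).trans ?_
      have := H1.toL2.le_opNorm v
      calc _ ≤ ‖g‖ * (‖(H1.toL2 : H1 d →L[ℝ] L2 d)‖ * ‖v‖) :=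
            mul_le_mul_of_nonneg_left this (norm_nonneg _)
        _ = _ := by ring)

theorem toHNegOneL_apply {d : ℕ} (g : L2 d) : toHNegOneL d g = toHNegOne g := rfl

/-- Parseval for the Dirichlet form; it carries the modewise equation over to arbitrary test
functions in H¹. -/
theorem hasSum_sum_inner_partialDeriv {d : ℕ} (v w : H1 d) :
    HasSum (fun n => laplaceEigenvalue n * (coeff n (H1.toL2 v) * coeff n (H1.toL2 w)))
      (∑ i, ⟪H1.partialDeriv i v, H1.partialDeriv i w⟫_ℝ) := by
  have h1 : ∀ i : Fin d, HasSum
      (fun n : Fin d → ℤ => (2 * Real.pi * n i) ^ 2 * (coeff n (H1.toL2 v) * coeff n (H1.toL2 w)))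
      ⟪H1.partialDeriv i v, H1.partialDeriv i w⟫_ℝ := by
    intro i
    have := (Equiv.neg (Fin d → ℤ)).hasSum_iff.2
      (hasSum_coeff_mul_coeff (H1.partialDeriv i v) (H1.partialDeriv i w))
    refine this.congr_fun fun n => ?_
    simp only [Function.comp, Equiv.neg_apply, coeff_partialDeriv, neg_neg, Pi.neg_apply]
    push_cast
    ring
  have h2 := hasSum_sum (s := Finset.univ) fun i _ => h1 i
  refine h2.congr_fun fun n => ?_
  rw [laplaceEigenvalue_eq, Finset.sum_mul]

section Strong

variable {d : ℕ} {T : ℝ} {G : ℝ → L2 d} {θ : L2 d} {u : ℝ → L2 d}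

/-- A summable bound for `(1 + λ_n) |⟨u(t), e_n⟩|²` that is uniform in time. -/
def energyBound (T : ℝ) (G : ℝ → L2 d) (θ : L2 d) (n : Fin d → ℤ) : ℝ :=
  2 * ((1 + laplaceEigenvalue n) * coeff n θ ^ 2)
    + 2 * (1 + T) * ∫ s in 0..T, coeff n (G s) ^ 2

theorem energyBound_nonneg (hT : 0 ≤ T) (n : Fin d → ℤ) : 0 ≤ energyBound T G θ n := by
  have h1 := laplaceEigenvalue_nonneg n
  have h2 : 0 ≤ ∫ s in 0..T, coeff n (G s) ^ 2 :=
    intervalIntegral.integral_nonneg hT fun _ _ => sq_nonneg _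
  unfold energyBound
  positivity

theorem summable_energyBound {M : ℝ} (hT : 0 ≤ T) (hG : Continuous G) (hθ : HsBound 1 M θ) :
    Summable (energyBound T G θ) := by
  refine Summable.add (Summable.mul_left 2 ?_) ((summable_integral_coeff_sq hG hT).mul_left _)
  simpa only [Real.rpow_one] using hθ.summable

theorem IsMild.weighted_coeff_sq_le (h : IsMild T G θ u) (hG : Continuous G) {t : ℝ}
    (ht : t ∈ Icc 0 T) (n : Fin d → ℤ) :
    (1 + laplaceEigenvalue n) * coeff n (u t) ^ 2 ≤ energyBound T G θ n := by
  rw [h t ht n]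
  refine (duhamel_weighted_sq_le (laplaceEigenvalue_nonneg n) (continuous_coeff hG n)
    ht.1 ht.2).trans (add_le_add le_rfl (mul_le_mul_of_nonneg_left ?_
      (by linarith [ht.1, ht.2])))
  exact integral_sq_mono (continuous_coeff hG n) ht.1 ht.2

theorem IsMild.hsBound_one (h : IsMild T G θ u) (hG : Continuous G) {M : ℝ} (hθ : HsBound 1 M θ)
    {t : ℝ} (ht : t ∈ Icc 0 T) : HsBound 1 (∑' n, energyBound T G θ n) (u t) := by
  intro S
  have hT : 0 ≤ T := ht.1.trans ht.2
  refine le_trans (Finset.sum_le_sum fun n _ => ?_)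
    ((summable_energyBound hT hG hθ).sum_le_tsum S fun n _ => energyBound_nonneg hT n)
  rw [Real.rpow_one]
  exact h.weighted_coeff_sq_le hG ht n

/-- The bound `energyBound` is summable and uniform in time, so continuity of each coefficient of
the gradient suffices. -/
theorem IsMild.continuousOn_liftH1 (h : IsMild T G θ u) (hG : Continuous G) (hu : Continuous u)
    (hT : 0 ≤ T) {M : ℝ} (hθ : HsBound 1 M θ) :
    ContinuousOn (fun t => liftH1 (u t)) (Icc 0 T) := by
  have hl : ∀ t ∈ Icc 0 T, H1.toL2 (liftH1 (u t)) = u t := fun t ht =>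
    toL2_liftH1 (h.hsBound_one hG hθ ht)
  refine continuousOn_H1 (hu.continuousOn.congr hl) fun i => ?_
  have e : ∀ t ∈ Icc 0 T, ∀ n, coeff n (H1.partialDeriv i (liftH1 (u t)))
      = -(2 * Real.pi * n i * coeff (-n) (u t)) := fun t ht n => by
    rw [coeff_partialDeriv, hl t ht]
  refine continuousOn_of_coeff (fun n => ?_)
    ((Equiv.neg (Fin d → ℤ)).summable_iff.2 (summable_energyBound hT hG hθ)) fun t ht n => ?_
  · exact ((continuous_coeff hu (-n)).const_mul _).neg.continuousOn.congr fun t ht => e t ht n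
  · rw [e t ht, neg_sq, mul_pow]
    refine le_trans (mul_le_mul_of_nonneg_right ?_ (sq_nonneg _))
      (h.weighted_coeff_sq_le hG ht (-n))
    rw [laplaceEigenvalue_neg]
    linarith [sq_le_laplaceEigenvalue n i]

theorem sobolevNorm_sq {d : ℕ} (s : ℝ) (g : L2 d) :
    sobolevNorm s g ^ 2 = ∑' n : Fin d → ℤ, ENNReal.ofReal ((1 + laplaceEigenvalue n) ^ s *
      coeff n g ^ 2) := by
  rw [sobolevNorm_eq, ← ENNReal.rpow_natCast, ← ENNReal.rpow_mul]
  norm_num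

/-- Sum and time integral are interchanged; on each mode `duhamel_energy` controls λ_n² ∫ a². -/
theorem IsMild.lintegral_sobolevNorm_two_lt_top (h : IsMild T G θ u) (hG : Continuous G)
    (hu : Continuous u) (hT : 0 ≤ T) {M : ℝ} (hθ : HsBound 1 M θ) :
    ∫⁻ t in Icc 0 T, sobolevNorm 2 (u t) ^ 2 < ⊤ := by
  simp only [sobolevNorm_sq]
  have hc : ∀ n, Continuous fun t => (1 + laplaceEigenvalue n) ^ (2 : ℝ) * coeff n (u t) ^ 2 :=
    fun n => ((continuous_coeff hu n).pow 2).const_mul _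
  rw [lintegral_tsum fun n => (hc n).measurable.ennreal_ofReal.aemeasurable]
  -- From (1+λ)² ≤ 2 + 2λ²: the first part contributes 2T times the energy bound, the second 2(λ c²
  -- + ∫ g²) with λ c² below the energy bound.
  have hb : ∀ n, ∫⁻ t in Icc 0 T, ENNReal.ofReal
      ((1 + laplaceEigenvalue n) ^ (2 : ℝ) * coeff n (u t) ^ 2)
      ≤ ENNReal.ofReal ((2 * T + 2) * energyBound T G θ n
        + 2 * ∫ s in 0..T, coeff n (G s) ^ 2) := by
    intro n
    rw [← ofReal_integral_eq_lintegral_ofReal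
      ((hc n).continuousOn.integrableOn_compact isCompact_Icc)
      (Filter.Eventually.of_forall fun t => mul_nonneg (weight_nonneg 2 n) (sq_nonneg _)),
      integral_Icc_eq_integral_Ioc, ← intervalIntegral.integral_of_le hT]
    apply ENNReal.ofReal_le_ofReal
    have hl := laplaceEigenvalue_nonneg n
    set g := fun s => coeff n (G s)
    set a := duhamel (laplaceEigenvalue n) (coeff n θ) g
    have ha : Continuous a := continuous_duhamel _ _ (continuous_coeff hG n)
    have h1 : ∫ t in 0..T, (1 + laplaceEigenvalue n) ^ (2 : ℝ) * coeff n (u t) ^ 2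
        = ∫ t in 0..T, (1 + laplaceEigenvalue n) ^ (2 : ℝ) * a t ^ 2 := by
      apply intervalIntegral.integral_congr
      intro t ht
      rw [uIcc_of_le hT] at ht
      simp only [h t ht n, a, g]
    have h2 : ∫ t in 0..T, a t ^ 2 ≤ ∫ _ in 0..T, energyBound T G θ n := by
      apply intervalIntegral.integral_mono_on hT ((ha.pow 2).intervalIntegrable _ _) (by simp)
      intro t ht
      have := h.weighted_coeff_sq_le hG ht n
      rw [h t ht n] at this
      exact le_trans (le_mul_of_one_le_left (sq_nonneg _) (by linarith)) this
    rw [intervalIntegral.integral_const, smul_eq_mul, sub_zero] at h2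
    have h3 := duhamel_energy (c := coeff n θ) hl (continuous_coeff hG n) hT
    have h4 : laplaceEigenvalue n * coeff n θ ^ 2 ≤ energyBound T G θ n := by
      have h5 : 0 ≤ ∫ s in 0..T, coeff n (G s) ^ 2 :=
        intervalIntegral.integral_nonneg hT fun _ _ => sq_nonneg _
      have h6 := mul_nonneg (by linarith : 0 ≤ 2 * (1 + T)) h5
      have h7 := mul_nonneg hl (sq_nonneg (coeff n θ))
      unfold energyBound
      nlinarith [sq_nonneg (coeff n θ)]
    rw [h1, intervalIntegral.integral_const_mul, Real.rpow_two]
    have h8 : 0 ≤ ∫ t in 0..T, a t ^ 2 :=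
      intervalIntegral.integral_nonneg hT fun _ _ => sq_nonneg _
    change laplaceEigenvalue n ^ 2 * ∫ t in 0..T, a t ^ 2 ≤ _ at h3
    nlinarith [mul_nonneg (sq_nonneg (1 - laplaceEigenvalue n)) h8]
  refine (ENNReal.tsum_le_tsum hb).trans_lt ?_
  have hs : Summable fun n => (2 * T + 2) * energyBound T G θ n
      + 2 * ∫ s in 0..T, coeff n (G s) ^ 2 :=
    ((summable_energyBound hT hG hθ).mul_left _).add ((summable_integral_coeff_sq hG hT).mul_left 2)
  exact hs.tsum_ofReal_lt_top

/-- The time derivative of a mild solution. -/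
def timeDeriv (G u : ℝ → L2 d) (t : ℝ) : L2 d :=
  ofCoeff (fun n => -(laplaceEigenvalue n * coeff n (u t))) + G t

theorem HsBound.summable_laplace {M : ℝ} {g : L2 d} (h : HsBound 2 M g) :
    Summable fun n => (-(laplaceEigenvalue n * coeff n g)) ^ 2 := by
  refine Summable.of_nonneg_of_le (fun _ => sq_nonneg _) (fun n => ?_) h.summable
  rw [neg_sq, mul_pow, Real.rpow_two]
  have := laplaceEigenvalue_nonneg n
  exact mul_le_mul_of_nonneg_right (by nlinarith) (sq_nonneg _)

theorem HsBound.norm_laplace_le {M : ℝ} {g : L2 d} (h : HsBound 2 M g) :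
    ‖ofCoeff fun n => -(laplaceEigenvalue n * coeff n g)‖ ^ 2 ≤ M := by
  apply norm_sq_le_of_sum_le
  intro S
  refine le_trans (Finset.sum_le_sum fun n _ => ?_) (h S)
  rw [coeff_ofCoeff h.summable_laplace, neg_sq, mul_pow, Real.rpow_two]
  have := laplaceEigenvalue_nonneg n
  exact mul_le_mul_of_nonneg_right (by nlinarith) (sq_nonneg _)

/-- Finiteness of the integral puts u(t) in H² for almost every t; at the remaining times `ofCoeff`
may take its default value in `timeDeriv`. -/
theorem IsMild.ae_hsBound_two (h : IsMild T G θ u) (hG : Continuous G)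
    (hu : Continuous u) (hT : 0 ≤ T) {M : ℝ} (hθ : HsBound 1 M θ) :
    ∀ᵐ t ∂(volume.restrict (Icc 0 T)),
      sobolevNorm 2 (u t) < ⊤ ∧ HsBound 2 ((sobolevNorm 2 (u t)).toReal ^ 2) (u t) := by
  have hm : Measurable fun t => sobolevNorm 2 (u t) ^ 2 := by
    simp only [sobolevNorm_sq]
    refine Measurable.tsum fun n => ?_
    exact (((continuous_coeff hu n).pow 2).const_mul _).measurable.ennreal_ofReal
  filter_upwards [ae_lt_top hm (h.lintegral_sobolevNorm_two_lt_top hG hu hT hθ).ne] with t ht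
  have ht' : sobolevNorm 2 (u t) < ⊤ := by
    rw [lt_top_iff_ne_top]
    intro hne
    rw [hne] at ht
    simp at ht
  exact ⟨ht', hsBound_of_sobolevNorm_le ENNReal.toReal_nonneg (ENNReal.ofReal_toReal ht'.ne).ge⟩

theorem IsMild.memLp_timeDeriv (h : IsMild T G θ u) (hG : Continuous G)
    (hu : Continuous u) (hT : 0 ≤ T) {M : ℝ} (hθ : HsBound 1 M θ) :
    MemLp (timeDeriv G u) 2 (volume.restrict (Icc 0 T)) := by
  have hae := h.ae_hsBound_two hG hu hT hθ
  have hGm : MemLp G 2 (volume.restrict (Icc 0 T)) := by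
    obtain ⟨C, hC⟩ := isCompact_Icc.exists_bound_of_continuousOn hG.continuousOn (s := Icc 0 T)
    exact MemLp.of_bound hG.aestronglyMeasurable C
      ((ae_restrict_iff' measurableSet_Icc).2 (Filter.Eventually.of_forall hC))
  refine MemLp.add (f := fun t => ofCoeff fun n => -(laplaceEigenvalue n * coeff n (u t))) ?_ hGm
  have hmeas : AEStronglyMeasurable
      (fun t => ofCoeff fun n => -(laplaceEigenvalue n * coeff n (u t)))
      (volume.restrict (Icc 0 T)) := by
    -- Measurability comes from the expansion: almost everywhere the Laplacian is the limit of
    -- finite sums that are continuous in time.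
    refine aestronglyMeasurable_of_tendsto_ae (Filter.atTop (α := Finset (Fin d → ℤ)))
      (f := fun S t => ∑ n ∈ S, (-(laplaceEigenvalue n * coeff n (u t))) • contL2 (hartley n))
      (fun S => ?_) ?_
    · refine Continuous.aestronglyMeasurable (continuous_finsetSum S fun n _ => ?_)
      exact ((continuous_coeff hu n).const_mul _).neg.smul continuous_const
    · filter_upwards [hae] with t ht
      have := hasSum_coeff_smul (ofCoeff fun n => -(laplaceEigenvalue n * coeff n (u t)))
      simp only [coeff_ofCoeff ht.2.summable_laplace] at this
      exact this
  refine ⟨hmeas, ?_⟩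
  rw [eLpNorm_lt_top_iff_lintegral_rpow_enorm_lt_top (by norm_num) (by norm_num)]
  refine lt_of_le_of_lt (lintegral_mono_ae ?_)
    (h.lintegral_sobolevNorm_two_lt_top hG hu hT hθ)
  filter_upwards [hae] with t ht
  have h1 := abs_le_of_sq_le_sq ht.2.norm_laplace_le ENNReal.toReal_nonneg
  rw [abs_norm] at h1
  have h2 : ‖ofCoeff fun n => -(laplaceEigenvalue n * coeff n (u t))‖ₑ ≤ sobolevNorm 2 (u t) := by
    rw [← ofReal_norm, ← ENNReal.ofReal_toReal ht.1.ne]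
    exact ENNReal.ofReal_le_ofReal h1
  simp only [ENNReal.toReal_ofNat, ENNReal.rpow_ofNat]
  gcongr

theorem intervalIntegrable_of_memLp {E : Type*} [NormedAddCommGroup E] {v : ℝ → E}
    (hv : MemLp v 2 (volume.restrict (Icc 0 T))) {t : ℝ} (ht : t ∈ Icc 0 T) :
    IntervalIntegrable v volume 0 t := by
  have hi : IntegrableOn v (Icc 0 T) volume := hv.integrable (by norm_num)
  exact (intervalIntegrable_iff_integrableOn_Ioc_of_le ht.1).2
      (hi.mono_set (Ioc_subset_Icc_self.trans (Icc_subset_Icc_right ht.2)))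

theorem IsMild.initial (h : IsMild T G θ u) (hT : 0 ≤ T) : u 0 = θ := by
  apply L2_ext_coeff
  intro n
  rw [h 0 ⟨le_rfl, hT⟩ n, duhamel_initial]

theorem IsMild.eq_add_integral_timeDeriv (h : IsMild T G θ u) (hG : Continuous G)
    (hu : Continuous u) (hT : 0 ≤ T) {M : ℝ} (hθ : HsBound 1 M θ) {t : ℝ} (ht : t ∈ Icc 0 T) :
    u t = u 0 + ∫ s in 0..t, timeDeriv G u s := by
  apply L2_ext_coeff
  intro n
  set g := fun s => coeff n (G s)
  have hg : Continuous g := continuous_coeff hG n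
  set a := duhamel (laplaceEigenvalue n) (coeff n θ) g
  have ha : Continuous a := continuous_duhamel _ _ hg
  rw [map_add, ← (coeff n).intervalIntegral_comp_comm
    (intervalIntegrable_of_memLp (h.memLp_timeDeriv hG hu hT hθ) ht), h.initial hT, h t ht n]
  have h1 : ∫ s in 0..t, coeff n (timeDeriv G u s)
      = ∫ s in 0..t, (-laplaceEigenvalue n * a s + g s) := by
    apply intervalIntegral.integral_congr_ae
    rw [uIoc_of_le ht.1]
    filter_upwards [(ae_restrict_iff' measurableSet_Icc).1 (h.ae_hsBound_two hG hu hT hθ)]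
      with s hs hst
    have hs' : s ∈ Icc 0 T := ⟨hst.1.le, hst.2.trans ht.2⟩
    rw [timeDeriv, map_add, coeff_ofCoeff (hs hs').2.summable_laplace, h s hs' n]
    simp only [a, g]
    ring
  rw [h1, intervalIntegral.integral_eq_sub_of_hasDerivAt
    (fun s _ => hasDerivAt_duhamel _ _ hg s)
    ((((ha.const_mul _).add hg)).intervalIntegrable _ _), duhamel_initial]
  simp [g]

/-- At almost every time u(t) lies in H², and the weak formulation is Parseval applied to a' + λ_n a
= g. The derivative in the dual of H¹ is the image of the one in L². -/
theorem IsMild.isStrongSolution (h : IsMild T G θ u) (hG : Continuous G) (hu : Continuous u)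
    (hT : 0 ≤ T) {M : ℝ} (hθ : HsBound 1 M θ) {F : ℝ → Torus d → ℝ}
    (hF : ∀ s ∈ Icc 0 T, F s =ᵐ[torusMeasure d] G s) : IsStrongSolution T F θ u := by
  have hl : ∀ t ∈ Icc 0 T, H1.toL2 (liftH1 (u t)) = u t := fun t ht =>
    toL2_liftH1 (h.hsBound_one hG hθ ht)
  have hcont := h.continuousOn_liftH1 hG hu hT hθ
  have hLp := h.memLp_timeDeriv hG hu hT hθ
  refine ⟨⟨hu.continuousOn, h.initial hT, fun t => liftH1 (u t),
    fun t => toHNegOneL d (timeDeriv G u t), ?_, ?_, ?_, ?_, ?_⟩, ⟨_, hcont, hl⟩,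
    h.lintegral_sobolevNorm_two_lt_top hG hu hT hθ, timeDeriv G u, hLp,
    fun t ht => h.eq_add_integral_timeDeriv hG hu hT hθ ht⟩
  · obtain ⟨C, hC⟩ := isCompact_Icc.exists_bound_of_continuousOn hcont
    exact MemLp.of_bound (hcont.aestronglyMeasurable measurableSet_Icc) C
      ((ae_restrict_iff' measurableSet_Icc).2 (Filter.Eventually.of_forall hC))
  · exact (ae_restrict_iff' measurableSet_Icc).2 (Filter.Eventually.of_forall hl)
  · exact (toHNegOneL d).comp_memLp' hLp
  · intro t ht
    rw [(toHNegOneL d).intervalIntegral_comp_comm (intervalIntegrable_of_memLp hLp ht),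
      ← toHNegOneL_apply, ← toHNegOneL_apply, ← map_add,
      ← h.eq_add_integral_timeDeriv hG hu hT hθ ht]
  · filter_upwards [h.ae_hsBound_two hG hu hT hθ, ae_restrict_mem measurableSet_Icc]
      with t ht htm v
    rw [integral_mul_eq_inner (hF t htm), toHNegOneL_apply, toHNegOne_apply]
    have h1 := (hasSum_coeff_mul_coeff (timeDeriv G u t) (H1.toL2 v)).add
      (hasSum_sum_inner_partialDeriv (liftH1 (u t)) v)
    refine h1.unique ((hasSum_coeff_mul_coeff (G t) (H1.toL2 v)).congr_fun fun n => ?_)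
    rw [timeDeriv, map_add, coeff_ofCoeff ht.2.summable_laplace, hl t htm]
    ring

end Strong

end

noncomputable section

/-! ### Summability of negative powers of the eigenvalues -/

/-- The exponent 7/12 lies above 1/2, so one coordinate sums, and three coordinates together use up
7/4. -/
theorem summable_one_add_sq_rpow : Summable fun m : ℤ => (1 + (m : ℝ) ^ 2) ^ (-(7 / 12) : ℝ) := by
  refine Summable.of_norm_bounded_eventually
    (Real.summable_abs_int_rpow (b := 7 / 6) (by norm_num)) ?_
  filter_upwards [(Set.finite_singleton (0 : ℤ)).compl_mem_cofinite] with m hm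
  have hm0 : (0 : ℝ) < |(m : ℝ)| := abs_pos.2 (by exact_mod_cast hm)
  rw [Real.norm_of_nonneg (by positivity)]
  have e : |(m : ℝ)| ^ (-(7 / 6) : ℝ) = (|(m : ℝ)| ^ 2) ^ (-(7 / 12) : ℝ) := by
    rw [← Real.rpow_natCast, ← Real.rpow_mul hm0.le]
    norm_num
  rw [e, sq_abs]
  refine Real.rpow_le_rpow_of_nonpos ?_ (by linarith) (by norm_num)
  rw [← sq_abs]
  positivity

/-- A finite set of frequencies lies in a box, and over a box the sum of products is a product of
sums. -/
theorem summable_prod_apply {d : ℕ} {f : ℤ → ℝ} (hf : ∀ m, 0 ≤ f m) (hs : Summable f) :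
    Summable fun n : Fin d → ℤ => ∏ i, f (n i) := by
  refine summable_of_sum_le (c := ∏ _ : Fin d, ∑' m, f m)
    (fun n => Finset.prod_nonneg fun i _ => hf _) fun S => ?_
  have hsub : S ⊆ Fintype.piFinset fun i => S.image fun n => n i := fun n hn =>
    Fintype.mem_piFinset.2 fun i => Finset.mem_image_of_mem (fun n : Fin d → ℤ => n i) hn
  refine (Finset.sum_le_sum_of_subset_of_nonneg hsub
    fun n _ _ => Finset.prod_nonneg fun i _ => hf _).trans ?_
  rw [← Finset.prod_univ_sum]
  exact Finset.prod_le_prod (fun i _ => Finset.sum_nonneg fun m _ => hf m)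
    fun i _ => hs.sum_le_tsum _ fun m _ => hf m

/-- The threshold is d/2 ≤ 3/2 < 7/4. Each coordinate satisfies 1 + n_i² ≤ 1 + λ_n, so the weight
dominates a product of one-dimensional weights. -/
theorem summable_weight {d : ℕ} (hd : d ≤ 3) {s : ℝ} (hs : s ≤ -(7 / 4)) :
    Summable fun n : Fin d → ℤ => (1 + laplaceEigenvalue n) ^ s := by
  refine Summable.of_nonneg_of_le (fun n => weight_nonneg _ n) (fun n => ?_)
    (summable_prod_apply (d := d) (fun m => by positivity) summable_one_add_sq_rpow)
  have h1 := one_le_weight n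
  refine (Real.rpow_le_rpow_of_exponent_le h1 hs).trans ?_
  have h2 : ∏ i, (1 + (n i : ℝ) ^ 2) ^ (7 / 12 : ℝ) ≤ (1 + laplaceEigenvalue n) ^ (7 / 4 : ℝ) := by
    calc _ ≤ ∏ _ : Fin d, (1 + laplaceEigenvalue n) ^ (7 / 12 : ℝ) := by
          refine Finset.prod_le_prod (fun i _ => by positivity) fun i _ => ?_
          refine Real.rpow_le_rpow (by positivity) ?_ (by norm_num)
          have h3 := sq_le_laplaceEigenvalue n i
          have h4 : (1 : ℝ) ≤ (2 * Real.pi) ^ 2 := by nlinarith [Real.pi_gt_three]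
          rw [mul_pow] at h3
          nlinarith [sq_nonneg (n i : ℝ)]
      _ = (1 + laplaceEigenvalue n) ^ (7 / 12 * d : ℝ) := by
          rw [Finset.prod_const, Finset.card_univ, Fintype.card_fin, ← Real.rpow_natCast,
            ← Real.rpow_mul (by linarith)]
      _ ≤ _ := by
          refine Real.rpow_le_rpow_of_exponent_le h1 ?_
          have : (d : ℝ) ≤ 3 := by exact_mod_cast hd
          linarith
  have h5 : ∏ i, (1 + (n i : ℝ) ^ 2) ^ (-(7 / 12) : ℝ)
      = (∏ i, (1 + (n i : ℝ) ^ 2) ^ (7 / 12 : ℝ))⁻¹ := by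
    rw [← Finset.prod_inv_distrib]
    exact Finset.prod_congr rfl fun i _ => Real.rpow_neg (by positivity) _
  rw [h5, Real.rpow_neg (by linarith)]
  exact inv_anti₀ (Finset.prod_pos fun i _ => by positivity) h2

/-! ### Superposition operators -/

/-- The superposition operator `g ↦ f ∘ g` on `L²(Ω)`. -/
def superpose {d : ℕ} (f : ℝ → ℝ) (g : L2 d) : L2 d :=
  open Classical in if h : MemLp (fun x => f (g x)) 2 (torusMeasure d) then h.toLp else 0

section superpose

variable {d : ℕ} {f : ℝ → ℝ}

theorem memLp_superpose (hf : Continuous f) {C : ℝ} (hC : ∀ x, ‖f x‖ ≤ C) (g : L2 d) :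
    MemLp (fun x => f (g x)) 2 (torusMeasure d) :=
  MemLp.of_bound (hf.comp_aestronglyMeasurable (Lp.aestronglyMeasurable g)) C
    (Filter.Eventually.of_forall fun _ => hC _)

theorem coeFn_superpose (hf : Continuous f) {C : ℝ} (hC : ∀ x, ‖f x‖ ≤ C) (g : L2 d) :
    superpose f g =ᵐ[torusMeasure d] fun x => f (g x) := by
  rw [superpose, dif_pos (memLp_superpose hf hC g)]
  exact MemLp.coeFn_toLp _

theorem norm_superpose_sub_le (hf : Continuous f) {C : ℝ} (hC : ∀ x, ‖f x‖ ≤ C) {L : ℝ}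
    (hL : ∀ x y, |f x - f y| ≤ L * |x - y|) (g h : L2 d) :
    ‖superpose f g - superpose f h‖ ≤ L * ‖g - h‖ := by
  apply Lp.norm_le_mul_norm_of_ae_le_mul
  filter_upwards [coeFn_superpose hf hC g, coeFn_superpose hf hC h, Lp.coeFn_sub g h,
    Lp.coeFn_sub (superpose f g) (superpose f h)] with x h1 h2 h3 h4
  rw [h3, h4, Pi.sub_apply, Pi.sub_apply, h1, h2]
  exact hL _ _

theorem continuous_superpose (hf : Continuous f) {C : ℝ} (hC : ∀ x, ‖f x‖ ≤ C) {L : ℝ}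
    (hL : ∀ x y, |f x - f y| ≤ L * |x - y|) : Continuous (superpose f : L2 d → L2 d) := by
  refine (LipschitzWith.of_dist_le_mul (K := L.toNNReal) fun g h => ?_).continuous
  rw [dist_eq_norm, dist_eq_norm]
  exact (norm_superpose_sub_le hf hC hL g h).trans
    (mul_le_mul_of_nonneg_right (Real.le_coe_toNNReal L) (norm_nonneg _))

theorem hsBound_superpose (hf : Continuous f) {C : ℝ} (hC : ∀ x, ‖f x‖ ≤ C) (g : L2 d) :
    HsBound 0 (C ^ 2) (superpose f g) := by
  refine (hsBound_zero _).mono le_rfl (pow_le_pow_left₀ (norm_nonneg _) ?_ 2)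
  have h0 : 0 ≤ C := (norm_nonneg _).trans (hC 0)
  have := Lp.norm_le_of_ae_bound (f := superpose f g) h0 (by
    filter_upwards [coeFn_superpose hf hC g] with x hx
    rw [hx]
    exact hC _)
  simpa [measureUnivNNReal] using this

theorem exists_lipschitz_of_hasCompactSupport (hf : ContDiff ℝ ∞ f) (hfc : HasCompactSupport f) :
    ∃ L : ℝ, ∀ x y, |f x - f y| ≤ L * |x - y| := by
  obtain ⟨K, hK⟩ := ContDiff.lipschitzWith_of_hasCompactSupport hfc hf (by simp)
  exact ⟨K, fun x y => by simpa [Real.dist_eq] using hK.dist_le_mul x y⟩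

end superpose

/-! ### Sobolev norms of compositions -/

theorem hasSum_iterate_torusDeriv_sq {d : ℕ} (i : Fin d) (k : ℕ) :
    ∀ {φ : Torus d → ℝ} (h : IsSmooth φ),
      HasSum (fun n : Fin d → ℤ => (2 * Real.pi * n i) ^ (2 * k) * coeff n h.toL2 ^ 2)
        (∫ x, ((torusDeriv i)^[k] φ x) ^ 2 ∂(torusMeasure d)) := by
  induction k with
  | zero =>
    intro φ h
    have := hasSum_coeff_sq h.toL2
    rw [← real_inner_self_eq_norm_sq, inner_eq_integral] at this
    have e : ∫ x, h.toL2 x * h.toL2 x ∂(torusMeasure d) = ∫ x, φ x ^ 2 ∂(torusMeasure d) := by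
      apply integral_congr_ae
      filter_upwards [h.coeFn_toL2] with x hx
      rw [hx, sq]
    rw [e] at this
    simpa using this
  | succ k ih =>
    intro φ h
    have := (Equiv.neg (Fin d → ℤ)).hasSum_iff.2 (ih (h.torusDeriv i))
    refine this.congr_fun fun n => ?_
    simp only [Function.comp, Equiv.neg_apply]
    rw [coeff_torusDeriv h, neg_neg, mul_add, pow_add, Pi.neg_apply]
    push_cast
    rw [pow_mul, pow_mul]
    ring

/-- By the power mean inequality H^(k+1) is controlled by the pure derivatives of order k+1, so
mixed ones never occur. The factor d + 1 instead of d is at least 1 and also covers the constant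
term. -/
theorem weight_pow_le {d : ℕ} (k : ℕ) (n : Fin d → ℤ) :
    (1 + laplaceEigenvalue n) ^ (k + 1)
      ≤ 2 ^ k * (d + 1) ^ k * (1 + ∑ i, (2 * Real.pi * n i) ^ (2 * (k + 1))) := by
  have h1 := add_pow_le zero_le_one (laplaceEigenvalue_nonneg n) (k + 1)
  rw [one_pow, Nat.add_sub_cancel] at h1
  have h2 : laplaceEigenvalue n ^ (k + 1)
      ≤ (d + 1) ^ k * ∑ i, (2 * Real.pi * n i) ^ (2 * (k + 1)) := by
    have h3 := pow_sum_le_card_mul_sum_pow (s := Finset.univ)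
      (f := fun i => (2 * Real.pi * (n i : ℝ)) ^ 2) (fun i _ => sq_nonneg _) k
    rw [laplaceEigenvalue_eq]
    refine h3.trans ?_
    simp only [Finset.card_univ, Fintype.card_fin, ← pow_mul]
    have : 0 ≤ ∑ i, (2 * Real.pi * (n i : ℝ)) ^ (2 * (k + 1)) :=
      Finset.sum_nonneg fun i _ => by
        rw [pow_mul]
        positivity
    gcongr
    linarith
  refine h1.trans ?_
  have h4 : (1 : ℝ) ≤ (d + 1) ^ k := one_le_pow₀ (by linarith [Nat.cast_nonneg (α := ℝ) d])
  rw [mul_assoc]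
  refine mul_le_mul_of_nonneg_left ?_ (by positivity)
  linarith

/-- The derivatives of a composition are controlled linearly by the derivative of highest order. -/
theorem abs_iteratedDeriv_comp_le {f v : ℝ → ℝ} (hf : ContDiff ℝ ∞ f) (hv : ContDiff ℝ ∞ v)
    {k : ℕ} (hk : 1 ≤ k) {C M : ℝ} (hM : 1 ≤ M) (s : ℝ)
    (hC : ∀ j ≤ k, ∀ y, |iteratedDeriv j f y| ≤ C)
    (hvM : ∀ j, 1 ≤ j → j < k → |iteratedDeriv j v s| ≤ M) :
    |iteratedDeriv k (f ∘ v) s| ≤ k.factorial * C * M ^ k * (1 + |iteratedDeriv k v s|) := by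
  set y := |iteratedDeriv k v s|
  have hy : 0 ≤ y := abs_nonneg _
  have hk0 : (k : ℝ) ≠ 0 := by
    have : k ≠ 0 := by omega
    exact_mod_cast this
  -- The bound for compositions asks for the j-th derivative of v to be at most D^j. With D = M r
  -- the lower orders fit because M ≥ 1 and r ≥ 1, the top order fits because r^k = 1 + y, and D^k
  -- is linear in y.
  set r := (1 + y) ^ (1 / k : ℝ)
  have hr1 : 1 ≤ r := Real.one_le_rpow (by linarith) (by positivity)
  have hrk : r ^ k = 1 + y := by
    rw [← Real.rpow_natCast, ← Real.rpow_mul (by linarith), one_div_mul_cancel hk0, Real.rpow_one]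
  have hn : ((k : ℕ∞) : ℕ∞ω) ≤ ∞ := by exact_mod_cast le_top
  have h := norm_iteratedFDeriv_comp_le (n := k) hf hv hn s (C := C) (D := M * r)
    (fun j hj => by
      rw [norm_iteratedFDeriv_eq_norm_iteratedDeriv]
      exact hC j hj _)
    (fun j hj1 hjk => by
      rw [norm_iteratedFDeriv_eq_norm_iteratedDeriv, mul_pow]
      have hMj : M ≤ M ^ j := le_self_pow₀ hM (by omega)
      rcases hjk.lt_or_eq with hlt | rfl
      · refine (hvM j hj1 hlt).trans (hMj.trans ?_)
        exact le_mul_of_one_le_right (by positivity) (one_le_pow₀ hr1)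
      · rw [hrk]
        change y ≤ _
        nlinarith [hM.trans hMj])
  rw [norm_iteratedFDeriv_eq_norm_iteratedDeriv, mul_pow, hrk] at h
  rw [← Real.norm_eq_abs]
  linarith

end

noncomputable section

/-! ### Partial sums of Hartley series and bounds for their derivatives -/

section trigPoly

variable {d : ℕ}

/-- The sign `e` records the frequency flip, so that sums of this form are closed under
differentiation and can be differentiated inductively. -/
theorem torusDeriv_const_mul_hartley_sum (i : Fin d) (S : Finset (Fin d → ℤ))
    (a : (Fin d → ℤ) → ℝ) (e : ℤ) :
    torusDeriv i (fun x => ∑ n ∈ S, a n * hartley (e • n) x)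
      = fun x => ∑ n ∈ S, (2 * Real.pi * (e * n i) * a n) * hartley ((-e) • n) x := by
  funext x
  have h : HasDerivAt (fun s : ℝ => ∑ n ∈ S, a n * hartley (e • n) (x + Pi.single i (s : UnitAddCircle)))
      (∑ n ∈ S, a n * torusDeriv i (hartley (e • n)) x) 0 :=
    HasDerivAt.fun_sum fun n _ => (hasDerivAt_torusDeriv (isSmooth_hartley _) i x).const_mul _
  refine h.deriv.trans (Finset.sum_congr rfl fun n _ => ?_)
  rw [torusDeriv_hartley, neg_smul, Pi.smul_apply, smul_eq_mul]
  push_cast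
  ring

theorem abs_iterate_torusDeriv_hartley_sum_le (i : Fin d) (S : Finset (Fin d → ℤ)) (j : ℕ) :
    ∀ (a : (Fin d → ℤ) → ℝ) (e : ℤ), |e| = 1 → ∀ x,
      |(torusDeriv i)^[j] (fun x => ∑ n ∈ S, a n * hartley (e • n) x) x|
        ≤ ∑ n ∈ S, 2 * (|2 * Real.pi * n i| ^ j * |a n|) := by
  induction j with
  | zero =>
    intro a e _ x
    refine (Finset.abs_sum_le_sum_abs _ _).trans (Finset.sum_le_sum fun n _ => ?_)
    rw [abs_mul, pow_zero, one_mul, mul_comm]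
    exact mul_le_mul_of_nonneg_right (abs_hartley_le _ _) (abs_nonneg _)
  | succ j ih =>
    intro a e he x
    rw [Function.iterate_succ_apply, torusDeriv_const_mul_hartley_sum]
    refine (ih _ (-e) (by rwa [abs_neg]) x).trans (Finset.sum_le_sum fun n _ => le_of_eq ?_)
    have he' : |(e : ℝ)| = 1 := by exact_mod_cast he
    simp only [abs_mul, he']
    ring

/-- The partial sum of the Fourier series of `g`. -/
def partialSum (S : Finset (Fin d → ℤ)) (g : L2 d) (x : Torus d) : ℝ :=
  ∑ n ∈ S, coeff n g * hartley n x

theorem isSmooth_partialSum (S : Finset (Fin d → ℤ)) (g : L2 d) : IsSmooth (partialSum S g) :=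
  ContDiff.sum fun n _ => contDiff_const.mul (isSmooth_hartley n)

theorem toL2_partialSum (S : Finset (Fin d → ℤ)) (g : L2 d) :
    (isSmooth_partialSum S g).toL2 = ∑ n ∈ S, coeff n g • contL2 (hartley n) := by
  rw [IsSmooth.toL2]
  have : (⟨partialSum S g, (isSmooth_partialSum S g).continuous⟩ : C(Torus d, ℝ))
      = ∑ n ∈ S, coeff n g • hartley n := by
    ext x
    simp [partialSum, ContinuousMap.sum_apply]
  rw [this, map_sum]
  simp only [map_smul]

theorem coeff_partialSum (S : Finset (Fin d → ℤ)) (g : L2 d) (n : Fin d → ℤ) :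
    coeff n (isSmooth_partialSum S g).toL2 = if n ∈ S then coeff n g else 0 := by
  rw [toL2_partialSum, map_sum]
  simp only [map_smul, coeff_contL2_hartley, smul_eq_mul, mul_ite, mul_one, mul_zero]
  rw [Finset.sum_ite_eq]

theorem abs_two_pi_mul_pow_le {i : Fin d} {n : Fin d → ℤ} {j k : ℕ} (hj : j < k) :
    |2 * Real.pi * n i| ^ j ≤ (1 + laplaceEigenvalue n) ^ (((k : ℝ) - 1) / 2) := by
  have h1 := one_le_weight n
  have h2 : |2 * Real.pi * n i| ≤ (1 + laplaceEigenvalue n) ^ (1 / 2 : ℝ) := by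
    rw [← Real.sqrt_eq_rpow]
    apply Real.abs_le_sqrt
    linarith [sq_le_laplaceEigenvalue n i]
  refine (pow_le_pow_left₀ (abs_nonneg _) h2 j).trans ?_
  rw [← Real.rpow_natCast, ← Real.rpow_mul (by linarith)]
  apply Real.rpow_le_rpow_of_exponent_le h1
  have : (j : ℝ) + 1 ≤ k := by exact_mod_cast hj
  linarith

/-- The Sobolev embedding of H^(k+3/4) into C^(k-1), uniform in the set of frequencies retained. -/
theorem abs_iterate_torusDeriv_partialSum_le (hd : d ≤ 3) {k : ℕ} {M : ℝ} {g : L2 d}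
    (hg : HsBound (k + 3 / 4) M g) (S : Finset (Fin d → ℤ)) (i : Fin d) {j : ℕ} (hj : j < k)
    (x : Torus d) : |(torusDeriv i)^[j] (partialSum S g) x|
      ≤ (∑' n : Fin d → ℤ, (1 + laplaceEigenvalue n) ^ (-(7 / 4) : ℝ)) + M := by
  have h := abs_iterate_torusDeriv_hartley_sum_le i S j (fun n => coeff n g) 1 (by simp) x
  simp only [one_smul] at h
  refine h.trans ?_
  have h1 : ∀ n ∈ S, 2 * (|2 * Real.pi * n i| ^ j * |coeff n g|)
      ≤ (1 + laplaceEigenvalue n) ^ (-(7 / 4) : ℝ)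
        + (1 + laplaceEigenvalue n) ^ ((k : ℝ) + 3 / 4) * coeff n g ^ 2 := by
    intro n _
    have hw := one_le_weight n
    have hw0 : 0 < 1 + laplaceEigenvalue n := by linarith
    -- The inequality 2 p q |c| ≤ p² + q² c²: p² is the summable weight, q² the Sobolev weight, and
    -- p q is the size of a derivative of order k - 1.
    set p := (1 + laplaceEigenvalue n) ^ (-(7 / 8) : ℝ)
    set q := (1 + laplaceEigenvalue n) ^ (((k : ℝ) + 3 / 4) / 2)
    have hp : p ^ 2 = (1 + laplaceEigenvalue n) ^ (-(7 / 4) : ℝ) := by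
      rw [← Real.rpow_natCast, ← Real.rpow_mul hw0.le]
      norm_num
    have hq : q ^ 2 = (1 + laplaceEigenvalue n) ^ ((k : ℝ) + 3 / 4) := by
      rw [← Real.rpow_natCast, ← Real.rpow_mul hw0.le]
      norm_num
    have hpq : p * q = (1 + laplaceEigenvalue n) ^ (((k : ℝ) - 1) / 2) := by
      rw [← Real.rpow_add hw0]
      congr 1
      ring
    have h2 : |2 * Real.pi * n i| ^ j * |coeff n g| ≤ p * q * |coeff n g| :=
      mul_le_mul_of_nonneg_right (hpq ▸ abs_two_pi_mul_pow_le hj) (abs_nonneg _)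
    rw [← hp, ← hq, ← sq_abs (coeff n g)]
    nlinarith [sq_nonneg (p - q * |coeff n g|)]
  refine (Finset.sum_le_sum h1).trans ?_
  rw [Finset.sum_add_distrib]
  exact add_le_add ((summable_weight hd le_rfl).sum_le_tsum S fun n _ => weight_nonneg _ n) (hg S)

theorem integral_iterate_torusDeriv_partialSum_sq_le {k : ℕ} {M : ℝ} {g : L2 d}
    (hg : HsBound (k + 3 / 4) M g) (S : Finset (Fin d → ℤ)) (i : Fin d) :
    ∫ x, ((torusDeriv i)^[k] (partialSum S g) x) ^ 2 ∂(torusMeasure d) ≤ M := by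
  refine hasSum_le_of_sum_le (hasSum_iterate_torusDeriv_sq i k (isSmooth_partialSum S g))
    fun S' => le_trans (Finset.sum_le_sum fun n _ => ?_) (hg S')
  have hw := one_le_weight n
  have h1 : (2 * Real.pi * n i) ^ (2 * k) ≤ (1 + laplaceEigenvalue n) ^ ((k : ℝ) + 3 / 4) := by
    rw [pow_mul]
    refine (pow_le_pow_left₀ (sq_nonneg _) ((sq_le_laplaceEigenvalue n i).trans
      (by linarith : _ ≤ 1 + laplaceEigenvalue n)) k).trans ?_
    rw [← Real.rpow_natCast]
    exact Real.rpow_le_rpow_of_exponent_le hw (by linarith)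
  refine mul_le_mul h1 ?_ (sq_nonneg _) (weight_nonneg _ n)
  rw [coeff_partialSum]
  split_ifs
  · exact le_rfl
  · simpa using sq_nonneg (coeff n g)

end trigPoly

/-! ### Boundedness of superposition between Sobolev spaces -/

theorem hsBound_of_integral_iterate_le {d : ℕ} {φ : Torus d → ℝ} (h : IsSmooth φ) (k : ℕ)
    {A B : ℝ} (hA : ‖h.toL2‖ ^ 2 ≤ A)
    (hB : ∀ i, ∫ x, ((torusDeriv i)^[k + 1] φ x) ^ 2 ∂(torusMeasure d) ≤ B) :
    HsBound ((k + 1 : ℕ) : ℝ) (2 ^ k * (d + 1) ^ k * (A + d * B)) h.toL2 := by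
  intro S
  have h1 : ∀ n ∈ S, (1 + laplaceEigenvalue n) ^ ((k + 1 : ℕ) : ℝ) * coeff n h.toL2 ^ 2
      ≤ 2 ^ k * (d + 1) ^ k * (coeff n h.toL2 ^ 2
        + ∑ i, (2 * Real.pi * n i) ^ (2 * (k + 1)) * coeff n h.toL2 ^ 2) := by
    intro n _
    rw [Real.rpow_natCast, ← Finset.sum_mul, ← one_add_mul, ← mul_assoc]
    exact mul_le_mul_of_nonneg_right (weight_pow_le k n) (sq_nonneg _)
  refine (Finset.sum_le_sum h1).trans ?_
  rw [← Finset.mul_sum, Finset.sum_add_distrib, Finset.sum_comm]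
  refine mul_le_mul_of_nonneg_left ?_ (by positivity)
  refine add_le_add ((sum_coeff_sq_le _ S).trans hA) ?_
  calc _ ≤ ∑ _ : Fin d, B := by
        refine Finset.sum_le_sum fun i _ => le_trans ?_ (hB i)
        refine sum_le_hasSum S (fun n _ => ?_) (hasSum_iterate_torusDeriv_sq i (k + 1) h)
        rw [pow_mul]
        positivity
    _ = d * B := by simp

theorem exists_bound_iteratedDeriv {f : ℝ → ℝ} (hf : ContDiff ℝ ∞ f) (hfc : HasCompactSupport f)
    (k : ℕ) : ∃ C, ∀ j ≤ k, ∀ y, |iteratedDeriv j f y| ≤ C := by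
  have h : ∀ j : ℕ, ∃ C, ∀ y, ‖iteratedDeriv j f y‖ ≤ C := by
    intro j
    have hc : Continuous (iteratedDeriv j f) :=
      hf.continuous_iteratedDeriv j (by exact_mod_cast le_top)
    refine hc.bounded_above_of_compact_support ?_
    rw [iteratedDeriv_eq_equiv_comp]
    exact (hfc.iteratedFDeriv j).comp_left (by simp)
  choose C hC using h
  refine ⟨∑ j ∈ Finset.range (k + 1), |C j|, fun j hj y => ?_⟩
  refine ((hC j y).trans (le_abs_self _)).trans ?_
  exact Finset.single_le_sum (f := fun j => |C j|) (fun _ _ => abs_nonneg _)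
    (Finset.mem_range.2 (by omega))

/-- Superposition with a smooth function of compact support maps bounded subsets of `H^{k+3/4}` to
bounded subsets of `H^k`. -/
theorem exists_hsBound_superpose {d : ℕ} (hd : d ≤ 3) {f : ℝ → ℝ} (hf : ContDiff ℝ ∞ f)
    (hfc : HasCompactSupport f) (k : ℕ) (M : ℝ) :
    ∃ M', ∀ g : L2 d, HsBound ((k + 1 : ℕ) + 3 / 4) M g →
      HsBound ((k + 1 : ℕ) : ℝ) M' (superpose f g) := by
  obtain ⟨C, hC⟩ := exists_bound_iteratedDeriv hf hfc (k + 1)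
  have hC0 : ∀ x, ‖f x‖ ≤ C := fun x => by simpa using hC 0 (by omega) x
  obtain ⟨L, hL⟩ := exists_lipschitz_of_hasCompactSupport hf hfc
  set W := ∑' n : Fin d → ℤ, (1 + laplaceEigenvalue n) ^ (-(7 / 4) : ℝ)
  set A := ((k + 1).factorial * C * (1 + |W + M|) ^ (k + 1))
  -- The prefactor is that of `weight_pow_le`, C² bounds the L² part, and A² (2 + 2M) bounds the top
  -- derivative.
  refine ⟨2 ^ k * (d + 1) ^ k * (C ^ 2 + d * (A ^ 2 * (2 + 2 * M))), fun g hg S' => ?_⟩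
  have hcont : Continuous (superpose f : L2 d → L2 d) := continuous_superpose hf.continuous hC0 hL
  -- The chain rule needs smooth functions: the bound is proved for partial sums of g and passes to
  -- the limit, since only the finitely many coefficients in S' occur.
  have hlim : Filter.Tendsto (fun S => superpose f (isSmooth_partialSum S g).toL2) Filter.atTop
      (nhds (superpose f g)) := by
    refine (hcont.tendsto g).comp ?_
    simp only [toL2_partialSum]
    exact hasSum_coeff_smul g
  have hlim' : Filter.Tendsto (fun S => ∑ n ∈ S', (1 + laplaceEigenvalue n) ^ ((k + 1 : ℕ) : ℝ)
      * coeff n (superpose f (isSmooth_partialSum S g).toL2) ^ 2) Filter.atTop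
      (nhds (∑ n ∈ S', (1 + laplaceEigenvalue n) ^ ((k + 1 : ℕ) : ℝ)
        * coeff n (superpose f g) ^ 2)) :=
    tendsto_finsetSum _ fun n _ =>
      ((((coeff n).continuous.tendsto _).comp hlim).pow 2).const_mul _
  refine le_of_tendsto' hlim' fun S => ?_
  set v := partialSum S g
  have hv : IsSmooth v := isSmooth_partialSum S g
  have hfv : IsSmooth fun x => f (v x) := hv.comp hf
  have e : superpose f hv.toL2 = hfv.toL2 := by
    apply Lp.ext
    filter_upwards [coeFn_superpose hf.continuous hC0 hv.toL2, hv.coeFn_toL2, hfv.coeFn_toL2]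
      with x h1 h2 h3
    rw [h1, h2, h3]
  rw [e]
  refine hsBound_of_integral_iterate_le hfv k ?_ (fun i => ?_) S'
  · rw [← e]
    refine norm_sq_le_of_sum_le _ fun S'' => ?_
    have := hsBound_superpose hf.continuous hC0 hv.toL2 S''
    simpa using this
  -- Lower derivatives of v are bounded by the embedding, so the top derivative enters linearly;
  -- then (1 + y)² ≤ 2 + 2y², and that derivative is bounded in L².
  · have hpt : ∀ x, ((torusDeriv i)^[k + 1] (fun x => f (v x)) x) ^ 2
        ≤ A ^ 2 * (2 + 2 * ((torusDeriv i)^[k + 1] v x) ^ 2) := by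
      intro x
      have h1 := abs_iteratedDeriv_comp_le (k := k + 1) (M := 1 + |W + M|) hf
        (contDiff_translate hv i x) (by omega) (by linarith [abs_nonneg (W + M)]) 0
        (fun j hj y => hC j hj y) (fun j _ hj2 => by
          rw [iteratedDeriv_translate]
          refine (abs_iterate_torusDeriv_partialSum_le hd hg S i hj2 _).trans ?_
          linarith [le_abs_self (W + M)])
      have h2 := iteratedDeriv_translate (fun x => f (v x)) i x (k + 1)
      have h3 : (f ∘ fun s : ℝ => v (x + Pi.single i (s : UnitAddCircle)))
        = fun s : ℝ => f (v (x + Pi.single i (s : UnitAddCircle))) := rfl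
      rw [h3, h2, iteratedDeriv_translate] at h1
      simp only [add_single_coe_zero] at h1
      have h4 := pow_le_pow_left₀ (abs_nonneg _) h1 2
      rw [sq_abs, mul_pow] at h4
      refine h4.trans (mul_le_mul_of_nonneg_left ?_ (sq_nonneg _))
      rw [← sq_abs ((torusDeriv i)^[k + 1] v x)]
      nlinarith [sq_nonneg (1 - |(torusDeriv i)^[k + 1] v x|)]
    have i1 : Integrable (fun x => ((torusDeriv i)^[k + 1] (fun x => f (v x)) x) ^ 2)
        (torusMeasure d) :=
      integrable_of_continuous ((hfv.iterate_torusDeriv i (k + 1)).continuous.pow 2)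
    have i2 : Integrable (fun x => ((torusDeriv i)^[k + 1] v x) ^ 2) (torusMeasure d) :=
      integrable_of_continuous ((hv.iterate_torusDeriv i (k + 1)).continuous.pow 2)
    refine (integral_mono i1 (((integrable_const 2).add (i2.const_mul 2)).const_mul _) hpt).trans ?_
    have e1 : ∫ x, A ^ 2 * (2 + 2 * ((torusDeriv i)^[k + 1] v x) ^ 2) ∂(torusMeasure d)
        = A ^ 2 * (2 + 2 * ∫ x, ((torusDeriv i)^[k + 1] v x) ^ 2 ∂(torusMeasure d)) := by
      rw [integral_const_mul, integral_add (integrable_const 2) (i2.const_mul 2),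
        integral_const_mul]
      simp
    refine e1.le.trans (mul_le_mul_of_nonneg_left ?_ (sq_nonneg _))
    linarith [integral_iterate_torusDeriv_partialSum_sq_le hg S i]

/-! ### Regularity of mild solutions -/

/-- The semigroup does not increase the H^γ norm of the initial value, and the forced part gains 7/4
derivatives by `duhamel_zero_smoothing`. The singularity (t-s)^(-3/4) is integrable, so the bound is
uniform in time. -/
theorem IsMild.exists_hsBound {d : ℕ} {T γ σ M M₀ : ℝ} {G : ℝ → L2 d} {θ : L2 d}
    {u : ℝ → L2 d} (h : IsMild T G θ u) (hG : Continuous G) (hθ : HsBound γ M₀ θ)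
    (hM : ∀ s ∈ Icc 0 T, HsBound σ M (G s)) :
    ∃ M', ∀ t ∈ Icc 0 T, HsBound (min γ (σ + 7 / 4)) M' (u t) := by
  refine ⟨2 * M₀ + 2 * ((1 + T) * Real.exp T * (M * (4 * (1 + T)))), fun t ht S => ?_⟩
  have hint : IntervalIntegrable (fun s : ℝ => (t - s) ^ (-(3 / 4) : ℝ)) volume 0 t := by
    have := (intervalIntegral.intervalIntegrable_rpow' (a := t) (b := 0)
      (r := -(3 / 4)) (by norm_num)).comp_sub_left t
    simpa using this
  have hgc : ∀ n, Continuous fun s => coeff n (G s) := continuous_coeff hG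
  have hi : ∀ n, IntervalIntegrable (fun s : ℝ => (t - s) ^ (-(3 / 4) : ℝ) *
      ((1 + laplaceEigenvalue n) ^ σ * coeff n (G s) ^ 2)) volume 0 t := fun n =>
    hint.mul_continuousOn (((hgc n).pow 2).const_mul _).continuousOn
  have h1 : ∀ n ∈ S, (1 + laplaceEigenvalue n) ^ (min γ (σ + 7 / 4)) * coeff n (u t) ^ 2
      ≤ 2 * ((1 + laplaceEigenvalue n) ^ γ * coeff n θ ^ 2)
        + 2 * ((1 + T) * Real.exp T * ∫ s in 0..t, (t - s) ^ (-(3 / 4) : ℝ) *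
          ((1 + laplaceEigenvalue n) ^ σ * coeff n (G s) ^ 2)) := by
    intro n _
    have hl := laplaceEigenvalue_nonneg n
    have hw := one_le_weight n
    rw [h t ht n, duhamel_eq_add_zero]
    set c := Real.exp (-laplaceEigenvalue n * t) * coeff n θ
    set z := duhamel (laplaceEigenvalue n) 0 (fun s => coeff n (G s)) t
    have hc : c ^ 2 ≤ coeff n θ ^ 2 := by
      rw [mul_pow]
      refine mul_le_of_le_one_left (sq_nonneg _) (pow_le_one₀ (Real.exp_pos _).le ?_)
      rw [Real.exp_le_one_iff]
      nlinarith [ht.1]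
    have e1 : (1 + laplaceEigenvalue n) ^ (min γ (σ + 7 / 4)) * c ^ 2
        ≤ (1 + laplaceEigenvalue n) ^ γ * coeff n θ ^ 2 :=
      mul_le_mul (Real.rpow_le_rpow_of_exponent_le hw (min_le_left _ _)) hc (sq_nonneg _)
        (weight_nonneg _ n)
    have e2 : (1 + laplaceEigenvalue n) ^ (min γ (σ + 7 / 4)) * z ^ 2
        ≤ (1 + T) * Real.exp T * ∫ s in 0..t, (t - s) ^ (-(3 / 4) : ℝ) *
          ((1 + laplaceEigenvalue n) ^ σ * coeff n (G s) ^ 2) := by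
      have e3 := mul_le_mul_of_nonneg_left (duhamel_zero_smoothing hl (hgc n) ht.1 ht.2)
        (weight_nonneg σ n)
      rw [← mul_assoc, ← Real.rpow_add (by linarith)] at e3
      refine (mul_le_mul_of_nonneg_right (Real.rpow_le_rpow_of_exponent_le hw (min_le_right _ _))
        (sq_nonneg _)).trans (e3.trans_eq ?_)
      rw [mul_left_comm, ← intervalIntegral.integral_const_mul]
      congr 2
      funext s
      ring
    have e4 : (1 + laplaceEigenvalue n) ^ (min γ (σ + 7 / 4)) * (c + z) ^ 2
        ≤ (1 + laplaceEigenvalue n) ^ (min γ (σ + 7 / 4)) * (2 * c ^ 2 + 2 * z ^ 2) :=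
      mul_le_mul_of_nonneg_left (by nlinarith [sq_nonneg (c - z)]) (weight_nonneg _ n)
    linarith
  refine (Finset.sum_le_sum h1).trans ?_
  rw [Finset.sum_add_distrib, ← Finset.mul_sum, ← Finset.mul_sum, ← Finset.mul_sum,
    ← intervalIntegral.integral_finsetSum fun n _ => hi n]
  have hT : 0 ≤ T := ht.1.trans ht.2
  have hM0 : 0 ≤ M := (hM 0 ⟨le_rfl, hT⟩).nonneg
  have h2 : ∫ s in 0..t, ∑ n ∈ S, (t - s) ^ (-(3 / 4) : ℝ) *
      ((1 + laplaceEigenvalue n) ^ σ * coeff n (G s) ^ 2)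
      ≤ ∫ s in 0..t, M * (t - s) ^ (-(3 / 4) : ℝ) := by
    apply intervalIntegral.integral_mono_on ht.1
    · simp only [← Finset.mul_sum]
      exact hint.mul_continuousOn
        (continuous_finsetSum S fun n _ => ((hgc n).pow 2).const_mul _).continuousOn
    · exact hint.const_mul _
    · intro s hs
      rw [← Finset.mul_sum, mul_comm M]
      exact mul_le_mul_of_nonneg_left (hM s ⟨hs.1, hs.2.trans ht.2⟩ S)
        (Real.rpow_nonneg (by linarith [hs.2]) _)
  rw [intervalIntegral.integral_const_mul] at h2
  have h3 := mul_le_mul_of_nonneg_left (integral_rpow_neg_three_quarters ht.1 ht.2) hM0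
  have h4 : 0 ≤ (1 + T) * Real.exp T := by positivity
  have h5 := mul_le_mul_of_nonneg_left (h2.trans h3) h4
  have h6 := hθ S
  linarith

/-- Solutions of the reaction-diffusion equation preserve Sobolev regularity. -/
theorem IsMild.exists_hsBound_of_superpose {d : ℕ} (hd : d ≤ 3) {f : ℝ → ℝ} (hf : ContDiff ℝ ∞ f)
    (hfc : HasCompactSupport f) {T γ M₀ : ℝ} {θ : L2 d} {u : ℝ → L2 d}
    (h : IsMild T (fun s => superpose f (u s)) θ u) (hu : Continuous u) (hθ : HsBound γ M₀ θ) :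
    ∃ M, ∀ t ∈ Icc 0 T, HsBound γ M (u t) := by
  obtain ⟨C, hC⟩ := hf.continuous.bounded_above_of_compact_support hfc
  obtain ⟨L, hL⟩ := exists_lipschitz_of_hasCompactSupport hf hfc
  have hG : Continuous fun s => superpose f (u s) :=
    (continuous_superpose hf.continuous hC hL).comp hu
  -- Bootstrap. A bounded source gives exponent 7/4 = 1 + 3/4. From (k+1) + 3/4 the source lies in
  -- H^(k+1), and k + 1 + 7/4 = (k+2) + 3/4.
  have key : ∀ k : ℕ, ∃ M, ∀ t ∈ Icc 0 T, HsBound (min γ ((k + 1 : ℕ) + 3 / 4)) M (u t) := by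
    intro k
    induction k with
    | zero =>
      obtain ⟨M, hM⟩ := h.exists_hsBound hG hθ (σ := 0)
        fun s _ => hsBound_superpose hf.continuous hC (u s)
      refine ⟨M, fun t ht => (hM t ht).mono (le_of_eq ?_) le_rfl⟩
      norm_num
    | succ k ih =>
      obtain ⟨M, hM⟩ := ih
      rcases le_total γ ((k + 1 : ℕ) + 3 / 4) with hγ | hγ
      · refine ⟨M, fun t ht => (hM t ht).mono ?_ le_rfl⟩
        rw [min_eq_left hγ]
        exact min_le_left _ _
      · rw [min_eq_right hγ] at hM
        obtain ⟨M', hM'⟩ := exists_hsBound_superpose hd hf hfc k M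
        obtain ⟨M'', hM''⟩ := h.exists_hsBound hG hθ fun s hs => hM' (u s) (hM s hs)
        refine ⟨M'', fun t ht => (hM'' t ht).mono (le_of_eq ?_) le_rfl⟩
        congr 1
        push_cast
        ring
  obtain ⟨k, hk⟩ := exists_nat_ge γ
  obtain ⟨M, hM⟩ := key k
  refine ⟨M, fun t ht => (hM t ht).mono (le_min le_rfl ?_) le_rfl⟩
  push_cast
  linarith

end

noncomputable section

/-! ### Rapidly converging Hartley series depending on time -/

/-- A family of coefficients, continuous in time, that decays faster than any power of the
frequency, uniformly in time. -/
structure IsRapid {d : ℕ} (A : ℝ → (Fin d → ℤ) → ℝ) : Prop where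
  continuous : ∀ n, Continuous fun t => A t n
  bound : ∀ k : ℕ, ∃ C, ∀ t n, |A t n| * (1 + laplaceEigenvalue n) ^ k ≤ C

/-- The function with Hartley coefficients `A t`. -/
def hartleySeries {d : ℕ} (A : ℝ → (Fin d → ℤ) → ℝ) (t : ℝ) (x : Torus d) : ℝ :=
  ∑' n, A t n * hartley n x

section hartleySeries

variable {d : ℕ} {A : ℝ → (Fin d → ℤ) → ℝ}

theorem summable_weight_inv_sq (hd : d ≤ 3) :
    Summable fun n : Fin d → ℤ => ((1 + laplaceEigenvalue n) ^ 2)⁻¹ := by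
  refine (summable_weight hd (s := -2) (by norm_num)).congr fun n => ?_
  rw [Real.rpow_neg (by linarith [one_le_weight n]), Real.rpow_two]

/-- Two spare powers of the weight are spent on summability, which holds for d ≤ 3. -/
theorem IsRapid.exists_summable_bound (hA : IsRapid A) (hd : d ≤ 3) (k : ℕ) :
    ∃ c : (Fin d → ℤ) → ℝ, Summable c ∧
      ∀ t n, |A t n| * (1 + laplaceEigenvalue n) ^ k ≤ c n := by
  obtain ⟨C, hC⟩ := hA.bound (k + 2)
  refine ⟨fun n => C * ((1 + laplaceEigenvalue n) ^ 2)⁻¹, (summable_weight_inv_sq hd).mul_left C,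
    fun t n => ?_⟩
  have hw := one_le_weight n
  change _ ≤ C * ((1 + laplaceEigenvalue n) ^ 2)⁻¹
  rw [← div_eq_mul_inv, le_div_iff₀ (by positivity), mul_assoc, ← pow_add]
  exact hC t n

theorem IsRapid.exists_summable_abs (hA : IsRapid A) (hd : d ≤ 3) :
    ∃ c : (Fin d → ℤ) → ℝ, Summable c ∧ ∀ t n, |A t n| ≤ c n := by
  simpa using hA.exists_summable_bound hd 0

theorem abs_mul_hartley_le (a : ℝ) (n : Fin d → ℤ) (x : Torus d) :
    |a * hartley n x| ≤ 2 * |a| := by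
  rw [abs_mul, mul_comm]
  exact mul_le_mul_of_nonneg_right (abs_hartley_le n x) (abs_nonneg a)

theorem IsRapid.continuous_hartleySeries (hA : IsRapid A) (hd : d ≤ 3) :
    Continuous (Function.uncurry (hartleySeries A)) := by
  obtain ⟨c, hc, hb⟩ := hA.exists_summable_abs hd
  refine continuous_tsum (u := fun n => 2 * c n) (fun n => ?_) (hc.mul_left 2) fun n p => ?_
  · exact ((hA.continuous n).comp continuous_fst).mul ((hartley n).continuous.comp continuous_snd)
  · exact (abs_mul_hartley_le _ _ _).trans (by linarith [hb p.1 n])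

theorem abs_two_pi_mul_le (n : Fin d → ℤ) (i : Fin d) :
    |2 * Real.pi * n i| ≤ 1 + laplaceEigenvalue n := by
  have := sq_le_laplaceEigenvalue n i
  rw [← sq_abs] at this
  nlinarith [sq_nonneg (|2 * Real.pi * n i| - 1), abs_nonneg (2 * Real.pi * n i)]

theorem norm_phase_le (n : Fin d → ℤ) : ‖phase n‖ ≤ d * (1 + laplaceEigenvalue n) := by
  have hw := one_le_weight n
  refine ContinuousLinearMap.opNorm_le_bound _ (by positivity) fun y => ?_
  rw [phase_apply]
  calc ‖∑ j, 2 * Real.pi * n j * y j‖ ≤ ∑ _j : Fin d, (1 + laplaceEigenvalue n) * ‖y‖ := by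
        refine norm_sum_le_of_le _ fun j _ => ?_
        rw [norm_mul]
        exact mul_le_mul (abs_two_pi_mul_le n j) (norm_le_pi_norm y j) (norm_nonneg _)
          (by linarith)
    _ = _ := by simp [mul_assoc]

theorem abs_iteratedDeriv_cos_add_sin_le (k : ℕ) (r : ℝ) :
    ‖iteratedDeriv k (fun r => Real.cos r + Real.sin r) r‖ ≤ 2 := by
  have h : iteratedDeriv k (fun r => Real.cos r + Real.sin r) r
      = iteratedDeriv k Real.cos r + iteratedDeriv k Real.sin r :=
    iteratedDeriv_fun_add Real.contDiff_cos.contDiffAt Real.contDiff_sin.contDiffAt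
  rw [h]
  refine (norm_add_le _ _).trans ?_
  have h1 := Real.abs_iteratedDeriv_cos_le_one k r
  have h2 := Real.abs_iteratedDeriv_sin_le_one k r
  rw [Real.norm_eq_abs, Real.norm_eq_abs]
  linarith

theorem norm_iteratedFDeriv_hartley_le (k : ℕ) (n : Fin d → ℤ) (y : Fin d → ℝ) :
    ‖iteratedFDeriv ℝ k (periodicLift (hartley n)) y‖ ≤ 2 * (d * (1 + laplaceEigenvalue n)) ^ k := by
  rw [periodicLift_hartley, (phase n).iteratedFDeriv_comp_right contDiff_cos_add_sin y
    (by exact_mod_cast le_top)]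
  refine (ContinuousMultilinearMap.norm_compContinuousLinearMap_le _ _).trans ?_
  rw [norm_iteratedFDeriv_eq_norm_iteratedDeriv, Finset.prod_const, Finset.card_univ,
    Fintype.card_fin]
  exact mul_le_mul (abs_iteratedDeriv_cos_add_sin_le _ _)
    (pow_le_pow_left₀ (norm_nonneg _) (norm_phase_le n) k) (by positivity) (by norm_num)

theorem IsRapid.isSmooth_hartleySeries (hA : IsRapid A) (hd : d ≤ 3) (t : ℝ) :
    IsSmooth (hartleySeries A t) := by
  choose c hc hb using hA.exists_summable_bound hd
  have e : periodicLift (hartleySeries A t)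
      = fun y => ∑' n, A t n • periodicLift (hartley n) y := rfl
  rw [IsSmooth, e]
  refine contDiff_tsum (v := fun k n => 2 * d ^ k * c k n) (fun n => ?_)
    (fun k _ => (hc k).mul_left _) fun k n y _ => ?_
  · exact contDiff_const.mul (isSmooth_hartley n)
  · have h1 : iteratedFDeriv ℝ k (fun y => A t n • periodicLift (hartley n) y) y
        = A t n • iteratedFDeriv ℝ k (periodicLift (hartley n)) y :=
      iteratedFDeriv_const_smul_apply' (a := A t n)
        ((ContDiff.of_le (isSmooth_hartley n) (by exact_mod_cast le_top)).contDiffAt)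
    rw [h1, norm_smul, Real.norm_eq_abs]
    have h2 := mul_le_mul_of_nonneg_left (norm_iteratedFDeriv_hartley_le k n y)
      (abs_nonneg (A t n))
    have h3 : (0 : ℝ) ≤ 2 * d ^ k := by positivity
    have h4 := mul_le_mul_of_nonneg_left (hb k t n) h3
    rw [mul_pow] at h2
    linarith

theorem IsRapid.partial (hA : IsRapid A) (i : Fin d) :
    IsRapid fun t n => -(2 * Real.pi * n i * A t (-n)) := by
  refine ⟨fun n => ((hA.continuous (-n)).const_mul _).neg, fun k => ?_⟩
  obtain ⟨C, hC⟩ := hA.bound (k + 1)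
  refine ⟨C, fun t n => le_trans ?_ (hC t (-n))⟩
  have h1 := abs_two_pi_mul_le n i
  have hw := one_le_weight n
  rw [abs_neg, abs_mul, laplaceEigenvalue_neg, pow_succ, mul_comm |2 * Real.pi * (n i : ℝ)|,
    mul_assoc, mul_comm ((1 + laplaceEigenvalue n) ^ k)]
  gcongr

theorem IsRapid.torusDeriv_hartleySeries (hA : IsRapid A) (hd : d ≤ 3) (i : Fin d) (t : ℝ) :
    torusDeriv i (hartleySeries A t)
      = hartleySeries (fun t n => -(2 * Real.pi * n i * A t (-n))) t := by
  funext x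
  obtain ⟨c, hc, hb⟩ := hA.exists_summable_bound hd 1
  have hterm : ∀ (n : Fin d → ℤ) (s : ℝ),
      HasDerivAt (fun s : ℝ => A t n * hartley n (x + Pi.single i (s : UnitAddCircle)))
        (A t n * (2 * Real.pi * n i * hartley (-n) (x + Pi.single i (s : UnitAddCircle)))) s := by
    intro n s
    have := (hasDerivAt_translate (isSmooth_hartley n) i x s).const_mul (A t n)
    rwa [torusDeriv_hartley] at this
  have hbound : ∀ (n : Fin d → ℤ) (s : ℝ),
      ‖A t n * (2 * Real.pi * n i * hartley (-n) (x + Pi.single i (s : UnitAddCircle)))‖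
        ≤ 2 * c n := by
    intro n s
    rw [← mul_assoc, Real.norm_eq_abs]
    refine (abs_mul_hartley_le _ _ _).trans ?_
    have h1 := mul_le_mul_of_nonneg_left (abs_two_pi_mul_le n i) (abs_nonneg (A t n))
    have h2 := hb t n
    rw [pow_one] at h2
    rw [abs_mul]
    linarith
  have hsum : Summable fun n : Fin d → ℤ =>
      A t n * hartley n (x + Pi.single i ((0 : ℝ) : UnitAddCircle)) := by
    obtain ⟨c', hc', hb'⟩ := hA.exists_summable_abs hd
    exact Summable.of_norm_bounded (hc'.mul_left 2) fun n =>
      (abs_mul_hartley_le _ _ _).trans (by linarith [hb' t n])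
  have h := hasDerivAt_tsum (hc.mul_left 2) hterm hbound hsum 0
  refine h.deriv.trans ?_
  rw [hartleySeries, ← (Equiv.neg (Fin d → ℤ)).tsum_eq]
  refine tsum_congr fun n => ?_
  rw [add_single_coe_zero]
  simp only [Equiv.neg_apply, neg_neg, Pi.neg_apply]
  push_cast
  ring

/-- The series converges both in L² and uniformly; the L² class of the uniform limit must be h. -/
theorem IsRapid.hasSum_hartleySeries (hA : IsRapid A) (hd : d ≤ 3) (t : ℝ) (h : L2 d)
    (hh : ∀ n, coeff n h = A t n) : h =ᵐ[torusMeasure d] hartleySeries A t := by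
  obtain ⟨c, hc, hb⟩ := hA.exists_summable_abs hd
  have hs : Summable fun n => A t n • hartley n := by
    refine Summable.of_norm_bounded (hc.mul_left 2) fun n => ?_
    have h0 : 0 ≤ 2 * |A t n| := by positivity
    refine ((ContinuousMap.norm_le _ h0).2 fun x => abs_mul_hartley_le (A t n) n x).trans ?_
    linarith [hb t n]
  have h1 := (contL2 (d := d)).hasSum hs.hasSum
  have h2 := hasSum_coeff_smul h
  simp only [hh] at h2
  simp only [map_smul] at h1
  have e := h2.unique h1
  filter_upwards [coeFn_contL2 (∑' n, A t n • hartley n)] with x hx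
  rw [e, hx]
  exact ((ContinuousMap.evalCLM ℝ x).hasSum hs.hasSum).tsum_eq.symm

/-- The series is differentiated with each coefficient replaced by its integral representation,
which is differentiable on ℝ but agrees with `A` only on [0,T]; hence the one-sided notion at the
endpoints. -/
theorem IsRapid.hasDerivWithinAt_hartleySeries {A' : ℝ → (Fin d → ℤ) → ℝ} (hd : d ≤ 3)
    (hA : IsRapid A) (hA' : IsRapid A') {T : ℝ}
    (h : ∀ n, ∀ t ∈ Icc 0 T, A t n = A 0 n + ∫ s in 0..t, A' s n) (x : Torus d) {t : ℝ}
    (ht : t ∈ Icc 0 T) :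
    HasDerivWithinAt (fun t => hartleySeries A t x) (hartleySeries A' t x) (Icc 0 T) t := by
  obtain ⟨c, hc, hb⟩ := hA.exists_summable_abs hd
  obtain ⟨c', hc', hb'⟩ := hA'.exists_summable_abs hd
  have hterm : ∀ (n : Fin d → ℤ) (s : ℝ),
      HasDerivAt (fun t => (A 0 n + ∫ s in 0..t, A' s n) * hartley n x)
        (A' s n * hartley n x) s := fun n s =>
    ((((hA'.continuous n).integral_hasStrictDerivAt 0 s).hasDerivAt.const_add _).mul_const _)
  have h0 : Summable fun n : Fin d → ℤ => (A 0 n + ∫ s in (0 : ℝ)..0, A' s n) * hartley n x :=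
    Summable.of_norm_bounded (hc.mul_left 2) fun n =>
      (abs_mul_hartley_le _ _ _).trans (by simpa using hb 0 n)
  have hd := hasDerivAt_tsum (hc'.mul_left 2) hterm
    (fun n s => (abs_mul_hartley_le _ _ _).trans (by linarith [hb' s n])) h0 t
  have e : ∀ s ∈ Icc 0 T, hartleySeries A s x
      = ∑' n, (A 0 n + ∫ r in 0..s, A' r n) * hartley n x := fun s hs =>
    tsum_congr fun n => by rw [h n s hs]
  exact hd.hasDerivWithinAt.congr e (e t ht)

end hartleySeries

/-! ### Functions smooth in space and continuously differentiable in time -/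

/-- `H` is smooth in space, and `H` and its time derivative on `[0,T]` are jointly continuous. -/
def IsSpaceTimeC1 {d : ℕ} (T : ℝ) (H : ℝ → Torus d → ℝ) : Prop :=
  (∀ t, IsSmooth (H t)) ∧ Continuous (Function.uncurry H) ∧
    ∃ D : ℝ → Torus d → ℝ, Continuous (Function.uncurry D) ∧
      ∀ x, ∀ t ∈ Icc 0 T, HasDerivWithinAt (fun s => H s x) (D t x) (Icc 0 T) t

/-- The spatial derivatives of `H` of order at most `m` satisfy `IsSpaceTimeC1`. -/
def IsSpaceTimeSmooth {d : ℕ} (T : ℝ) : ℕ → (ℝ → Torus d → ℝ) → Prop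
  | 0, H => IsSpaceTimeC1 T H
  | m + 1, H => IsSpaceTimeC1 T H ∧
      ∀ i, IsSpaceTimeSmooth T m fun t => torusDeriv i (H t)

section SpaceTime

variable {d : ℕ} {T : ℝ}

theorem IsSpaceTimeC1.add {H K : ℝ → Torus d → ℝ} (h : IsSpaceTimeC1 T H)
    (h' : IsSpaceTimeC1 T K) : IsSpaceTimeC1 T fun t x => H t x + K t x := by
  obtain ⟨hs, hc, D, hD, hd⟩ := h
  obtain ⟨hs', hc', D', hD', hd'⟩ := h'
  exact ⟨fun t => (hs t).add (hs' t), hc.add hc', fun t x => D t x + D' t x, hD.add hD',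
    fun x t ht => (hd x t ht).add (hd' x t ht)⟩

theorem IsSpaceTimeC1.mul {H K : ℝ → Torus d → ℝ} (h : IsSpaceTimeC1 T H)
    (h' : IsSpaceTimeC1 T K) : IsSpaceTimeC1 T fun t x => H t x * K t x := by
  obtain ⟨hs, hc, D, hD, hd⟩ := h
  obtain ⟨hs', hc', D', hD', hd'⟩ := h'
  exact ⟨fun t => (hs t).mul (hs' t), hc.mul hc', fun t x => D t x * K t x + H t x * D' t x,
    (hD.mul hc').add (hc.mul hD'), fun x t ht => (hd x t ht).mul (hd' x t ht)⟩

theorem IsSpaceTimeC1.comp {H : ℝ → Torus d → ℝ} (h : IsSpaceTimeC1 T H) {g : ℝ → ℝ}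
    (hg : ContDiff ℝ ∞ g) : IsSpaceTimeC1 T fun t x => g (H t x) := by
  obtain ⟨hs, hc, D, hD, hd⟩ := h
  refine ⟨fun t => (hs t).comp hg, hg.continuous.comp hc, fun t x => deriv g (H t x) * D t x,
    ((hg.continuous_deriv (by simp)).comp hc).mul hD, fun x t ht => ?_⟩
  exact ((hg.differentiable (by simp) _).hasDerivAt).comp_hasDerivWithinAt t (hd x t ht)

theorem IsSpaceTimeSmooth.of_succ {m : ℕ} : ∀ {H : ℝ → Torus d → ℝ},
    IsSpaceTimeSmooth T (m + 1) H → IsSpaceTimeSmooth T m H := by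
  induction m with
  | zero => exact fun h => h.1
  | succ m ih => exact fun h => ⟨h.1, fun i => ih (h.2 i)⟩

theorem torusDeriv_add {φ ψ : Torus d → ℝ} (h : IsSmooth φ) (h' : IsSmooth ψ) (i : Fin d) :
    torusDeriv i (fun x => φ x + ψ x) = fun x => torusDeriv i φ x + torusDeriv i ψ x := by
  funext x
  exact ((hasDerivAt_torusDeriv h i x).add (hasDerivAt_torusDeriv h' i x)).deriv

theorem IsSpaceTimeSmooth.add {m : ℕ} : ∀ {H K : ℝ → Torus d → ℝ}, IsSpaceTimeSmooth T m H →
    IsSpaceTimeSmooth T m K → IsSpaceTimeSmooth T m fun t x => H t x + K t x := by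
  induction m with
  | zero => exact fun h h' => IsSpaceTimeC1.add h h'
  | succ m ih =>
    refine fun {H K} h h' => ⟨h.1.add h'.1, fun i => ?_⟩
    simp only [torusDeriv_add (h.1.1 _) (h'.1.1 _)]
    exact ih (h.2 i) (h'.2 i)

theorem IsSpaceTimeSmooth.mul {m : ℕ} : ∀ {H K : ℝ → Torus d → ℝ}, IsSpaceTimeSmooth T m H →
    IsSpaceTimeSmooth T m K → IsSpaceTimeSmooth T m fun t x => H t x * K t x := by
  induction m with
  | zero => exact fun h h' => IsSpaceTimeC1.mul h h'
  | succ m ih =>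
    refine fun {H K} h h' => ⟨h.1.mul h'.1, fun i => ?_⟩
    simp only [torusDeriv_mul (h.1.1 _) (h'.1.1 _)]
    exact (ih (h.2 i) h'.of_succ).add (ih h.of_succ (h'.2 i))

theorem IsSpaceTimeSmooth.comp {m : ℕ} : ∀ {H : ℝ → Torus d → ℝ}, IsSpaceTimeSmooth T m H →
    ∀ {g : ℝ → ℝ}, ContDiff ℝ ∞ g → IsSpaceTimeSmooth T m fun t x => g (H t x) := by
  induction m with
  | zero => exact fun h _ hg => IsSpaceTimeC1.comp h hg
  | succ m ih =>
    refine fun {H} h g hg => ⟨h.1.comp hg, fun i => ?_⟩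
    simp only [torusDeriv_comp hg (h.1.1 _)]
    exact (ih h.of_succ (contDiff_infty_iff_deriv.1 hg).2).mul (h.2 i)

theorem isSpaceTimeC1_iterTorusDeriv (α : List (Fin d)) : ∀ {H : ℝ → Torus d → ℝ},
    (∀ m, IsSpaceTimeSmooth T m H) → IsSpaceTimeC1 T fun t => iterTorusDeriv α (H t) := by
  -- In `iterTorusDeriv` the last index acts first. Removing it leaves the family of smooth
  -- functions intact and lowers the order by one.
  induction α using List.reverseRecOn with
  | nil => exact fun h => h 0
  | append_singleton α i ih =>
    intro H h
    have e : ∀ t, iterTorusDeriv (α ++ [i]) (H t) = iterTorusDeriv α (torusDeriv i (H t)) :=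
      fun t => by simp [iterTorusDeriv]
    simp only [e]
    exact ih fun m => (h (m + 1)).2 i

/-- Joint continuity makes the time derivative a continuous curve in C(Ω); the integral identity in
C(Ω) is checked pointwise by the fundamental theorem of calculus. -/
theorem IsSpaceTimeC1.memC1 {H : ℝ → Torus d → ℝ} (h : IsSpaceTimeC1 T H) :
    MemC1 T fun t => (⟨H t, (h.1 t).continuous⟩ : C(Torus d, ℝ)) := by
  obtain ⟨hs, hc, D, hD, hd⟩ := h
  let D' : C(ℝ, C(Torus d, ℝ)) := ContinuousMap.curry ⟨Function.uncurry D, hD⟩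
  obtain ⟨C, hC⟩ := isCompact_Icc.exists_bound_of_continuousOn D'.continuous.continuousOn
    (s := Icc 0 T)
  refine ⟨D', MemLp.of_bound D'.continuous.aestronglyMeasurable C
    ((ae_restrict_iff' measurableSet_Icc).2 (Filter.Eventually.of_forall hC)), fun t ht => ?_⟩
  ext x
  let ev : C(Torus d, ℝ) →L[ℝ] ℝ := ContinuousMap.evalCLM ℝ x
  have hDi : IntervalIntegrable (fun s => D' s) volume 0 t :=
    Continuous.intervalIntegrable D'.continuous _ _
  have h1 : ∫ s in 0..t, ev (D' s) = ev (∫ s in 0..t, D' s) :=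
    ev.intervalIntegral_comp_comm hDi
  have h2 : ∫ s in 0..t, D s x = H t x - H 0 x := by
    refine intervalIntegral.integral_eq_sub_of_hasDerivAt_of_le
      (f := fun s => H s x) ht.1 ?_ (fun s hs => ?_) ?_
    · exact (hc.comp (continuous_id.prodMk continuous_const)).continuousOn
    · exact (hd x s ⟨hs.1.le, hs.2.le.trans ht.2⟩).hasDerivAt
        (Icc_mem_nhds hs.1 (hs.2.trans_le ht.2))
    · exact (hD.comp (continuous_id.prodMk continuous_const)).intervalIntegrable _ _
  have h3 : ∫ s in 0..t, ev (D' s) = ∫ s in 0..t, D s x := rfl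
  have h4 : (∫ s in 0..t, D' s) x = H t x - H 0 x := by
    rw [← h2, ← h3, h1]
    rfl
  change H t x = H 0 x + (∫ s in 0..t, D' s) x
  rw [h4]
  ring

theorem isC1Infty_of_isSpaceTimeSmooth {V W : ℝ → Torus d → ℝ}
    (hV : ∀ t ∈ Icc 0 T, V t =ᵐ[torusMeasure d] W t) (hW : ∀ m, IsSpaceTimeSmooth T m W) :
    IsC1Infty T V :=
  ⟨W, hV, fun t _ => (hW 0).1 t, fun α => ⟨_, fun _ _ _ => rfl,
    (isSpaceTimeC1_iterTorusDeriv α hW).memC1⟩⟩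

/-- A space derivative acts on coefficients by a frequency flip and a factor linear in n. This
preserves rapid decay and the integral relation, which makes the induction on the order possible. -/
theorem isSpaceTimeSmooth_hartleySeries (hd : d ≤ 3) (m : ℕ) : ∀ {A A' : ℝ → (Fin d → ℤ) → ℝ},
    IsRapid A → IsRapid A' → (∀ n, ∀ t ∈ Icc 0 T, A t n = A 0 n + ∫ s in 0..t, A' s n) →
    IsSpaceTimeSmooth T m (hartleySeries A) := by
  have h0 : ∀ {A A' : ℝ → (Fin d → ℤ) → ℝ}, IsRapid A → IsRapid A' →
      (∀ n, ∀ t ∈ Icc 0 T, A t n = A 0 n + ∫ s in 0..t, A' s n) →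
      IsSpaceTimeC1 T (hartleySeries A) := fun hA hA' h =>
    ⟨hA.isSmooth_hartleySeries hd, hA.continuous_hartleySeries hd, _,
      hA'.continuous_hartleySeries hd, fun x _ ht =>
        hA.hasDerivWithinAt_hartleySeries hd hA' h x ht⟩
  induction m with
  | zero => exact h0
  | succ m ih =>
    refine fun {A A'} hA hA' h => ⟨h0 hA hA' h, fun i => ?_⟩
    simp only [hA.torusDeriv_hartleySeries hd]
    refine ih (hA.partial i) (hA'.partial i) fun n t ht => ?_
    rw [h (-n) t ht, intervalIntegral.integral_neg, intervalIntegral.integral_const_mul]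
    ring

end SpaceTime

/-! ### Smoothness of solutions with smooth initial value -/

theorem exists_hsBound_of_isSmooth {d : ℕ} {φ : Torus d → ℝ} (h : IsSmooth φ) (s : ℝ) :
    ∃ M, HsBound s M h.toL2 := by
  obtain ⟨k, hk⟩ := exists_nat_ge s
  have hB : ∀ i, ∫ x, ((torusDeriv i)^[k + 1] φ x) ^ 2 ∂(torusMeasure d)
      ≤ ∑ i, ∫ x, ((torusDeriv i)^[k + 1] φ x) ^ 2 ∂(torusMeasure d) := fun i =>
    Finset.single_le_sum (f := fun i => ∫ x, ((torusDeriv i)^[k + 1] φ x) ^ 2 ∂(torusMeasure d))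
      (fun _ _ => integral_nonneg fun _ => sq_nonneg _) (Finset.mem_univ i)
  refine ⟨_, (hsBound_of_integral_iterate_le h k le_rfl hB).mono ?_ le_rfl⟩
  push_cast
  linarith

/-- A single term of the H^(2k) sum already gives decay of order k. Clamping time to [0,T] makes the
bound hold for all real times. -/
theorem isRapid_of_hsBound {d : ℕ} {T : ℝ} (hT : 0 ≤ T) {v : ℝ → L2 d} (hv : Continuous v)
    (h : ∀ k : ℕ, ∃ M, ∀ t ∈ Icc 0 T, HsBound k M (v t)) :
    IsRapid fun t n => coeff n (v (projIcc 0 T hT t)) := by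
  refine ⟨fun n => continuous_coeff
    (hv.comp (continuous_subtype_val.comp continuous_projIcc)) n, fun k => ?_⟩
  obtain ⟨M, hM⟩ := h (2 * k)
  refine ⟨√M, fun t n => ?_⟩
  have h1 := hM _ (projIcc 0 T hT t).2 {n}
  rw [Finset.sum_singleton, Real.rpow_natCast, mul_comm, mul_comm 2 k, pow_mul, ← mul_pow] at h1
  have h2 := Real.abs_le_sqrt h1
  rwa [abs_mul, abs_of_nonneg (pow_nonneg (zero_le_one.trans (one_le_weight n)) k)] at h2

/-- These are the coefficients of u' = Δu + f(u); time regularity is read off from the equation. -/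
theorem IsRapid.heat {d : ℕ} {A B : ℝ → (Fin d → ℤ) → ℝ} (hA : IsRapid A) (hB : IsRapid B) :
    IsRapid fun t n => -laplaceEigenvalue n * A t n + B t n := by
  refine ⟨fun n => ((hA.continuous n).const_mul _).add (hB.continuous n), fun k => ?_⟩
  obtain ⟨C, hC⟩ := hA.bound (k + 1)
  obtain ⟨C', hC'⟩ := hB.bound k
  refine ⟨C + C', fun t n => le_trans ?_ (add_le_add (hC t n) (hC' t n))⟩
  have hl := laplaceEigenvalue_nonneg n
  have h1 : |-laplaceEigenvalue n * A t n + B t n|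
      ≤ |A t n| * (1 + laplaceEigenvalue n) + |B t n| := by
    refine (abs_add_le _ _).trans (add_le_add ?_ le_rfl)
    rw [abs_mul, abs_neg, abs_of_nonneg hl]
    nlinarith [abs_nonneg (A t n)]
  refine (mul_le_mul_of_nonneg_right h1 (by positivity)).trans_eq ?_
  ring

/-- For smooth initial values, the solution of the reaction-diffusion equation is given by a
jointly smooth function. -/
theorem IsMild.exists_isSpaceTimeSmooth {d : ℕ} (hd : d ≤ 3) {f : ℝ → ℝ} (hf : ContDiff ℝ ∞ f)
    (hfc : HasCompactSupport f) {T : ℝ} (hT : 0 ≤ T) {θ : L2 d} {u : ℝ → L2 d}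
    (h : IsMild T (fun s => superpose f (u s)) θ u) (hu : Continuous u)
    (hθ : ∀ s, ∃ M, HsBound s M θ) :
    ∃ W : ℝ → Torus d → ℝ, (∀ m, IsSpaceTimeSmooth T m W) ∧
      ∀ t ∈ Icc 0 T, u t =ᵐ[torusMeasure d] W t := by
  obtain ⟨C, hC⟩ := hf.continuous.bounded_above_of_compact_support hfc
  obtain ⟨L, hL⟩ := exists_lipschitz_of_hasCompactSupport hf hfc
  have hG : Continuous fun s => superpose f (u s) :=
    (continuous_superpose hf.continuous hC hL).comp hu
  have hub : ∀ s, ∃ M, ∀ t ∈ Icc 0 T, HsBound s M (u t) := fun s => by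
    obtain ⟨M₀, hM₀⟩ := hθ s
    exact h.exists_hsBound_of_superpose hd hf hfc hu hM₀
  have hGb : ∀ k : ℕ, ∃ M, ∀ t ∈ Icc 0 T, HsBound k M (superpose f (u t)) := fun k => by
    obtain ⟨M, hM⟩ := hub ((k + 1 : ℕ) + 3 / 4)
    obtain ⟨M', hM'⟩ := exists_hsBound_superpose hd hf hfc k M
    exact ⟨M', fun t ht => (hM' _ (hM t ht)).mono (by push_cast; linarith) le_rfl⟩
  have hA := isRapid_of_hsBound hT hu fun k => hub k
  have hB := isRapid_of_hsBound hT hG hGb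
  refine ⟨_, fun m => isSpaceTimeSmooth_hartleySeries hd m hA (hA.heat hB) fun n t ht => ?_,
    fun t ht => hA.hasSum_hartleySeries hd t (u t) fun n => by rw [projIcc_of_mem hT ht]⟩
  have hg := continuous_coeff hG n
  have h1 : ∫ s in 0..t, (-laplaceEigenvalue n * coeff n (u (projIcc 0 T hT s))
      + coeff n (superpose f (u (projIcc 0 T hT s))))
      = ∫ s in 0..t, (-laplaceEigenvalue n * duhamel (laplaceEigenvalue n) (coeff n θ)
        (fun s => coeff n (superpose f (u s))) s + coeff n (superpose f (u s))) := by
    apply intervalIntegral.integral_congr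
    intro s hs
    rw [uIcc_of_le ht.1] at hs
    have hs' : s ∈ Icc 0 T := ⟨hs.1, hs.2.trans ht.2⟩
    simp only [projIcc_of_mem hT hs', h s hs' n]
  rw [h1, intervalIntegral.integral_eq_sub_of_hasDerivAt
    (fun s _ => hasDerivAt_duhamel _ _ hg s)
    ((((continuous_duhamel _ _ hg).const_mul _).add hg).intervalIntegrable _ _), duhamel_initial,
    projIcc_of_mem hT ht, projIcc_left, h t ht n]
  simp only [h.initial hT]
  ring

end

noncomputable section

/-! ### Multiplication by continuous functions -/

/-- Multiplication of an element of `L²(Ω)` by a continuous function. -/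
def mulL2 {d : ℕ} : C(Torus d, ℝ) →L[ℝ] L2 d →L[ℝ] L2 d :=
  ((ContinuousLinearMap.mul ℝ ℝ).holderL (torusMeasure d) ⊤ 2 2).comp
    (ContinuousMap.toLp ⊤ (torusMeasure d) ℝ)

theorem coeFn_mulL2 {d : ℕ} (φ : C(Torus d, ℝ)) (g : L2 d) :
    mulL2 φ g =ᵐ[torusMeasure d] fun x => φ x * g x := by
  have h1 := (ContinuousLinearMap.mul ℝ ℝ).coeFn_holder (r := 2)
    (ContinuousMap.toLp (E := ℝ) ⊤ (torusMeasure d) ℝ φ) g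
  filter_upwards [h1, ContinuousMap.coeFn_toLp (p := ⊤) (𝕜 := ℝ) (torusMeasure d) φ] with x h2 h3
  have h4 : mulL2 φ g x = _ := h2
  rw [h4, h3]
  rfl

theorem norm_mulL2_le {d : ℕ} {φ : C(Torus d, ℝ)} {K : ℝ} (hK : ∀ x, |φ x| ≤ K) (g : L2 d) :
    ‖mulL2 φ g‖ ≤ K * ‖g‖ := by
  apply Lp.norm_le_mul_norm_of_ae_le_mul
  filter_upwards [coeFn_mulL2 φ g] with x hx
  rw [hx, norm_mul]
  exact mul_le_mul_of_nonneg_right (hK x) (norm_nonneg _)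

/-! ### Well-posedness -/

/-- Existence, uniqueness and strong regularity for `u' - Δu = N(t, u)` with Lipschitz `N`. -/
theorem exists_strong_solution {d : ℕ} {T L M : ℝ} (hT : 0 ≤ T) {N : ℝ → L2 d → L2 d}
    (hN : Continuous (Function.uncurry N)) (hL : ∀ t g h, ‖N t g - N t h‖ ≤ L * ‖g - h‖)
    {F : ℝ → L2 d → Torus d → ℝ} (hF : ∀ t ∈ Icc 0 T, ∀ g, F t g =ᵐ[torusMeasure d] N t g)
    {θ : L2 d} (hθ : HsBound 1 M θ) :
    ∃ u : ℝ → L2 d, Continuous u ∧ IsMild T (fun s => N s (u s)) θ u ∧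
      IsStrongSolution T (fun t => F t (u t)) θ u ∧
      ∀ w : ℝ → L2 d, IsWeakSolution T (fun t => F t (w t)) θ w → EqOn w u (Icc 0 T) := by
  obtain ⟨u, hu, hmild⟩ := exists_isMild hT hN hL θ
  have hG : ∀ {v : ℝ → L2 d}, Continuous v → Continuous fun s => N s (v s) := fun hv =>
    hN.comp (continuous_id.prodMk hv)
  refine ⟨u, hu, hmild, hmild.isStrongSolution (hG hu) hu hT hθ fun s hs => hF s hs _,
    fun w hw => ?_⟩
  -- A competing weak solution is continuous on [0,T] only; it is replaced by its constant extension
  -- beyond the endpoints.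
  have hw' : EqOn w (fun t => w (projIcc 0 T hT t)) (Icc 0 T) := fun t ht => by
    simp only [projIcc_of_mem hT ht]
  have hwc := continuous_comp_projIcc hT hw.continuousOn
  have hwm := hw.isMild hw' hwc (hG hwc) fun s hs => by
    rw [hw' hs]
    exact hF s hs _
  exact fun t ht => (hw' ht).trans
    (hwm.eqOn hmild (hG hwc) (hG hu) hwc hu (fun s _ => hL s _ _) ht)

/-! ### Linearization -/

/-- The mean value inequality for x ↦ f x - f'(b) x, whose derivative is at most K |a - b| between a
and b. -/
theorem abs_taylor_remainder_le {f : ℝ → ℝ} (hf : Differentiable ℝ f) {K : ℝ}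
    (hK : ∀ x y, |deriv f x - deriv f y| ≤ K * |x - y|) (a b : ℝ) :
    |f a - f b - deriv f b * (a - b)| ≤ K * |a - b| ^ 2 := by
  have hK0 : 0 ≤ K := by
    have := (abs_nonneg _).trans (hK 1 0)
    simpa using this
  have hd : ∀ x, HasDerivAt (fun x => f x - deriv f b * x) (deriv f x - deriv f b) x := by
    intro x
    simpa using (hf x).hasDerivAt.fun_sub ((hasDerivAt_id x).const_mul (deriv f b))
  have h := (convex_uIcc b a).norm_image_sub_le_of_norm_hasDerivWithin_le
    (C := K * |a - b|) (fun x _ => (hd x).hasDerivWithinAt) (fun x hx => ?_)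
    left_mem_uIcc right_mem_uIcc
  · rw [Real.norm_eq_abs, Real.norm_eq_abs] at h
    have e : f a - deriv f b * a - (f b - deriv f b * b) = f a - f b - deriv f b * (a - b) := by
      ring
    rw [e] at h
    linarith
  · exact (hK x b).trans (mul_le_mul_of_nonneg_left (abs_sub_left_of_mem_uIcc hx) hK0)

/-- A quadratic remainder of an L² function is controlled in L¹ only, but this bounds its
coefficients, as Hartley functions are bounded by 2. -/
theorem abs_coeff_le_of_ae_le {d : ℕ} {R D : L2 d} {K : ℝ}
    (h : ∀ᵐ x ∂(torusMeasure d), |R x| ≤ K * D x ^ 2) (n : Fin d → ℤ) :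
    |coeff n R| ≤ 2 * K * ‖D‖ ^ 2 := by
  have hD : Integrable (fun x => D x ^ 2) (torusMeasure d) := (Lp.memLp D).integrable_sq
  have e : ‖D‖ ^ 2 = ∫ x, D x ^ 2 ∂(torusMeasure d) := by
    rw [← real_inner_self_eq_norm_sq, inner_eq_integral]
    simp only [sq]
  rw [coeff_eq_integral, e, ← integral_const_mul, ← Real.norm_eq_abs]
  refine norm_integral_le_of_norm_le (hD.const_mul _) ?_
  filter_upwards [h] with x hx
  rw [norm_mul, mul_assoc]
  exact mul_le_mul (abs_hartley_le n x) hx (abs_nonneg _) (by norm_num)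

/-- The remainder in the linearization of the superposition operator. -/
theorem abs_coeff_superpose_remainder_le {d : ℕ} {f : ℝ → ℝ} (hf : Differentiable ℝ f) {C K : ℝ}
    (hC : ∀ x, ‖f x‖ ≤ C) (hK : ∀ x y, |deriv f x - deriv f y| ≤ K * |x - y|) {v w : L2 d}
    {V : C(Torus d, ℝ)} (hV : ∀ᵐ x ∂(torusMeasure d), V x = deriv f (v x)) (n : Fin d → ℤ) :
    |coeff n (superpose f w - superpose f v - mulL2 V (w - v))| ≤ 2 * K * ‖w - v‖ ^ 2 := by
  apply abs_coeff_le_of_ae_le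
  filter_upwards [hV, coeFn_superpose hf.continuous hC w, coeFn_superpose hf.continuous hC v,
    coeFn_mulL2 V (w - v), Lp.coeFn_sub w v, Lp.coeFn_sub (superpose f w) (superpose f v),
    Lp.coeFn_sub (superpose f w - superpose f v) (mulL2 V (w - v))] with x h1 h2 h3 h4 h5 h6 h7
  rw [h7, Pi.sub_apply, h6, Pi.sub_apply, h4, h2, h3, h5, Pi.sub_apply, h1, ← sq_abs (w x - v x)]
  exact abs_taylor_remainder_le hf hK _ _

/-- An estimate for `w' - Δw = V w + R`, `w(0) = 0`, in terms of the Fourier coefficients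
of `R`. -/
theorem norm_sq_le_of_coeff_eq {d : ℕ} (hd : d ≤ 3) {T K Z : ℝ} {A R w : ℝ → L2 d}
    (hw : Continuous w) (hA : Continuous A) (hR : Continuous R) (hAK : ∀ s, ‖A s‖ ≤ K * ‖w s‖)
    (hRZ : ∀ s ∈ Icc 0 T, ∀ n, |coeff n (R s)| ≤ Z)
    (h : ∀ t ∈ Icc 0 T, ∀ n, coeff n (w t)
      = duhamel (laplaceEigenvalue n) 0 (fun s => coeff n (A s)) t
        + duhamel (laplaceEigenvalue n) 0 (fun s => coeff n (R s)) t) :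
    ∀ t ∈ Icc 0 T, ‖w t‖ ^ 2
      ≤ 2 * (Z * (1 + T)) ^ 2 * (∑' n : Fin d → ℤ, ((1 + laplaceEigenvalue n) ^ 2)⁻¹)
        * Real.exp (2 * (1 + T) * K ^ 2 * T) := by
  intro t ht
  have hT : 0 ≤ T := ht.1.trans ht.2
  have hpos : ∀ n : Fin d → ℤ, 0 ≤ ((1 + laplaceEigenvalue n) ^ 2)⁻¹ := fun n => by positivity
  refine le_exp_of_le_integral (y := fun t => ‖w t‖ ^ 2) (by fun_prop)
    (mul_nonneg (by positivity) (tsum_nonneg hpos)) (by positivity) (fun t ht => ?_) t ht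
  apply norm_sq_le_of_sum_le
  intro S
  -- The part driven by `A` is left to Gronwall; the part driven by `R` has merely bounded source
  -- coefficients and is summed by means of the squared gain (1+λ_n)^(-2).
  have hc : ∀ n, coeff n (w t) ^ 2 ≤ 2 * (1 + T) * (∫ s in 0..t, coeff n (A s) ^ 2)
      + 2 * (Z * (1 + T)) ^ 2 * ((1 + laplaceEigenvalue n) ^ 2)⁻¹ := by
    intro n
    have hl := laplaceEigenvalue_nonneg n
    have h1 := duhamel_zero_sq_le' hl (continuous_coeff hA n) ht.1 ht.2
    have h2 := abs_duhamel_zero_le hl (continuous_coeff hR n) ht.1 ht.2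
      fun s hs => hRZ s ⟨hs.1, hs.2.trans ht.2⟩ n
    rw [h t ht n]
    set a := duhamel (laplaceEigenvalue n) 0 (fun s => coeff n (A s)) t
    set b := duhamel (laplaceEigenvalue n) 0 (fun s => coeff n (R s)) t
    have h3 : a ^ 2 ≤ (1 + laplaceEigenvalue n) * a ^ 2 :=
      le_mul_of_one_le_left (sq_nonneg a) (by linarith)
    have h4 : b ^ 2 ≤ (Z * (1 + T)) ^ 2 * ((1 + laplaceEigenvalue n) ^ 2)⁻¹ := by
      rw [← div_eq_mul_inv, ← div_pow, ← sq_abs b]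
      exact pow_le_pow_left₀ (abs_nonneg b) h2 2
    nlinarith [sq_nonneg (a - b)]
  have h5 : ∫ s in 0..t, ‖A s‖ ^ 2 ≤ ∫ s in 0..t, K ^ 2 * ‖w s‖ ^ 2 := by
    apply intervalIntegral.integral_mono_on ht.1 (Continuous.intervalIntegrable (by fun_prop) _ _)
      (Continuous.intervalIntegrable (by fun_prop) _ _)
    intro s _
    rw [← mul_pow]
    exact pow_le_pow_left₀ (norm_nonneg _) (hAK s) 2
  rw [intervalIntegral.integral_const_mul] at h5
  have h6 := (sum_integral_coeff_sq_le hA ht.1 S).trans h5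
  have h7 := (summable_weight_inv_sq hd).sum_le_tsum S fun n _ => hpos n
  refine (Finset.sum_le_sum fun n _ => hc n).trans ?_
  rw [Finset.sum_add_distrib, ← Finset.mul_sum, ← Finset.mul_sum]
  have h8 := mul_le_mul_of_nonneg_left h6 (by positivity : (0 : ℝ) ≤ 2 * (1 + T))
  have h9 := mul_le_mul_of_nonneg_left h7 (by positivity : (0 : ℝ) ≤ 2 * (Z * (1 + T)) ^ 2)
  linarith

/-- The quadratic estimate for the linearization of the reaction-diffusion equation. -/
theorem exists_norm_linearization_le {d : ℕ} (hd : d ≤ 3) {f : ℝ → ℝ} (hf : ContDiff ℝ ∞ f)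
    (hfc : HasCompactSupport f) {T K : ℝ} :
    ∃ C : ℝ, 0 < C ∧ ∀ {θ h : L2 d} {u₀ u₁ U : ℝ → L2 d} {V : ℝ → C(Torus d, ℝ)},
      Continuous u₀ → Continuous u₁ → Continuous U → Continuous V →
      (∀ t ∈ Icc 0 T, ∀ᵐ x ∂(torusMeasure d), V t x = deriv f (u₀ t x)) →
      (∀ t x, |V t x| ≤ K) →
      IsMild T (fun s => superpose f (u₀ s)) θ u₀ →
      IsMild T (fun s => superpose f (u₁ s)) (θ + h) u₁ →
      IsMild T (fun s => mulL2 (V s) (U s)) h U →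
      ∀ t ∈ Icc 0 T, ‖u₁ t - u₀ t - U t‖ ≤ C * ‖h‖ ^ 2 := by
  obtain ⟨B, hB⟩ := hf.continuous.bounded_above_of_compact_support hfc
  obtain ⟨L, hL⟩ := exists_lipschitz_of_hasCompactSupport hf hfc
  obtain ⟨K₂, hK₂⟩ := exists_lipschitz_of_hasCompactSupport (contDiff_infty_iff_deriv.1 hf).2
    hfc.deriv
  have hK₂0 : 0 ≤ K₂ := by simpa using (abs_nonneg _).trans (hK₂ 1 0)
  -- The Gronwall factor in the stability estimate ‖u₁ - u₀‖² ≤ 2 E ‖h‖².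
  set E : ℝ := Real.exp (2 * (1 + T) * L ^ 2 * T)
  -- The constant of `norm_sq_le_of_coeff_eq` for Z = 4 K₂ E ‖h‖² with ‖h‖⁴ removed; the 4 combines
  -- the 2 in the coefficient bound with the 2 in the stability estimate.
  set Q : ℝ := 2 * (4 * K₂ * E * (1 + T)) ^ 2
    * (∑' n : Fin d → ℤ, ((1 + laplaceEigenvalue n) ^ 2)⁻¹) * Real.exp (2 * (1 + T) * K ^ 2 * T)
  have hQ : 0 ≤ Q := mul_nonneg (mul_nonneg (by positivity) (tsum_nonneg fun n => by positivity))
    (Real.exp_pos _).le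
  refine ⟨√Q + 1, by positivity, fun {θ h u₀ u₁ U V} hu₀ hu₁ hU hV hVf hVK h₀ h₁ h₂ t ht => ?_⟩
  have hs : ∀ {v : ℝ → L2 d}, Continuous v → Continuous fun s => superpose f (v s) := fun hv =>
    (continuous_superpose hf.continuous hB hL).comp hv
  have hm : ∀ {v : ℝ → L2 d}, Continuous v → Continuous fun s => mulL2 (V s) (v s) := fun hv =>
    (mulL2.continuous.comp hV).clm_apply hv
  have hw : Continuous fun s => u₁ s - u₀ s - U s := (hu₁.sub hu₀).sub hU
  have hR : Continuous fun s => superpose f (u₁ s) - superpose f (u₀ s)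
      - mulL2 (V s) (u₁ s - u₀ s) :=
    ((hs hu₁).sub (hs hu₀)).sub (hm (hu₁.sub hu₀))
  have hD := h₁.norm_sub_sq_le h₀ (hs hu₁) (hs hu₀) hu₁ hu₀ fun s _ =>
    norm_superpose_sub_le hf.continuous hB hL _ _
  rw [add_sub_cancel_left] at hD
  have key := norm_sq_le_of_coeff_eq hd (Z := 4 * K₂ * E * ‖h‖ ^ 2) hw (hm hw) hR
    (fun s => norm_mulL2_le (hVK s) _) (fun s hs n => ?_) (fun t ht n => ?_) t ht
  · have hC : ‖u₁ t - u₀ t - U t‖ ^ 2 ≤ (√Q * ‖h‖ ^ 2) ^ 2 := by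
      rw [mul_pow, Real.sq_sqrt hQ]
      refine key.trans_eq ?_
      simp only [Q]
      ring
    have := abs_le_of_sq_le_sq hC (by positivity)
    rw [abs_of_nonneg (norm_nonneg _)] at this
    nlinarith [sq_nonneg ‖h‖]
  · refine (abs_coeff_superpose_remainder_le (hf.differentiable (by simp)) hB hK₂ (hVf s hs)
      n).trans ?_
    have := mul_le_mul_of_nonneg_left (hD s hs) (by positivity : 0 ≤ 2 * K₂)
    linarith
  -- The three Duhamel formulas combine because f(u₁) - f(u₀) - V U = V w + R, and the initial
  -- values cancel.
  · have e := duhamel_sub (laplaceEigenvalue n) (coeff n (θ + h)) (coeff n θ)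
      (continuous_coeff (hs hu₁) n) (continuous_coeff (hs hu₀) n) t
    have e' := duhamel_sub (laplaceEigenvalue n) (coeff n (θ + h) - coeff n θ) (coeff n h)
      (g := fun s => coeff n (superpose f (u₁ s)) - coeff n (superpose f (u₀ s)))
      ((continuous_coeff (hs hu₁) n).sub (continuous_coeff (hs hu₀) n))
      (continuous_coeff (hm hU) n) t
    rw [map_sub, map_sub, h₁ t ht n, h₀ t ht n, h₂ t ht n]
    rw [← e, ← e',
      ← duhamel_add _ _ _ (continuous_coeff (hm hw) n) (continuous_coeff hR n)]
    simp only [map_add, map_sub, add_sub_cancel_left, sub_self, add_zero]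
    congr 1
    funext s
    ring

end

/-! ### Well-posedness of both equations and the main theorem -/

noncomputable section

/-- Well-posedness of the reaction-diffusion equation, with persistence of `H^γ` regularity. -/
theorem exists_isReactionDiffusionSolution {d : ℕ} (hd : d ≤ 3) {f : ℝ → ℝ} (hf : ContDiff ℝ ∞ f)
    (hfc : HasCompactSupport f) {T : ℝ} (hT : 0 ≤ T) {γ M₀ : ℝ} (hγ : 1 ≤ γ) {θ : L2 d}
    (hθ : HsBound γ M₀ θ) :
    ∃ u : ℝ → L2 d, Continuous u ∧ IsMild T (fun s => superpose f (u s)) θ u ∧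
      IsReactionDiffusionSolution f T θ u ∧
      ∃ M : ℝ, ∀ t ∈ Icc 0 T, sobolevNorm γ (u t) ≤ ENNReal.ofReal M := by
  obtain ⟨B, hB⟩ := hf.continuous.bounded_above_of_compact_support hfc
  obtain ⟨L, hL⟩ := exists_lipschitz_of_hasCompactSupport hf hfc
  obtain ⟨u, hu, hm, hs, huniq⟩ := exists_strong_solution hT (N := fun _ => superpose f)
    (F := fun _ g x => f (g x))
    ((continuous_superpose (d := d) hf.continuous hB hL).comp continuous_snd)
    (fun _ g h => norm_superpose_sub_le hf.continuous hB hL g h)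
    (fun _ _ g => (coeFn_superpose hf.continuous hB g).symm) (hθ.mono hγ le_rfl)
  obtain ⟨M, hM⟩ := hm.exists_hsBound_of_superpose hd hf hfc hu hθ
  exact ⟨u, hu, hm, ⟨hs, huniq⟩, √M, fun t ht => (hM t ht).sobolevNorm_le⟩

/-- Well-posedness of the linear Schrödinger equation with a continuous potential. -/
theorem exists_isSchrodingerSolution {d : ℕ} {T K M : ℝ} (hT : 0 ≤ T) {V : ℝ → Torus d → ℝ}
    {Vc : ℝ → C(Torus d, ℝ)} (hVc : Continuous Vc) (hK : ∀ t x, |Vc t x| ≤ K)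
    (hV : ∀ t ∈ Icc 0 T, ∀ᵐ x ∂(torusMeasure d), Vc t x = V t x) {h : L2 d} (hh : HsBound 1 M h) :
    ∃ U : ℝ → L2 d, Continuous U ∧ IsMild T (fun s => mulL2 (Vc s) (U s)) h U ∧
      IsSchrodingerSolution V T h U := by
  obtain ⟨U, hU, hm, hs, huniq⟩ := exists_strong_solution hT (N := fun t g => mulL2 (Vc t) g)
    (F := fun t g x => V t x * g x)
    ((mulL2.continuous.comp (hVc.comp continuous_fst)).clm_apply continuous_snd)
    (fun t g h => by simpa only [map_sub] using norm_mulL2_le (hK t) (g - h))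
    (fun t ht g => by
      filter_upwards [hV t ht, coeFn_mulL2 (Vc t) g] with x h1 h2
      rw [h2, h1]) hh
  exact ⟨U, hU, hm, hs.toIsWeakSolution, huniq⟩

end

theorem theorem3p4 (d : ℕ) (hd : 1 ≤ d) (hd3 : d ≤ 3)
    (f : ℝ → ℝ) (hf : ContDiff ℝ ∞ f) (hfc : HasCompactSupport f)
    (T : ℝ) (hT : 0 < T) (γ : ℝ) (hγ : max 1 ((d : ℝ) / 2) < γ)
    (θ₀ : L2 d) (hθ₀ : ∃ φ : Torus d → ℝ, IsSmooth φ ∧ θ₀ =ᵐ[torusMeasure d] φ) :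
    ∃ u₀ : ℝ → L2 d,
      IsReactionDiffusionSolution f T θ₀ u₀ ∧
      (∃ M : ℝ, ∀ t ∈ Icc 0 T, sobolevNorm γ (u₀ t) ≤ ENNReal.ofReal M) ∧
      IsC1Infty T (fun t x => deriv f (u₀ t x)) ∧
      ∀ B : ℝ, ∃ C : ℝ, 0 < C ∧
        ∀ h : L2 d, sobolevNorm γ h < ⊤ → sobolevNorm γ (θ₀ + h) ≤ ENNReal.ofReal B →
          ∃ u₁ U : ℝ → L2 d,
            IsReactionDiffusionSolution f T (θ₀ + h) u₁ ∧
            (∃ M : ℝ, ∀ t ∈ Icc 0 T, sobolevNorm γ (u₁ t) ≤ ENNReal.ofReal M) ∧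
            IsSchrodingerSolution (fun t x => deriv f (u₀ t x)) T h U ∧
            ∀ t ∈ Icc 0 T, ‖u₁ t - u₀ t - U t‖ ≤ C * ‖h‖ ^ 2 := by
  have hγ1 : 1 ≤ γ := (le_max_left _ _).trans hγ.le
  obtain ⟨φ, hφ, hθφ⟩ := hθ₀
  have e : θ₀ = hφ.toL2 := Lp.ext (hθφ.trans hφ.coeFn_toL2.symm)
  have hθ : ∀ s, ∃ M, HsBound s M θ₀ := fun s => e ▸ exists_hsBound_of_isSmooth hφ s
  obtain ⟨M₀, hM₀⟩ := hθ γ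
  obtain ⟨u₀, hu₀, hm₀, hs₀, hb₀⟩ := exists_isReactionDiffusionSolution hd3 hf hfc hT.le hγ1 hM₀
  obtain ⟨W, hW, huW⟩ := hm₀.exists_isSpaceTimeSmooth hd3 hf hfc hT.le hu₀ hθ
  have hf' : ContDiff ℝ ∞ (deriv f) := (contDiff_infty_iff_deriv.1 hf).2
  have hVW : ∀ t ∈ Icc 0 T,
      (fun x => deriv f (u₀ t x)) =ᵐ[torusMeasure d] fun x => deriv f (W t x) := by
    intro t ht
    filter_upwards [huW t ht] with x hx
    rw [hx]
  refine ⟨u₀, hs₀, hb₀, isC1Infty_of_isSpaceTimeSmooth hVW fun m => (hW m).comp hf',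
    fun B => ?_⟩
  obtain ⟨K, hK⟩ := hf'.continuous.bounded_above_of_compact_support hfc.deriv
  -- The smooth representative W turns the potential into a continuous curve in C(Ω), so that
  -- multiplication by it is a bounded operator on L², continuous in time.
  let Vc : C(ℝ, C(Torus d, ℝ)) :=
    ContinuousMap.curry ⟨fun p => deriv f (W p.1 p.2), hf'.continuous.comp (hW 0).2.1⟩
  have hVcK : ∀ t x, |Vc t x| ≤ K := fun t x => hK _
  have hVc : ∀ t ∈ Icc 0 T, ∀ᵐ x ∂(torusMeasure d), Vc t x = deriv f (u₀ t x) :=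
    fun t ht => (hVW t ht).symm
  -- This constant depends on d, f, T and K only, so it serves for every B.
  obtain ⟨C, hC, hlin⟩ := exists_norm_linearization_le (d := d) (T := T) (K := K) hd3 hf hfc
  refine ⟨C, hC, fun h hh hB => ?_⟩
  obtain ⟨M₁, hM₁⟩ := exists_hsBound_of_sobolevNorm_lt_top (hB.trans_lt ENNReal.ofReal_lt_top)
  obtain ⟨M₂, hM₂⟩ := exists_hsBound_of_sobolevNorm_lt_top hh
  obtain ⟨u₁, hu₁, hm₁, hs₁, hb₁⟩ := exists_isReactionDiffusionSolution hd3 hf hfc hT.le hγ1 hM₁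
  obtain ⟨U, hU, hmU, hsU⟩ := exists_isSchrodingerSolution hT.le
    (V := fun t x => deriv f (u₀ t x)) Vc.continuous hVcK hVc (hM₂.mono hγ1 le_rfl)
  exact ⟨u₁, U, hs₁, hb₁, hsU, hlin hu₀ hu₁ hU Vc.continuous hVc hVcK hm₀ hm₁ hmU⟩
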